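/- **Conventions.** $\Sigma=\{0,1\}$. A promise problem is a pair $A=(A_{\rm yes},A_{\rm no})$ of disjoint subsets of $\Sigma^*$. A function $f:\mathbb N\to\mathbb N$ is *polynomial-bounded* if a deterministic polynomial-time Turing machine outputs $1^{f(n)}$ on input $1^n$ for every $n$. Quantum circuits are acyclic networks of Toffoli gates $|a,b,c\rangle\mapsto|a,b,c\oplus ab\rangle$, Hadamard gates $|a\rangle\mapsto\frac{1}{\sqrt2}(|0\rangle+(-1)^a|1\rangle)$, phase gates $|a\rangle\mapsto i^a|a\rangle$, ancillary gates (which create a qubit in state $|0\rangle$) and erasure gates (which trace out a qubit); a circuit is *unitary* if it uses only the first three kinds of gates. A family of circuits $\{Q_n : n\in\mathbb N\}$ is *polynomial-time generated* if a deterministic polynomial-time Turing machine outputs an encoding of $Q_n$ on input $1^n$ for every $n$, where circuits are encoded by binary strings injectively and efficiently, and the length of an encoding is at least the size (gates plus wires) of the circuit. A promise problem $A$ is in $\mathrm{BQP}$ if there is a polynomial-time generated family of quantum circuits $\{Q_n\}$, where $Q_n$ has $n$ input qubits and one output qubit, such that $\Pr[Q\text{ accepts }x]\ge 2/3$ for $x\in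 A_{\rm yes}$ and $\Pr[Q\text{ accepts }x]\le 1/3$ for $x\in A_{\rm no}$. Here $Q$ accepts $x$ if $Q_{|x|}$ is applied to $|x\rangle\langle x|$ and the output qubit, measured in the standard basis, gives the outcome $0$, and rejects if it gives $1$ (exchanging the two outcomes defines the same class). **Theorem (BQP subroutine theorem).** Suppose $A=(A_{\rm yes},A_{\rm no})$ is a promise problem in $\mathrm{BQP}$. Then for every polynomial-bounded function $p$ there exist a polynomial-bounded function $q$ and a polynomial-time generated family of unitary quantum circuits $\{R_n : n\in\mathbb N\}$ with the following properties. 1. Each circuit $R_n$ implements a unitary operation $U_n$ (the product of its gates) on $n+q(n)+1$ qubits. 2. For every $x\in A_{\rm yes}$ and $a\in\Sigma$, with $n=|x|$ and $m=q(n)$, the number $\langle x,0^m,a\oplus1|U_n|x,0^m,a\rangle$ is real and $$\langle x,0^m,a\oplus 1|U_n|x,0^m,a\rangle\ \ge\ 1-2^{-p(n)}.$$ 3. For every $x\in A_{\rm no}$ and $a\in\Sigma$, with $n=|x|$ and $m=q(n)$, the number $\langle x,0^m,a|U_n|x,0^m,a\rangle$ is real and $$\langle x,0^m,a|U_n|x,0^m,a\rangle\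 \ge\ 1-2^{-p(n)}.$$ -/

import Mathlib

noncomputable section

namespace QCirc

/-! ### Promise problems and polynomial-time computation -/

/-- A promise problem over the alphabet `{0,1}`. -/
structure PromiseProblem where
  yes : Set (List Bool)
  no : Set (List Bool)
  disjoint : Disjoint yes no

/-- `f : ℕ → ℕ` is polynomial-bounded: some deterministic polynomial-time Turing machine
outputs `1^(f n)` on input `1^n`, for every `n`. -/
def PolyBounded (f : ℕ → ℕ) : Prop :=
  Nonempty (Turing.TM2ComputableInPolyTime
    Computability.unaryEncodeNat Computability.unaryEncodeNat f)

/-- Some deterministic polynomial-time Turing machine outputs the binary string `F n`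
on input `1^n`, for every `n`. -/
def PolyTimeStrings (F : ℕ → List Bool) : Prop :=
  Nonempty (Turing.TM2ComputableInPolyTime
    Computability.unaryEncodeNat (id : List Bool → List Bool) F)

/-! ### Gates

A circuit is written as the list of its gates in a topological order.  Wires are traced through
the unitary gates and carry natural-number labels: the `n` input qubits have the labels
`0, …, n-1`, and the qubits created by the ancillary gates get the labels `n, n+1, …`
in the order of creation.  `L : Finset ℕ` is always the set of labels of the qubits present, and
`N` is the next unused label. -/

/-- Labels of the standard basis states of the qubits in `L`. -/
abbrev Reg (L : Finset ℕ) : Type := L → Bool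

/-- The bit on wire `w` (and `false` if there is no such wire). -/
def Reg.bit {L : Finset ℕ} (x : Reg L) (w : ℕ) : Bool :=
  if h : w ∈ L then x ⟨w, h⟩ else false

/-- The unitary gates, with the wires they act on. -/
inductive UGate where
  /-- `|a⟩|b⟩|c⟩ ↦ |a⟩|b⟩|c ⊕ ab⟩` -/
  | toffoli (a b c : ℕ)
  /-- `|a⟩ ↦ (|0⟩ + (-1)^a |1⟩) / √2` -/
  | hadamard (a : ℕ)
  /-- `|a⟩ ↦ i^a |a⟩` -/
  | phase (a : ℕ)
  deriving DecidableEq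

/-- The gates of the universal gate set. -/
inductive Gate where
  | unitary (u : UGate)
  /-- Create a fresh qubit in state `|0⟩`. -/
  | ancilla
  /-- Trace out the qubit on wire `a`. -/
  | erase (a : ℕ)
  deriving DecidableEq

/-- The wires a unitary gate uses are present and pairwise distinct. -/
def UGate.Valid (L : Finset ℕ) : UGate → Prop
  | toffoli a b c => a ∈ L ∧ b ∈ L ∧ c ∈ L ∧ a ≠ b ∧ a ≠ c ∧ b ≠ c
  | hadamard a => a ∈ L
  | phase a => a ∈ L

/-- The unitary matrix of a unitary gate, acting on all qubits in `L`.  Row index `y`,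
column index `x`, so the entry is `⟨y|U|x⟩`. -/
def UGate.matrix (L : Finset ℕ) : UGate → Matrix (Reg L) (Reg L) ℂ
  | toffoli a b c => Matrix.of fun y x =>
      if ∀ w ∈ L, y.bit w = xor (x.bit w) (decide (w = c) && (x.bit a && x.bit b)) then 1 else 0
  | hadamard a => Matrix.of fun y x =>
      if ∀ w ∈ L, w ≠ a → y.bit w = x.bit w then
        ((1 / Real.sqrt 2 : ℝ) : ℂ) * (if x.bit a && y.bit a then -1 else 1)
      else 0
  | phase a => Matrix.of fun y x =>
      if y = x then (if x.bit a then Complex.I else 1) else 0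

/-- The isometry `|x⟩ ↦ |x⟩|0⟩` that adds the qubit `N`. -/
def addZero (N : ℕ) (L : Finset ℕ) : Matrix (Reg (insert N L)) (Reg L) ℂ :=
  Matrix.of fun y x => if (∀ w ∈ L, y.bit w = x.bit w) ∧ y.bit N = false then 1 else 0

/-- The operator `⟨b|` applied to the qubit `a` and the identity on the other qubits. -/
def project (a : ℕ) (b : Bool) (L : Finset ℕ) : Matrix (Reg (L.erase a)) (Reg L) ℂ :=
  Matrix.of fun y x => if (∀ w ∈ L.erase a, y.bit w = x.bit w) ∧ x.bit a = b then 1 else 0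

namespace Gate

/-- The next unused label after the gate. -/
def next (N : ℕ) : Gate → ℕ
  | unitary _ => N
  | ancilla => N + 1
  | erase _ => N

/-- The qubits present after the gate. -/
def live (N : ℕ) (L : Finset ℕ) : Gate → Finset ℕ
  | unitary _ => L
  | ancilla => insert N L
  | erase a => L.erase a

def Valid (L : Finset ℕ) : Gate → Prop
  | unitary u => u.Valid L
  | ancilla => True
  | erase a => a ∈ L

open scoped Matrix in
/-- The quantum operation of a gate, as a map on operators. -/
def apply (N : ℕ) (L : Finset ℕ) : (g : Gate) →
    Matrix (Reg L) (Reg L) ℂ → Matrix (Reg (g.live N L)) (Reg (g.live N L)) ℂ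
  | unitary u, ρ => u.matrix L * ρ * (u.matrix L)ᴴ
  | ancilla, ρ => addZero N L * ρ * (addZero N L)ᴴ
  | erase a, ρ => ∑ b : Bool, project a b L * ρ * (project a b L)ᴴ

end Gate

/-! ### Circuits -/

/-- Every gate acts on distinct qubits that are present when it is applied. -/
def ValidList : List Gate → ℕ → Finset ℕ → Prop
  | [], _, _ => True
  | g :: gs, N, L => g.Valid L ∧ ValidList gs (g.next N) (g.live N L)

/-- The qubits present after a list of gates. -/
def liveAfter : List Gate → ℕ → Finset ℕ → Finset ℕ
  | [], _, L => L
  | g :: gs, N, L => liveAfter gs (g.next N) (g.live N L)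

/-- The composition of the quantum operations of a list of gates (the head acts first). -/
def run : (gs : List Gate) → (N : ℕ) → (L : Finset ℕ) → Matrix (Reg L) (Reg L) ℂ →
    Matrix (Reg (liveAfter gs N L)) (Reg (liveAfter gs N L)) ℂ
  | [], _, _, ρ => ρ
  | g :: gs, N, L, ρ => run gs (g.next N) (g.live N L) (g.apply N L ρ)

/-- A quantum circuit with `n` input qubits and `m` output qubits.  The output qubits are
the qubits present at the end, in the order given by `outputs`. -/
structure QCircuit (n m : ℕ) where
  gates : List Gate
  outputs : Fin m → ℕ
  valid : ValidList gates n (Finset.range n)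
  outputs_injective : Function.Injective outputs
  outputs_live : Finset.univ.image outputs = liveAfter gates n (Finset.range n)

/-- The bits found on the wires `f 0, f 1, …`. -/
def readBits {L : Finset ℕ} {m : ℕ} (f : Fin m → ℕ) (x : Reg L) : Fin m → Bool :=
  fun i => x.bit (f i)

/-- The basis state with bit `u i` on the wire `f i`. -/
def loadBits {m : ℕ} (f : Fin m → ℕ) (L : Finset ℕ) (u : Fin m → Bool) : Reg L :=
  fun w => decide (∃ i, f i = w ∧ u i = true)

/-- The product of the matrices of a list of unitary gates (the head acts first). -/
def unitaryProduct (L : Finset ℕ) : List UGate → Matrix (Reg L) (Reg L) ℂ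
  | [] => 1
  | u :: us => unitaryProduct L us * u.matrix L

/-- `|x⟩⟨x|` -/
def basisState {k : ℕ} (x : Fin k → Bool) : Matrix (Fin k → Bool) (Fin k → Bool) ℂ :=
  Matrix.single x x 1

namespace QCircuit

/-- The quantum operation from `n` qubits to `m` qubits induced by a circuit. -/
def channel {n m : ℕ} (C : QCircuit n m) (ρ : Matrix (Fin n → Bool) (Fin n → Bool) ℂ) :
    Matrix (Fin m → Bool) (Fin m → Bool) ℂ :=
  (run C.gates n (Finset.range n) (ρ.submatrix (readBits Fin.val) (readBits Fin.val))).submatrix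
    (loadBits C.outputs _) (loadBits C.outputs _)

open scoped Matrix in
/-- All gates of `C` are unitary gates, `U` is the product of their matrices, `U` is unitary and
the quantum operation of `C` is `ρ ↦ U ρ U*`. -/
def ImplementsUnitary {k : ℕ} (C : QCircuit k k)
    (U : Matrix (Fin k → Bool) (Fin k → Bool) ℂ) : Prop :=
  (∃ us : List UGate, C.gates = us.map Gate.unitary ∧
    U = (unitaryProduct (Finset.range k) us).submatrix
      (loadBits C.outputs _) (loadBits Fin.val _)) ∧
  U ∈ Matrix.unitaryGroup (Fin k → Bool) ℂ ∧
  ∀ ρ, C.channel ρ = U * ρ * Uᴴ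

/-- The probability that measuring the output qubit on input `|x⟩⟨x|` gives `0`,
the outcome that means "accept". -/
def acceptProb {n : ℕ} (C : QCircuit n 1) (x : Fin n → Bool) : ℝ :=
  (C.channel (basisState x) (fun _ => false) (fun _ => false)).re

/-! ### Encoding of circuits by binary strings

A circuit is written as a sequence of natural numbers (number of inputs, number of outputs,
gates, end marker, output wires), and each number `k` as `1^k 0`. -/

/-- A gate as a sequence of numbers: a tag, then the wires. -/
def gateCode : Gate → List ℕ
  | .unitary (.toffoli a b c) => [0, a, b, c]
  | .unitary (.hadamard a) => [1, a]
  | .unitary (.phase a) => [2, a]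
  | .ancilla => [3]
  | .erase a => [4, a]

def natCode (k : ℕ) : List Bool := List.replicate k true ++ [false]

def code {n m : ℕ} (C : QCircuit n m) : List ℕ :=
  n :: m :: (C.gates.flatMap gateCode ++ 5 :: List.ofFn C.outputs)

def encode {n m : ℕ} (C : QCircuit n m) : List Bool :=
  C.code.flatMap natCode

end QCircuit

theorem natCode_append_inj (a b : ℕ) (s t : List Bool)
    (h : QCircuit.natCode a ++ s = QCircuit.natCode b ++ t) : a = b ∧ s = t := by
  induction a generalizing b with
  | zero =>
    cases b with
    | zero => simpa [QCircuit.natCode] using h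
    | succ b => simp [QCircuit.natCode, List.replicate_succ] at h
  | succ a ih =>
    cases b with
    | zero => simp [QCircuit.natCode, List.replicate_succ] at h
    | succ b =>
      have := ih b (by simpa [QCircuit.natCode, List.replicate_succ] using h)
      exact ⟨by rw [this.1], this.2⟩

theorem flatMap_natCode_inj (l l' : List ℕ)
    (h : l.flatMap QCircuit.natCode = l'.flatMap QCircuit.natCode) : l = l' := by
  induction l generalizing l' with
  | nil => cases l' <;> simp [QCircuit.natCode] at h ⊢
  | cons a l ih =>
    cases l' with
    | nil => simp [QCircuit.natCode] at h
    | cons b l' =>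
      obtain ⟨h1, h2⟩ := natCode_append_inj a b _ _ (by simpa using h)
      rw [h1, ih l' h2]

theorem gateCode_append_inj (gs gs' : List Gate) (s s' : List ℕ)
    (h : gs.flatMap QCircuit.gateCode ++ 5 :: s = gs'.flatMap QCircuit.gateCode ++ 5 :: s') :
    gs = gs' ∧ s = s' := by
  induction gs generalizing gs' with
  | nil =>
    cases gs' with
    | nil => simpa using h
    | cons g gs' => rcases g with ⟨_ | _ | _⟩ | _ | _ <;> simp [QCircuit.gateCode] at h
  | cons g gs ih =>
    cases gs' with
    | nil => rcases g with ⟨_ | _ | _⟩ | _ | _ <;> simp [QCircuit.gateCode] at h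
    | cons g' gs' =>
      have key : g = g' ∧ gs.flatMap QCircuit.gateCode ++ 5 :: s =
          gs'.flatMap QCircuit.gateCode ++ 5 :: s' := by
        rcases g with ⟨_ | _ | _⟩ | _ | _ <;> rcases g' with ⟨_ | _ | _⟩ | _ | _ <;>
          simp_all [QCircuit.gateCode]
      obtain ⟨h1, h2⟩ := ih gs' key.2
      exact ⟨by rw [key.1, h1], h2⟩

/-- A string encodes at most one circuit. -/
theorem encode_injective :
    Function.Injective (fun C : (Σ n m : ℕ, QCircuit n m) => C.2.2.encode) := by
  rintro ⟨n, m, C⟩ ⟨n', m', C'⟩ h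
  have h2 := flatMap_natCode_inj _ _ h
  simp only [QCircuit.code, List.cons.injEq] at h2
  obtain ⟨rfl, rfl, h2⟩ := h2
  obtain ⟨h3, h4⟩ := gateCode_append_inj _ _ _ _ h2
  have h5 := List.ofFn_injective h4
  cases C
  cases C'
  simp_all

/-- The number of gates plus the number of wires: each wire is an input wire or leaves a gate. -/
def QCircuit.size {n m : ℕ} (C : QCircuit n m) : ℕ :=
  C.gates.length + (n + (C.gates.map fun
    | .unitary (.toffoli _ _ _) => 3
    | .unitary (.hadamard _) => 1
    | .unitary (.phase _) => 1
    | .ancilla => 1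
    | .erase _ => 0).sum)

/-- The encoding does not compress circuits. -/
theorem QCircuit.size_le_length_encode {n m : ℕ} (C : QCircuit n m) :
    C.size ≤ C.encode.length := by
  unfold QCircuit.size QCircuit.encode QCircuit.code
  generalize C.gates = gs
  simp only [List.flatMap_cons, List.flatMap_append, List.length_append]
  induction gs with
  | nil => simp [natCode]; omega
  | cons g gs ih =>
    rcases g with ⟨_ | _ | _⟩ | _ | _ <;>
      simp [gateCode, natCode] at ih ⊢ <;> omega

/-- A family of circuits, one for each `n`, is polynomial-time generated: a deterministic
polynomial-time Turing machine outputs an encoding of the `n`-th circuit on input `1^n`. -/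
def PolyTimeGenerated {i o : ℕ → ℕ} (Q : ∀ n, QCircuit (i n) (o n)) : Prop :=
  PolyTimeStrings fun n => (Q n).encode

/-! ### BQP -/

/-- The class `BQP(a,b)`. -/
def BQPWith (a b : ℕ → ℝ) : Set PromiseProblem :=
  {A | ∃ Q : ∀ n, QCircuit n 1, PolyTimeGenerated Q ∧
    (∀ x ∈ A.yes, a x.length ≤ (Q x.length).acceptProb x.get) ∧
    (∀ x ∈ A.no, (Q x.length).acceptProb x.get ≤ b x.length)}

/-- The class `BQP`. -/
def BQP : Set PromiseProblem := BQPWith (fun _ => 2 / 3) (fun _ => 1 / 3)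

/-- The label of the basis state `|x, 0^m, a⟩` of `|x| + m + 1` qubits. -/
def queryState (x : List Bool) (m : ℕ) (a : Bool) : Fin (x.length + m + 1) → Bool :=
  Fin.snoc (α := fun _ => Bool) (Fin.append x.get (fun _ : Fin m => false)) a

end QCirc

end

open QCirc
open scoped ComplexOrder

/-!
The circuit `R n` computes the answer by running the given circuit many times, adds the answer to
the last qubit, and uncomputes everything else.  Let `D` be at least the length of the code of
`Q n` and at least `6 * p n`.  Erasure and ancillary gates are purified away: a circuit `C` acts on
its input as its unitary gates do on a register of `D` wires that starts with zeros on all ancillary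
wires, since tracing out a wire at the end instead of in the middle makes no difference
(`QSim.run_reduced`, `QSim.acceptProb_eq`).

`QSim.compute` runs these unitary gates on `2 * D` blocks of fresh wires.  The input is copied into
each block first, and the results are counted in unary, by a token on `2 * D + 1` wires that moves
one step whenever the output wire of a block carries `1`.  So the token ends at the number of
rejecting runs.  `QSim.flips` then negates the last qubit if the token is at most at `D`, and the
inverse of `QSim.compute` follows.  The matrix entry in question is `⟨Ψ|X^f|Φ⟩`, where `Φ` and `Ψ`
are the states after `compute`; grouping the basis states by the position of the token shows that
it is exactly the probability that the majority of the runs gives the answer `f`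
(`QSim.amplified_apply`), and in particular a nonnegative real number.  The runs are independent, so
the generating function of the position of the token is the `2 * D`-th power of that of one run
(`QSim.wt_app_trials`), and Chernoff's bound with `z = 2` or `z = 1/2` bounds the error by
`(8/9)^D ≤ 2⁻¹ ^ p n` (`QSim.one_sub_le_wt`).

For uniformity a stack machine has to write the code of `R n`.  Machine code is composed from
fragments with sequencing and loops (`StackProg.Frag`), whose effect on the stacks is described by
`StackProg.Frag.Runs`, including a bound on the number of steps.
`StackProg.polyTimeStrings_of_program` runs the two given machines first, one for the code of `Q n`
and one for `1^(p n)`, and hands their output to a program on binary stacks.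
`StackProg.Prog.amplify` is a program that parses the code of `Q n` once for each block and writes
the gates of `compute` on one stack and their inverses on another, so that the latter appear in the
reverse order as needed.
-/

/-! ### Structured programs for stack machines -/

namespace StackProg

open Turing Function

section Steps

variable {K : Type} [DecidableEq K] {Γ : K → Type} {Λ Λ' σ : Type}

/-- `Steps M c c' t`: the machine `M` goes from `c` to `c'` in exactly `t` steps. -/
inductive Steps (M : Λ → TM2.Stmt Γ Λ σ) : TM2.Cfg Γ Λ σ → TM2.Cfg Γ Λ σ → ℕ → Prop
  | refl (c) : Steps M c c 0
  | head {l v S c t} : Steps M (TM2.stepAux (M l) v S) c t → Steps M ⟨some l, v, S⟩ c (t + 1)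

theorem Steps.trans {M : Λ → TM2.Stmt Γ Λ σ} {c₁ c₂ c₃ : TM2.Cfg Γ Λ σ} {t t' : ℕ}
    (h : Steps M c₁ c₂ t) (h' : Steps M c₂ c₃ t') : Steps M c₁ c₃ (t + t') := by
  induction h with
  | refl c => simpa using h'
  | head _ ih => rw [Nat.add_right_comm]; exact .head (ih h')

theorem Steps.iterate {M : Λ → TM2.Stmt Γ Λ σ} {c c' : TM2.Cfg Γ Λ σ} {t : ℕ}
    (h : Steps M c c' t) : (flip bind (TM2.step M))^[t] (some c) = some c' := by
  induction h with
  | refl c => rfl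
  | head _ ih => rw [iterate_succ_apply]; exact ih

theorem Steps.of_iterate {M : Λ → TM2.Stmt Γ Λ σ} {t : ℕ} :
    ∀ {c c' : TM2.Cfg Γ Λ σ}, (flip bind (TM2.step M))^[t] (some c) = some c' →
      Steps M c c' t := by
  induction t with
  | zero => intro c c' h; obtain rfl : c = c' := by simpa using h
            exact .refl c
  | succ t ih =>
    rintro ⟨_ | l, v, S⟩ c' h
    · exfalso
      rw [iterate_succ_apply] at h
      have : ∀ t : ℕ, (flip bind (TM2.step M))^[t] none = none := by
        intro t; induction t with
        | zero => rfl
        | succ t ih => rw [iterate_succ_apply]; exact ih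
      have h2 : flip bind (TM2.step M) (some ⟨none, v, S⟩) = none := rfl
      rw [h2, this] at h
      cases h
    · rw [iterate_succ_apply] at h
      exact .head (ih h)

/-- Relabels a statement and replaces `halt` by the statement `exit`. -/
def mapStmt (f : Λ → Λ') (exit : TM2.Stmt Γ Λ' σ) : TM2.Stmt Γ Λ σ → TM2.Stmt Γ Λ' σ
  | .push k g q => .push k g (mapStmt f exit q)
  | .peek k g q => .peek k g (mapStmt f exit q)
  | .pop k g q => .pop k g (mapStmt f exit q)
  | .load g q => .load g (mapStmt f exit q)
  | .branch g q q' => .branch g (mapStmt f exit q) (mapStmt f exit q')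
  | .goto g => .goto fun v => f (g v)
  | .halt => exit

/-- The configuration of a larger machine that runs `exit` when the smaller one halts. -/
def mapCfg (f : Λ → Λ') (exit : TM2.Stmt Γ Λ' σ) (c : TM2.Cfg Γ Λ σ) : TM2.Cfg Γ Λ' σ :=
  match c.l with
  | some l => ⟨some (f l), c.var, c.stk⟩
  | none => TM2.stepAux exit c.var c.stk

theorem stepAux_mapStmt (f : Λ → Λ') (exit : TM2.Stmt Γ Λ' σ) (q : TM2.Stmt Γ Λ σ) (v : σ)
    (S : ∀ k, List (Γ k)) :
    TM2.stepAux (mapStmt f exit q) v S = mapCfg f exit (TM2.stepAux q v S) := by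
  induction q generalizing v S with
  | push _ _ _ ih => exact ih _ _
  | peek _ _ _ ih => exact ih _ _
  | pop _ _ _ ih => exact ih _ _
  | load _ _ ih => exact ih _ _
  | branch g _ _ ih ih' =>
    simp only [mapStmt, TM2.stepAux]
    cases g v
    · exact ih' _ _
    · exact ih _ _
  | goto _ => rfl
  | halt => rfl

theorem Steps.map {M : Λ → TM2.Stmt Γ Λ σ} {M' : Λ' → TM2.Stmt Γ Λ' σ} (f : Λ → Λ')
    (exit : TM2.Stmt Γ Λ' σ) (hM : ∀ l, M' (f l) = mapStmt f exit (M l))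
    {c c' : TM2.Cfg Γ Λ σ} {t : ℕ} (h : Steps M c c' t) :
    Steps M' (mapCfg f exit c) (mapCfg f exit c') t := by
  induction h with
  | refl c => exact .refl _
  | @head l v S c t _ ih =>
    rw [← stepAux_mapStmt, ← hM] at ih
    exact .head ih

end Steps

/-- A program fragment over the stacks `K`: machine code with an entry label, in which `halt`
stands for leaving the fragment.  The internal state has a component of type `Option Bool`,
which holds the last symbol that was popped. -/
structure Frag (K : Type) (Γ : K → Type) (τ : Type) where
  Λ : Type
  [fin : Fintype Λ]
  start : Λ
  stmt : Λ → TM2.Stmt Γ Λ (τ × Option Bool)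

attribute [instance] Frag.fin

namespace Frag

variable {K : Type} [DecidableEq K] {Γ : K → Type} {τ : Type}

/-- Started with stacks `S` and any internal state, `F` ends with the stacks `S'` after at most
`t` steps. -/
def Runs (F : Frag K Γ τ) (S S' : ∀ k, List (Γ k)) (t : ℕ) : Prop :=
  ∀ v, ∃ v', ∃ t' ≤ t, Steps F.stmt ⟨some F.start, v, S⟩ ⟨none, v', S'⟩ t'

theorem Runs.mono {F : Frag K Γ τ} {S S' : ∀ k, List (Γ k)} {t t' : ℕ} (h : F.Runs S S' t)
    (ht : t ≤ t') : F.Runs S S' t' := fun v => by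
  obtain ⟨v', s, hs, h⟩ := h v
  exact ⟨v', s, hs.trans ht, h⟩

theorem Runs.congr {F : Frag K Γ τ} {S S' S'' : ∀ k, List (Γ k)} {t t' : ℕ}
    (h : F.Runs S S' t) (hS : S' = S'') (ht : t ≤ t') : F.Runs S S'' t' :=
  hS ▸ h.mono ht

theorem Runs.congr' {F : Frag K Γ τ} {R R' S S' : ∀ k, List (Γ k)} {t t' : ℕ}
    (h : F.Runs R R' t) (hR : R = S) (hS : R' = S') (ht : t ≤ t') : F.Runs S S' t' :=
  hR ▸ hS ▸ h.mono ht

/-- The fragment that does nothing. -/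
def skip : Frag K Γ τ := ⟨Unit, (), fun _ => .halt⟩

theorem runs_skip (S : ∀ k, List (Γ k)) : (skip : Frag K Γ τ).Runs S S 1 :=
  fun v => ⟨v, 1, le_rfl, .head (.refl _)⟩

/-- Pushes the symbol `a` on the stack `k`. -/
def push (k : K) (a : Γ k) : Frag K Γ τ := ⟨Unit, (), fun _ => .push k (fun _ => a) .halt⟩

theorem runs_push (k : K) (a : Γ k) (S : ∀ k, List (Γ k)) :
    (push k a : Frag K Γ τ).Runs S (update S k (a :: S k)) 1 :=
  fun v => ⟨v, 1, le_rfl, .head (.refl _)⟩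

/-- Sequential composition. -/
def seq (F G : Frag K Γ τ) : Frag K Γ τ where
  Λ := F.Λ ⊕ G.Λ
  start := .inl F.start
  stmt
    | .inl l => mapStmt .inl (.goto fun _ => .inr G.start) (F.stmt l)
    | .inr l => mapStmt .inr .halt (G.stmt l)

theorem Runs.seq {F G : Frag K Γ τ} {S S' S'' : ∀ k, List (Γ k)} {t t' : ℕ}
    (hF : F.Runs S S' t) (hG : G.Runs S' S'' t') : (F.seq G).Runs S S'' (t + t') := fun v => by
  obtain ⟨v₁, t₁, ht₁, h₁⟩ := hF v
  obtain ⟨v₂, t₂, ht₂, h₂⟩ := hG v₁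
  refine ⟨v₂, t₁ + t₂, add_le_add ht₁ ht₂, ?_⟩
  exact (h₁.map (M' := (F.seq G).stmt) .inl _ fun _ => rfl).trans
    (h₂.map (M' := (F.seq G).stmt) .inr .halt fun _ => rfl)

/-- Pops a symbol from the stack `k`, reads it as `o : Option Bool` through `d`, runs `A o`, and
starts again if `cont o`. -/
def loop (k : K) (d : Option (Γ k) → Option Bool) (A : Option Bool → Frag K Γ τ)
    (cont : Option Bool → Bool) : Frag K Γ τ where
  Λ := Unit ⊕ Σ o, (A o).Λ
  start := .inl ()
  stmt
    | .inl () => .pop k (fun v o => (v.1, d o)) (.goto fun v => .inr ⟨v.2, (A v.2).start⟩)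
    | .inr ⟨o, l⟩ => mapStmt (fun l => .inr ⟨o, l⟩)
        (match cont o with
          | true => .goto fun _ => .inl ()
          | false => .halt) ((A o).stmt l)

theorem Runs.loop_exit {k : K} {d : Option (Γ k) → Option Bool} {A : Option Bool → Frag K Γ τ}
    {cont : Option Bool → Bool} {S S' : ∀ k, List (Γ k)} {t : ℕ} (o : Option Bool)
    (ho : d (S k).head? = o) (hc : cont o = false)
    (hA : (A o).Runs (update S k (S k).tail) S' t) :
    (loop k d A cont).Runs S S' (t + 1) := fun v => by
  subst ho
  obtain ⟨v', t', ht', h⟩ := hA (v.1, d (S k).head?)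
  refine ⟨v', t' + 1, by omega, .head ?_⟩
  have := h.map (M' := (loop k d A cont).stmt) (fun l => .inr ⟨_, l⟩) _ fun _ => rfl
  simp only [hc] at this
  exact this

theorem Runs.loop_cont {k : K} {d : Option (Γ k) → Option Bool} {A : Option Bool → Frag K Γ τ}
    {cont : Option Bool → Bool} {S S' S'' : ∀ k, List (Γ k)} {t t₂ : ℕ} (o : Option Bool)
    (ho : d (S k).head? = o) (hc : cont o = true)
    (hA : (A o).Runs (update S k (S k).tail) S' t) (hL : (loop k d A cont).Runs S' S'' t₂) :
    (loop k d A cont).Runs S S'' (t + 1 + t₂) := fun v => by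
  subst ho
  obtain ⟨v', t', ht', h⟩ := hA (v.1, d (S k).head?)
  obtain ⟨v₂, t₂', ht₂', h₂⟩ := hL v'
  refine ⟨v₂, t' + 1 + t₂', by omega, Steps.trans (.head ?_) h₂⟩
  have := h.map (M' := (loop k d A cont).stmt) (fun l => .inr ⟨_, l⟩) _ fun _ => rfl
  simp only [hc] at this
  exact this

end Frag

/-! ### Running a machine inside a larger one -/

section Embed

variable {K K' : Type} [DecidableEq K] [DecidableEq K'] {Γ : K → Type} {Γ' : K' → Type}
  {Λ σ σ' : Type}

/-- Reads a statement over the stacks `K` as one over the stacks `K'`, where the stack `k` becomes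
`e k` and the state is the component of the new state described by `get` and `set`. -/
def embedStmt (e : K → K') (φ : ∀ k, Γ k ≃ Γ' (e k)) (get : σ' → σ) (set : σ' → σ → σ') :
    TM2.Stmt Γ Λ σ → TM2.Stmt Γ' Λ σ'
  | .push k g q => .push (e k) (fun v => φ k (g (get v))) (embedStmt e φ get set q)
  | .peek k g q => .peek (e k) (fun v o => set v (g (get v) (o.map (φ k).symm)))
      (embedStmt e φ get set q)
  | .pop k g q => .pop (e k) (fun v o => set v (g (get v) (o.map (φ k).symm)))
      (embedStmt e φ get set q)
  | .load g q => .load (fun v => set v (g (get v))) (embedStmt e φ get set q)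
  | .branch g q q' => .branch (fun v => g (get v)) (embedStmt e φ get set q)
      (embedStmt e φ get set q')
  | .goto g => .goto fun v => g (get v)
  | .halt => .halt

/-- The stacks `S'` of the larger machine show the stacks `S` of the embedded machine, and agree
with `B` on all other stacks. -/
def Shows (e : K → K') (φ : ∀ k, Γ k ≃ Γ' (e k)) (B S' : ∀ k, List (Γ' k))
    (S : ∀ k, List (Γ k)) : Prop :=
  (∀ k, S' (e k) = (S k).map (φ k)) ∧ ∀ k', (∀ k, e k ≠ k') → S' k' = B k'

theorem Shows.update {e : K → K'} (he : Injective e) {φ : ∀ k, Γ k ≃ Γ' (e k)}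
    {B S' : ∀ k, List (Γ' k)} {S : ∀ k, List (Γ k)} (h : Shows e φ B S' S) (k : K)
    {l' : List (Γ' (e k))} {l : List (Γ k)} (hl : l' = l.map (φ k)) :
    Shows e φ B (update S' (e k) l') (update S k l) := by
  subst hl
  refine ⟨fun j => ?_, fun k' hk' => ?_⟩
  · by_cases hj : j = k
    · subst hj; simp
    · rw [update_of_ne hj, update_of_ne (he.ne hj), h.1]
  · rw [update_of_ne (hk' k).symm, h.2 _ hk']

/-- The stacks outside the image of `e` and the part of the state not seen by `get` are never
touched, so one step of the larger machine shows one step of the embedded one. -/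
theorem stepAux_embedStmt {e : K → K'} (he : Injective e) (φ : ∀ k, Γ k ≃ Γ' (e k))
    {get : σ' → σ} {set : σ' → σ → σ'} (hgs : ∀ v x, get (set v x) = x) {B : ∀ k, List (Γ' k)}
    (q : TM2.Stmt Γ Λ σ) (v' : σ') (S : ∀ k, List (Γ k)) (S' : ∀ k, List (Γ' k))
    (h : Shows e φ B S' S) :
    ∃ w' T', TM2.stepAux (embedStmt e φ get set q) v' S' =
        ⟨(TM2.stepAux q (get v') S).l, w', T'⟩ ∧
      get w' = (TM2.stepAux q (get v') S).var ∧ Shows e φ B T' (TM2.stepAux q (get v') S).stk := by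
  have hhead : ∀ k, (S' (e k)).head?.map (φ k).symm = (S k).head? := fun k => by
    rw [h.1]; cases S k <;> simp
  induction q generalizing v' S S' with
  | push k g q ih =>
    simp only [embedStmt, TM2.stepAux]
    have h2 := h.update he k (l' := φ k (g (get v')) :: S' (e k)) (l := g (get v') :: S k)
      (by simp [h.1])
    exact ih _ _ _ h2 fun k => by rw [h2.1]; cases Function.update S _ _ k <;> simp
  | peek k g q ih =>
    simp only [embedStmt, TM2.stepAux]
    have := ih (set v' (g (get v') ((S' (e k)).head?.map (φ k).symm))) _ _ h hhead
    simp only [hgs, hhead] at this ⊢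
    exact this
  | pop k g q ih =>
    simp only [embedStmt, TM2.stepAux]
    have h2 := h.update he k (l' := (S' (e k)).tail) (l := (S k).tail) (by simp [h.1])
    have := ih (set v' (g (get v') ((S' (e k)).head?.map (φ k).symm))) _ _ h2
      fun k => by rw [h2.1]; cases Function.update S _ _ k <;> simp
    simp only [hgs, hhead] at this ⊢
    exact this
  | load g q ih =>
    simp only [embedStmt, TM2.stepAux]
    have := ih (set v' (g (get v'))) _ _ h hhead
    simp only [hgs] at this ⊢
    exact this
  | branch g q q' ih ih' =>
    simp only [embedStmt, TM2.stepAux]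
    cases g (get v')
    · exact ih' _ _ _ h hhead
    · exact ih _ _ _ h hhead
  | goto g => exact ⟨v', S', rfl, rfl, h⟩
  | halt => exact ⟨v', S', rfl, rfl, h⟩

theorem Steps.embed {e : K → K'} (he : Injective e) (φ : ∀ k, Γ k ≃ Γ' (e k))
    {get : σ' → σ} {set : σ' → σ → σ'} (hgs : ∀ v x, get (set v x) = x) {B : ∀ k, List (Γ' k)}
    {M : Λ → TM2.Stmt Γ Λ σ} {c c' : TM2.Cfg Γ Λ σ} {t : ℕ} (hs : Steps M c c' t)
    (v' : σ') (hv : get v' = c.var) (S' : ∀ k, List (Γ' k)) (h : Shows e φ B S' c.stk) :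
    ∃ w' T', Steps (fun l => embedStmt e φ get set (M l)) ⟨c.l, v', S'⟩ ⟨c'.l, w', T'⟩ t ∧
      Shows e φ B T' c'.stk := by
  induction hs generalizing v' S' with
  | refl c => exact ⟨v', S', .refl _, h⟩
  | @head l v S c t _ ih =>
    obtain rfl : get v' = v := hv
    obtain ⟨w, T, h1, h2, h3⟩ := stepAux_embedStmt he φ hgs (M l) v' S S' h
    obtain ⟨w', T', h4, h5⟩ := ih w h2 T h3
    refine ⟨w', T', .head ?_, h5⟩
    rw [h1]
    exact h4

variable {τ : Type}

/-- The machine `tm` as a fragment: its internal state is reset to the initial one at the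
start. -/
def Frag.ofMachine (tm : FinTM2) (e : tm.K → K') (φ : ∀ k, tm.Γ k ≃ Γ' (e k))
    (get : τ × Option Bool → tm.σ) (set : τ × Option Bool → tm.σ → τ × Option Bool) :
    Frag K' Γ' τ where
  Λ := Unit ⊕ tm.Λ
  fin := haveI := tm.ΛFin; inferInstance
  start := .inl ()
  stmt
    | .inl () => .load (fun v => set v tm.initialState) (.goto fun _ => .inr tm.main)
    | .inr l => mapStmt .inr .halt (embedStmt e φ get set (tm.m l))

/-- A machine that turns `s` into `s'` runs as a fragment: it finds its stacks empty except for the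
input, and leaves them empty except for the output. -/
theorem Frag.runs_ofMachine (tm : FinTM2) {e : tm.K → K'} (he : Injective e)
    (φ : ∀ k, tm.Γ k ≃ Γ' (e k)) {get : τ × Option Bool → tm.σ}
    {set : τ × Option Bool → tm.σ → τ × Option Bool} (hgs : ∀ v x, get (set v x) = x)
    {s : List (tm.Γ tm.k₀)} {s' : List (tm.Γ tm.k₁)} {t : ℕ}
    (h : Nonempty (TM2OutputsInTime tm s (some s') t)) {B S S' : ∀ k, List (Γ' k)}
    (hS : Shows e φ B S (initList tm s).stk) (hS' : Shows e φ B S' (haltList tm s').stk) :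
    (Frag.ofMachine tm e φ get set).Runs S S' (t + 1) := fun v => by
  obtain ⟨⟨⟨n, hn⟩, hnt⟩⟩ := h
  have hs : Steps tm.m (initList tm s) (haltList tm s') n := Steps.of_iterate hn
  obtain ⟨w, T, h1, h2⟩ := hs.embed he φ hgs (set v tm.initialState) (by rw [hgs]; rfl) S hS
  have hT : T = S' := by
    funext k
    by_cases hk : ∃ j, e j = k
    · obtain ⟨j, rfl⟩ := hk
      rw [h2.1, hS'.1]
    · push Not at hk
      rw [h2.2 _ hk, hS'.2 _ hk]
  subst hT
  refine ⟨w, n + 1, by simpa using hnt, .head ?_⟩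
  exact h1.map (M' := (Frag.ofMachine tm e φ get set).stmt) .inr .halt fun _ => rfl

/-- A fragment over the stacks `K` as a fragment over the stacks `K'`. -/
def Frag.embed (F : Frag K Γ Unit) (e : K → K') (φ : ∀ k, Γ k ≃ Γ' (e k)) : Frag K' Γ' τ where
  Λ := F.Λ
  start := F.start
  stmt l := embedStmt e φ (fun v => ((), v.2)) (fun v x => (v.1, x.2)) (F.stmt l)

theorem Frag.Runs.embed {F : Frag K Γ Unit} {R R' : ∀ k, List (Γ k)} {t : ℕ} (h : F.Runs R R' t)
    {e : K → K'} (he : Injective e) (φ : ∀ k, Γ k ≃ Γ' (e k)) {B S S' : ∀ k, List (Γ' k)}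
    (hS : Shows e φ B S R) (hS' : Shows e φ B S' R') :
    (F.embed e φ : Frag K' Γ' τ).Runs S S' t := fun v => by
  obtain ⟨v', t', ht', hs⟩ := h ((), v.2)
  obtain ⟨w, T, h1, h2⟩ := hs.embed he φ (get := fun v => ((), v.2))
    (set := fun v x => (v.1, x.2)) (fun _ _ => rfl) v rfl S hS
  have hT : T = S' := by
    funext k
    by_cases hk : ∃ j, e j = k
    · obtain ⟨j, rfl⟩ := hk
      rw [h2.1, hS'.1]
    · push Not at hk
      rw [h2.2 _ hk, hS'.2 _ hk]
  subst hT
  exact ⟨w, t', ht', h1⟩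

end Embed

/-! ### The length of the output of a machine -/

section OutputLength

variable {K : Type} [DecidableEq K] {Γ : K → Type} {Λ σ : Type}

/-- The number of `push` instructions in a statement. -/
def pushes : TM2.Stmt Γ Λ σ → ℕ
  | .push _ _ q => pushes q + 1
  | .peek _ _ q => pushes q
  | .pop _ _ q => pushes q
  | .load _ q => pushes q
  | .branch _ q q' => pushes q + pushes q'
  | .goto _ => 0
  | .halt => 0

theorem length_stepAux_le (q : TM2.Stmt Γ Λ σ) (v : σ) (S : ∀ k, List (Γ k)) (b : ℕ)
    (hS : ∀ k, (S k).length ≤ b) (k : K) :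
    ((TM2.stepAux q v S).stk k).length ≤ b + pushes q := by
  induction q generalizing v S b with
  | push k' g q ih =>
    simp only [TM2.stepAux, pushes]
    refine (ih _ _ (b + 1) fun j => ?_).trans (by omega)
    by_cases hj : j = k'
    · subst hj; simpa using hS j
    · rw [update_of_ne hj]; exact (hS j).trans (by omega)
  | peek _ _ q ih => exact ih _ _ _ hS
  | pop k' g q ih =>
    simp only [TM2.stepAux, pushes]
    refine ih _ _ b fun j => ?_
    by_cases hj : j = k'
    · subst hj; simpa using (Nat.sub_le _ _).trans (hS j)
    · rw [update_of_ne hj]; exact hS j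
  | load _ q ih => exact ih _ _ _ hS
  | branch g q q' ih ih' =>
    simp only [TM2.stepAux, pushes]
    cases g v
    · exact (ih' _ _ _ hS).trans (by omega)
    · exact (ih _ _ _ hS).trans (by omega)
  | goto _ => exact hS k
  | halt => exact hS k

theorem Steps.length_le {M : Λ → TM2.Stmt Γ Λ σ} {C : ℕ} (hC : ∀ l, pushes (M l) ≤ C)
    {c c' : TM2.Cfg Γ Λ σ} {t : ℕ} (h : Steps M c c' t) (b : ℕ)
    (hb : ∀ k, (c.stk k).length ≤ b) (k : K) : (c'.stk k).length ≤ b + C * t := by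
  induction h generalizing b with
  | refl c => simpa using hb k
  | @head l v S c t _ ih =>
    refine (ih (b + C) fun k => (length_stepAux_le _ _ _ b hb k).trans ?_).trans ?_
    · have := hC l; omega
    · rw [Nat.mul_add]; omega

/-- A machine with running time `t` writes an output of length linear in `t`. -/
theorem exists_length_output_le (tm : FinTM2) : ∃ C, ∀ s s' t,
    Nonempty (TM2OutputsInTime tm s (some s') t) → s'.length ≤ s.length + C * t := by
  have := tm.ΛFin
  refine ⟨Finset.univ.sup fun l => pushes (tm.m l), fun s s' t ⟨⟨⟨n, hn⟩, hnt⟩⟩ => ?_⟩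
  have hs : Steps tm.m (initList tm s) (haltList tm s') n := Steps.of_iterate hn
  have := hs.length_le (C := Finset.univ.sup fun l => pushes (tm.m l))
    (fun l => Finset.le_sup (f := fun l => pushes (tm.m l)) (Finset.mem_univ l)) s.length
    (fun k => by
      simp only [initList]
      split
      · rename_i h; subst h; simp
      · simp) tm.k₁
  simp only [haltList, dite_true] at this
  exact this.trans (Nat.add_le_add_left (Nat.mul_le_mul_left _ hnt) _)

end OutputLength

end StackProg

namespace StackProg

open Turing Function

namespace Frag

variable {K : Type} [DecidableEq K] {Γ : K → Type} {τ : Type}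

/-- Pops the symbols of the stack `k` one by one, and runs `body b` after popping a symbol
read as `b`. -/
def forEach (k : K) (d : Γ k → Bool) (body : Bool → Frag K Γ τ) : Frag K Γ τ :=
  loop k (Option.map d) (fun o => o.elim skip body) Option.isSome

/-- The rule for `forEach`: the stacks are `st l` when the symbols `l` are still to be
treated. -/
theorem Runs.forEach {k : K} {d : Γ k → Bool} {body : Bool → Frag K Γ τ}
    (st : List (Γ k) → ∀ k, List (Γ k)) (c : ℕ) (l : List (Γ k))
    (hst : ∀ l', l' <:+ l → st l' k = l')
    (hbody : ∀ a l', a :: l' <:+ l → (body (d a)).Runs (update (st (a :: l')) k l') (st l') c) :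
    (forEach k d body).Runs (st l) (st []) (l.length * (c + 1) + 2) := by
  induction l with
  | nil =>
    refine (Runs.loop_exit (S' := st []) (t := 1) none ?_ rfl ?_).mono (by simp)
    · rw [hst [] (List.suffix_refl _)]; rfl
    · rw [hst [] (List.suffix_refl _), List.tail_nil,
        show update (st []) k [] = st [] by
          rw [update_eq_self_iff]; exact (hst [] (List.suffix_refl _)).symm]
      exact runs_skip _
  | cons a l ih =>
    have h1 := ih (fun l' h => hst l' (h.trans (List.suffix_cons a l)))
      (fun b l' h => hbody b l' (h.trans (List.suffix_cons a l)))
    refine (Runs.loop_cont (S' := st l) (some (d a)) ?_ rfl ?_ h1).mono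
      (t := c + 1 + (l.length * (c + 1) + 2)) (by simp [add_mul]; omega)
    · rw [hst _ (List.suffix_refl _)]; rfl
    · rw [hst _ (List.suffix_refl _)]
      exact hbody a l (List.suffix_refl _)

/-- The rule for `forEach` on a stack that holds copies of one symbol: the stacks are `st i` when
`i` copies are left. -/
theorem Runs.forEach_replicate {k : K} {d : Γ k → Bool} {body : Bool → Frag K Γ τ}
    (x : Γ k) (st : ℕ → ∀ k, List (Γ k)) (c m : ℕ)
    (hst : ∀ i ≤ m, st i k = List.replicate i x)
    (hbody : ∀ i < m, (body (d x)).Runs (update (st (i + 1)) k (List.replicate i x)) (st i) c) :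
    (Frag.forEach k d body).Runs (st m) (st 0) (m * (c + 1) + 2) := by
  have hsuff {l' : List (Γ k)} (hl : l' <:+ List.replicate m x) :
      l'.length ≤ m ∧ l' = List.replicate l'.length x :=
    ⟨by simpa using hl.length_le,
      List.eq_replicate_iff.2 ⟨rfl, fun b hb => List.eq_of_mem_replicate (hl.subset hb)⟩⟩
  have := Runs.forEach (k := k) (d := d) (body := body) (fun l => st l.length) c
    (List.replicate m x) (fun l' hl => by
      rw [hst _ (hsuff hl).1, ← (hsuff hl).2]) (fun a l' hl => by
      obtain ⟨h1, h2⟩ := hsuff hl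
      simp only [List.length_cons, List.replicate_succ, List.cons.injEq] at h1 h2
      have h3 := hbody l'.length (by omega)
      rw [← h2.2, ← h2.1] at h3
      exact h3)
  simpa using this

end Frag

/-! ### Programs with access to the output of machines -/

/-- Bounded by a polynomial. -/
def PolyLE (f : ℕ → ℕ) : Prop := ∃ P : Polynomial ℕ, ∀ n, f n ≤ P.eval n

theorem eval_mono (P : Polynomial ℕ) : Monotone fun n => P.eval n := fun a b h => by
  simp only [Polynomial.eval_eq_sum, Polynomial.sum]
  gcongr

namespace PolyLE

variable {f g : ℕ → ℕ}

theorem mono (hg : PolyLE g) (h : ∀ n, f n ≤ g n) : PolyLE f := by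
  obtain ⟨P, hP⟩ := hg
  exact ⟨P, fun n => (h n).trans (hP n)⟩

theorem const (c : ℕ) : PolyLE fun _ => c := ⟨Polynomial.C c, fun n => by simp⟩

theorem id : PolyLE fun n => n := ⟨Polynomial.X, fun n => by simp⟩

theorem add (hf : PolyLE f) (hg : PolyLE g) : PolyLE fun n => f n + g n := by
  obtain ⟨P, hP⟩ := hf
  obtain ⟨Q, hQ⟩ := hg
  exact ⟨P + Q, fun n => by simpa using add_le_add (hP n) (hQ n)⟩

theorem mul (hf : PolyLE f) (hg : PolyLE g) : PolyLE fun n => f n * g n := by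
  obtain ⟨P, hP⟩ := hf
  obtain ⟨Q, hQ⟩ := hg
  exact ⟨P * Q, fun n => by simpa using Nat.mul_le_mul (hP n) (hQ n)⟩

theorem eval (P : Polynomial ℕ) (hf : PolyLE f) : PolyLE fun n => P.eval (f n) := by
  obtain ⟨Q, hQ⟩ := hf
  exact ⟨P.comp Q, fun n => by simpa using eval_mono P (hQ n)⟩

end PolyLE

/-- The unary representation of a number. -/
abbrev unary (m : ℕ) : List Bool := List.replicate m true

theorem unaryEncodeNat_eq (n : ℕ) : Computability.unaryEncodeNat n = unary n := by
  induction n with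
  | zero => rfl
  | succ n ih => simp [Computability.unaryEncodeNat, ih, List.replicate_succ]

theorem initList_stk (tm : FinTM2) (s : List (tm.Γ tm.k₀)) :
    (initList tm s).stk = update (fun _ => []) tm.k₀ s := by
  funext k
  by_cases h : k = tm.k₀
  · subst h; simp [initList]
  · simp [initList, h]

theorem haltList_stk (tm : FinTM2) (s : List (tm.Γ tm.k₁)) :
    (haltList tm s).stk = update (fun _ => []) tm.k₁ s := by
  funext k
  by_cases h : k = tm.k₁
  · subst h; simp [haltList]
  · simp [haltList, h]

section Oracle

variable (M₁ M₂ : FinTM2) (ι : Type)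

/-- The stacks of two machines and of a program. -/
abbrev Stacks : Type := M₁.K ⊕ (M₂.K ⊕ ι)

/-- The alphabets of the stacks of two machines and of a program with binary stacks. -/
abbrev Alphabet : Stacks M₁ M₂ ι → Type
  | .inl k => M₁.Γ k
  | .inr (.inl k) => M₂.Γ k
  | .inr (.inr _) => Bool

variable {M₁ M₂ ι}

/-- Joins the contents of the stacks of two machines and of a program. -/
def join (S₁ : ∀ k, List (M₁.Γ k)) (S₂ : ∀ k, List (M₂.Γ k)) (S₃ : ι → List Bool) :
    ∀ k, List (Alphabet M₁ M₂ ι k)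
  | .inl k => S₁ k
  | .inr (.inl k) => S₂ k
  | .inr (.inr k) => S₃ k

variable (S₁ : ∀ k, List (M₁.Γ k)) (S₂ : ∀ k, List (M₂.Γ k)) (S₃ : ι → List Bool)

theorem update_join_fst [DecidableEq ι] (k : M₁.K) (l : List (M₁.Γ k)) :
    update (join S₁ S₂ S₃) (.inl k) l = join (update S₁ k l) S₂ S₃ := by
  funext j
  rcases j with j | j | j
  · by_cases h : j = k
    · subst h; simp [join]
    · rw [update_of_ne (by simpa using h)]; simp [join, h]
  · rw [update_of_ne (by simp)]; rfl
  · rw [update_of_ne (by simp)]; rfl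

theorem update_join_snd [DecidableEq ι] (k : M₂.K) (l : List (M₂.Γ k)) :
    update (join S₁ S₂ S₃) (.inr (.inl k)) l = join S₁ (update S₂ k l) S₃ := by
  funext j
  rcases j with j | j | j
  · rw [update_of_ne (by simp)]; rfl
  · by_cases h : j = k
    · subst h; simp [join]
    · rw [update_of_ne (by simpa using h)]; simp [join, h]
  · rw [update_of_ne (by simp)]; rfl

theorem update_join_thd [DecidableEq ι] (k : ι) (l : List Bool) :
    update (join S₁ S₂ S₃) (.inr (.inr k)) l = join S₁ S₂ (update S₃ k l) := by
  funext j
  rcases j with j | j | j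
  · rw [update_of_ne (by simp)]; rfl
  · rw [update_of_ne (by simp)]; rfl
  · by_cases h : j = k
    · subst h; simp [join]
    · rw [update_of_ne (by simpa using h)]; simp [join, h]

theorem shows_fst (B : ∀ k, List (M₁.Γ k)) :
    Shows (Γ' := Alphabet M₁ M₂ ι) Sum.inl (fun k => Equiv.refl (M₁.Γ k)) (join B S₂ S₃)
      (join S₁ S₂ S₃) S₁ := by
  refine ⟨fun k => (List.map_id _).symm, ?_⟩
  rintro (k | k | k) hk
  · exact absurd rfl (hk k)
  · rfl
  · rfl

theorem shows_snd (B : ∀ k, List (M₂.Γ k)) :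
    Shows (Γ' := Alphabet M₁ M₂ ι) (fun k => Sum.inr (Sum.inl k)) (fun k => Equiv.refl (M₂.Γ k))
      (join S₁ B S₃) (join S₁ S₂ S₃) S₂ := by
  refine ⟨fun k => (List.map_id _).symm, ?_⟩
  rintro (k | k | k) hk
  · rfl
  · exact absurd rfl (hk k)
  · rfl

theorem shows_thd (B : ι → List Bool) :
    Shows (Γ := fun _ : ι => Bool) (Γ' := Alphabet M₁ M₂ ι) (fun k => Sum.inr (Sum.inr k))
      (fun _ => Equiv.refl Bool) (join S₁ S₂ B) (join S₁ S₂ S₃) S₃ := by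
  refine ⟨fun k => (List.map_id _).symm, ?_⟩
  rintro (k | k | k) hk
  · rfl
  · rfl
  · exact absurd rfl (hk k)

end Oracle

/-- Initial stacks of a program: the unary input, a reversed string and a unary number. -/
def inputs {ι : Type} [DecidableEq ι] (iN iF iP : ι) (n : ℕ) (s : List Bool) (m : ℕ) :
    ι → List Bool :=
  update (update (update (fun _ => []) iN (unary n)) iF s.reverse) iP (unary m)

open Frag in
/-- A program on binary stacks that has `1^n`, the string `F n` in reverse and `1^(p n)` at its
disposal and computes `G n` in polynomial time shows that `G` is computable in polynomial time. -/
theorem polyTimeStrings_of_program {ι : Type} [Fintype ι] [DecidableEq ι] (iN iF iP iO : ι)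
    (hNF : iN ≠ iF) (hNP : iN ≠ iP) (hFP : iF ≠ iP) (Prog : Frag ι (fun _ => Bool) Unit)
    {F : ℕ → List Bool} (hF : PolyTimeStrings F) {p : ℕ → ℕ} (hp : PolyBounded p)
    {G : ℕ → List Bool} (P : Polynomial ℕ)
    (h : ∀ n, Prog.Runs (inputs iN iF iP n (F n) (p n)) (update (fun _ => []) iO (G n))
      (P.eval (n + (F n).length + p n))) : PolyTimeStrings G := by
  obtain ⟨⟨⟨M₁, in₁, out₁⟩, T₁, run₁⟩⟩ := hF
  obtain ⟨⟨⟨M₂, in₂, out₂⟩, T₂, run₂⟩⟩ := hp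
  replace run₁ (n : ℕ) : Nonempty (TM2OutputsInTime M₁ (List.replicate n (in₁.symm true))
      (some ((F n).map out₁.symm)) (T₁.eval n)) := ⟨by
    simpa only [unaryEncodeNat_eq, List.length_replicate, id, List.map_replicate,
      Equiv.invFun_as_coe] using run₁ n⟩
  replace run₂ (n : ℕ) : Nonempty (TM2OutputsInTime M₂ (List.replicate n (in₂.symm true))
      (some (List.replicate (p n) (out₂.symm true))) (T₂.eval n)) := ⟨by
    simpa only [unaryEncodeNat_eq, List.length_replicate, id, List.map_replicate,
      Equiv.invFun_as_coe] using run₂ n⟩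
  -- a machine cannot write more symbols than a constant times the number of its steps
  obtain ⟨C₁, hC₁⟩ := exists_length_output_le M₁
  obtain ⟨C₂, hC₂⟩ := exists_length_output_le M₂
  replace hC₁ : PolyLE fun n => (F n).length :=
    ⟨Polynomial.X + Polynomial.C C₁ * T₁, fun n => by simpa using hC₁ _ _ _ (run₁ n)⟩
  replace hC₂ : PolyLE p :=
    ⟨Polynomial.X + Polynomial.C C₂ * T₂, fun n => by simpa using hC₂ _ _ _ (run₂ n)⟩
  let Γ := Alphabet M₁ M₂ ι
  let τ := M₁.σ × M₂.σ
  -- copy the input to the input stacks of both machines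
  let stage₁ : Frag (Stacks M₁ M₂ ι) Γ τ := forEach (.inr (.inr iN)) (fun b : Bool => b) fun _ =>
    (push (.inl M₁.k₀) (in₁.symm true)).seq ((push (.inr (.inl M₂.k₀)) (in₂.symm true)).seq
      (push (.inr (.inr iF)) true))
  -- restore the input, of which `iF` holds a copy
  let stage₂ : Frag (Stacks M₁ M₂ ι) Γ τ := forEach (.inr (.inr iF)) (fun b : Bool => b) fun _ =>
    push (.inr (.inr iN)) true
  -- run the two machines
  let stage₃ : Frag (Stacks M₁ M₂ ι) Γ τ := ofMachine M₁ Sum.inl (fun k => Equiv.refl (M₁.Γ k))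
    (fun v => v.1.1) (fun v x => ((x, v.1.2), v.2))
  let stage₄ : Frag (Stacks M₁ M₂ ι) Γ τ := ofMachine M₂ (fun k => Sum.inr (Sum.inl k))
    (fun k => Equiv.refl (M₂.Γ k)) (fun v => v.1.2) (fun v x => ((v.1.1, x), v.2))
  -- hand their outputs over, which reverses `F n`
  let stage₅ : Frag (Stacks M₁ M₂ ι) Γ τ := forEach (.inl M₁.k₁) out₁ fun b =>
    push (.inr (.inr iF)) b
  let stage₆ : Frag (Stacks M₁ M₂ ι) Γ τ := forEach (.inr (.inl M₂.k₁)) out₂ fun b =>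
    push (.inr (.inr iP)) b
  let stage₇ : Frag (Stacks M₁ M₂ ι) Γ τ := Prog.embed (fun k => Sum.inr (Sum.inr k))
    (fun _ => Equiv.refl Bool)
  let whole := stage₁.seq (stage₂.seq (stage₃.seq (stage₄.seq (stage₅.seq (stage₆.seq stage₇)))))
  -- the contents of the stacks between the stages
  let E₁ : ∀ k, List (M₁.Γ k) := fun _ => []
  let E₂ : ∀ k, List (M₂.Γ k) := fun _ => []
  let E : ι → List Bool := fun _ => []
  let I₁ (n : ℕ) : ∀ k, List (M₁.Γ k) := update E₁ M₁.k₀ (List.replicate n (in₁.symm true))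
  let I₂ (n : ℕ) : ∀ k, List (M₂.Γ k) := update E₂ M₂.k₀ (List.replicate n (in₂.symm true))
  let O₁ (s : List Bool) : ∀ k, List (M₁.Γ k) := update E₁ M₁.k₁ (s.map out₁.symm)
  let O₂ (m : ℕ) : ∀ k, List (M₂.Γ k) := update E₂ M₂.k₁ (List.replicate m (out₂.symm true))
  have e₁ (n) : stage₁.Runs (join E₁ E₂ (update E iN (unary n)))
      (join (I₁ n) (I₂ n) (update E iF (unary n))) (n * 4 + 2) := by
    refine (Runs.forEach_replicate true
      (fun i => join (I₁ (n - i)) (I₂ (n - i)) (update (update E iF (unary (n - i))) iN (unary i)))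
      3 n ?_ ?_).congr' ?_ ?_ le_rfl
    · intro i _
      simp [join]
    · intro i hi
      refine ((runs_push _ _ _).seq ((runs_push _ _ _).seq (runs_push _ _ _))).congr ?_ le_rfl
      have hi' : n - i = n - (i + 1) + 1 := by omega
      simp only [update_join_fst, update_join_snd, update_join_thd]
      congr 1
      · simp [join, I₁, hi', List.replicate_succ]
      · simp [join, I₂, hi', List.replicate_succ]
      · funext k
        by_cases h1 : k = iF <;> by_cases h2 : k = iN <;>
          simp_all [join, update_apply, List.replicate_succ]
    · congr 1
      · simp [I₁, E₁]
      · simp [I₂, E₂]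
      · simp [E]
    · simp only [Nat.sub_zero]
      congr 1
      funext k
      by_cases h1 : k = iF <;> by_cases h2 : k = iN <;> simp_all [E]
  have e₂ (n) : stage₂.Runs (join (I₁ n) (I₂ n) (update E iF (unary n)))
      (join (I₁ n) (I₂ n) (update E iN (unary n))) (n * 2 + 2) := by
    refine (Runs.forEach_replicate true
      (fun i => join (I₁ n) (I₂ n) (update (update E iN (unary (n - i))) iF (unary i)))
      1 n ?_ ?_).congr' ?_ ?_ le_rfl
    · intro i _
      simp [join]
    · intro i hi
      refine (runs_push _ _ _).congr ?_ le_rfl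
      have hi' : n - i = n - (i + 1) + 1 := by omega
      simp only [update_join_thd]
      congr 1
      funext k
      by_cases h1 : k = iF <;> by_cases h2 : k = iN <;>
        simp_all [join, List.replicate_succ]
    · simp [E]
    · simp only [Nat.sub_zero]
      congr 1
      funext k
      by_cases h1 : k = iF <;> by_cases h2 : k = iN <;> simp_all [E]
  have e₃ (n) : stage₃.Runs (join (I₁ n) (I₂ n) (update E iN (unary n)))
      (join (O₁ (F n)) (I₂ n) (update E iN (unary n))) (T₁.eval n + 1) := by
    refine runs_ofMachine M₁ Sum.inl_injective _ (fun _ _ => rfl) (run₁ n)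
      (B := join E₁ (I₂ n) (update E iN (unary n))) ?_ ?_
    · rw [initList_stk]; exact shows_fst _ _ _ _
    · rw [haltList_stk]; exact shows_fst _ _ _ _
  have e₄ (n) : stage₄.Runs (join (O₁ (F n)) (I₂ n) (update E iN (unary n)))
      (join (O₁ (F n)) (O₂ (p n)) (update E iN (unary n))) (T₂.eval n + 1) := by
    refine runs_ofMachine M₂ (Sum.inr_injective.comp Sum.inl_injective) _ (fun _ _ => rfl)
      (run₂ n) (B := join (O₁ (F n)) E₂ (update E iN (unary n))) ?_ ?_
    · rw [initList_stk]; exact shows_snd _ _ _ _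
    · rw [haltList_stk]; exact shows_snd _ _ _ _
  have e₅ (n) : stage₅.Runs (join (O₁ (F n)) (O₂ (p n)) (update E iN (unary n)))
      (join E₁ (O₂ (p n)) (update (update E iN (unary n)) iF (F n).reverse))
      ((F n).length * 2 + 2) := by
    refine (Runs.forEach (fun l => join (update E₁ M₁.k₁ l) (O₂ (p n)) (update (update E iN
      (unary n)) iF (((F n).take ((F n).length - l.length)).reverse))) 1 ((F n).map out₁.symm)
      ?_ ?_).congr' ?_ ?_ (by simp)
    · intro l _
      simp [join]
    · intro a l ⟨r, hr⟩
      refine (runs_push _ _ _).congr ?_ le_rfl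
      simp only [update_join_fst, update_join_thd]
      have hF : F n = r.map out₁ ++ out₁ a :: l.map out₁ := by
        have := congrArg (List.map out₁) hr
        simpa using this.symm
      congr 1
      · simp
      · rw [hF]
        funext k
        by_cases h1 : k = iF
        · subst h1
          have h3 : r.length + (l.length + 1) - (l.length + 1) = r.length := by omega
          have h4 : r.length + (l.length + 1) - l.length = r.length + 1 := by omega
          simp [join, h3, h4, List.take_append]
        · simp [h1]
    · have : update E iN (unary n) iF = [] := by simp [E, hNF.symm]
      simp only [O₁, List.length_map, Nat.sub_self, List.take_zero, List.reverse_nil]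
      rw [← this, update_eq_self]
    · congr 1 <;> simp [E₁]
  have e₆ (n) : stage₆.Runs (join E₁ (O₂ (p n)) (update (update E iN (unary n)) iF (F n).reverse))
      (join E₁ E₂ (inputs iN iF iP n (F n) (p n))) (p n * 2 + 2) := by
    refine (Runs.forEach_replicate (Γ := Γ) (k := .inr (.inl M₂.k₁)) (out₂.symm true)
      (fun i => join E₁ (O₂ i) (inputs iN iF iP n (F n) (p n - i))) 1 (p n) ?_ ?_).congr' ?_ ?_
      le_rfl
    · intro i _
      simp [join, O₂]
    · intro i hi
      refine (runs_push _ _ _).congr ?_ le_rfl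
      have hi' : p n - i = p n - (i + 1) + 1 := by omega
      simp only [update_join_snd, update_join_thd]
      congr 1
      · simp [O₂]
      · simp [join, inputs, hi', List.replicate_succ]
    · congr 1
      simp [inputs, E, hFP.symm, hNP.symm]
    · simp [O₂, E₂]
  have e₇ (n) : stage₇.Runs (join E₁ E₂ (inputs iN iF iP n (F n) (p n)))
      (join E₁ E₂ (update E iO (G n))) (P.eval (n + (F n).length + p n)) :=
    (h n).embed (Sum.inr_injective.comp Sum.inr_injective) _ (B := join E₁ E₂ E)
      (shows_thd _ _ _ _) (shows_thd _ _ _ _)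
  have hT := (PolyLE.eval P ((PolyLE.id.add hC₁).add hC₂)).add <|
    (hC₂.mul (.const 2)).add <| (hC₁.mul (.const 2)).add <|
    (PolyLE.eval T₂ .id).add <| (PolyLE.eval T₁ .id).add <| (PolyLE.id.mul (.const 6)).add
      (.const 10)
  obtain ⟨T, hT⟩ := hT
  have e (n) : whole.Runs (join E₁ E₂ (update E iN (unary n)))
      (join E₁ E₂ (update E iO (G n))) (T.eval n) :=
    ((e₁ n).seq ((e₂ n).seq ((e₃ n).seq ((e₄ n).seq ((e₅ n).seq ((e₆ n).seq (e₇ n))))))).mono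
      (by have := hT n; dsimp only at this; omega)
  let init : τ × Option Bool := ((M₁.initialState, M₂.initialState), none)
  have := M₁.kFin
  have := M₂.kFin
  have := M₁.σFin
  have := M₂.σFin
  let tm : FinTM2 :=
    { K := Stacks M₁ M₂ ι
      k₀ := .inr (.inr iN)
      k₁ := .inr (.inr iO)
      Γ := Γ
      Λ := whole.Λ
      main := whole.start
      σ := τ × Option Bool
      initialState := init
      Γk₀Fin := inferInstanceAs (Fintype Bool)
      m := fun l => mapStmt (fun l => l) (.load (fun _ => init) .halt) (whole.stmt l) }
  refine ⟨⟨⟨tm, Equiv.refl Bool, Equiv.refl Bool⟩, T, fun n => ?_⟩⟩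
  have hn : ∃ t ≤ T.eval n, (flip bind tm.step)^[t] (some (initList tm (unary n))) =
      some (haltList tm (G n)) := by
    obtain ⟨v', t, ht, hs⟩ := e n init
    refine ⟨t, ht, ?_⟩
    have hs' := (hs.map (M' := tm.m) (fun l => l) (.load (fun _ => init) .halt)
      fun _ => rfl).iterate
    have h1 : initList tm (unary n) = ⟨some tm.main, init, join E₁ E₂ (update E iN (unary n))⟩ := by
      rw [← update_join_thd]
      have : (initList tm (unary n)).stk = join E₁ E₂ (update E iN (unary n)) := by
        rw [initList_stk, ← update_join_thd]
        congr 1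
        funext k
        rcases k with k | k | k <;> rfl
      rw [update_join_thd, ← this]
      rfl
    have h2 : haltList tm (G n) = ⟨none, init, join E₁ E₂ (update E iO (G n))⟩ := by
      have : (haltList tm (G n)).stk = join E₁ E₂ (update E iO (G n)) := by
        rw [haltList_stk, ← update_join_thd]
        congr 1
        funext k
        rcases k with k | k | k <;> rfl
      rw [← this]
      rfl
    rw [h1, h2]
    exact hs'
  have key : Nonempty (TM2OutputsInTime tm (unary n) (some (G n)) (T.eval n)) := by
    obtain ⟨t, ht, hs⟩ := hn
    exact ⟨⟨⟨t, hs⟩, ht⟩⟩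
  rw [unaryEncodeNat_eq, List.length_replicate]
  have hid : ∀ l : List Bool, l.map (Equiv.refl Bool).invFun = l := fun l => List.map_id l
  rw [id, hid, hid]
  exact key.some

end StackProg

/-! ### Circuits acting on finitely supported amplitude functions -/

namespace QSim

open Function Finsupp
open scoped Matrix

/-- A bit on every wire. -/
abbrev Config := ℕ → Bool

/-- Amplitude functions with finite support. -/
abbrev Vec := Config →₀ ℂ

/-- The action of a gate on a basis state. -/
noncomputable def act : UGate → Config → Vec
  | .toffoli a b c, s => single (update s c (xor (s c) (s a && s b))) 1
  | .hadamard a, s => single (update s a false) ((1 / Real.sqrt 2 : ℝ) : ℂ) +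
      single (update s a true) (((1 / Real.sqrt 2 : ℝ) : ℂ) * if s a then -1 else 1)
  | .phase a, s => single s (if s a then Complex.I else 1)

/-- The action of a gate. -/
noncomputable def step (u : UGate) : Vec →ₗ[ℂ] Vec := linearCombination ℂ (act u)

/-- The action of a list of gates, the head acting first. -/
noncomputable def app : List UGate → Vec →ₗ[ℂ] Vec
  | [] => LinearMap.id
  | u :: us => (app us).comp (step u)

theorem step_single (u : UGate) (s : Config) (c : ℂ) : step u (single s c) = c • act u s := by
  simp [step]

theorem app_nil (v : Vec) : app [] v = v := rfl

theorem app_cons (u : UGate) (us : List UGate) (v : Vec) : app (u :: us) v = app us (step u v) :=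
  rfl

theorem app_append (us vs : List UGate) (v : Vec) : app (us ++ vs) v = app vs (app us v) := by
  induction us generalizing v with
  | nil => rfl
  | cons u us ih => exact ih _

/-- The restriction of a configuration to the wires in `L`. -/
def restr (L : Finset ℕ) (s : Config) : Reg L := fun w => s w

/-- The configuration with the bits of `y` on the wires in `L` and those of `s` elsewhere. -/
def merge (L : Finset ℕ) (s : Config) (y : Reg L) : Config :=
  fun w => if h : w ∈ L then y ⟨w, h⟩ else s w

variable {L : Finset ℕ}

theorem restr_bit {s : Config} {w : ℕ} (h : w ∈ L) : (restr L s).bit w = s w := by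
  simp [Reg.bit, restr, h]

theorem eq_restr_iff {y : Reg L} {s : Config} : y = restr L s ↔ ∀ w ∈ L, y.bit w = s w := by
  constructor
  · rintro rfl w hw
    exact restr_bit hw
  · intro h
    funext ⟨w, hw⟩
    have := h w hw
    simpa [Reg.bit, hw, restr] using this

theorem restr_eq_restr_iff {s s' : Config} : restr L s = restr L s' ↔ ∀ w ∈ L, s w = s' w := by
  rw [eq_restr_iff]
  exact forall₂_congr fun w hw => by rw [restr_bit hw]

theorem restr_merge (s : Config) (y : Reg L) : restr L (merge L s y) = y := by
  funext ⟨w, hw⟩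
  simp [restr, merge, hw]

theorem merge_merge (s : Config) (y z : Reg L) : merge L (merge L s y) z = merge L s z := by
  funext w
  by_cases hw : w ∈ L <;> simp [merge, hw]

theorem merge_restr_update (s : Config) {c : ℕ} (hc : c ∈ L) (b : Bool) :
    merge L s (restr L (update s c b)) = update s c b := by
  funext w
  by_cases hw : w ∈ L
  · simp [merge, restr, hw]
  · have : w ≠ c := fun h => hw (h ▸ hc)
    simp [merge, hw, this]

theorem merge_restr (s : Config) : merge L s (restr L s) = s := by
  funext w
  by_cases hw : w ∈ L <;> simp [merge, restr, hw]

theorem merge_false (y : Reg L) : merge L (fun _ => false) y = y.bit := by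
  funext w
  simp [merge, Reg.bit]

theorem restr_self_bit (y : Reg L) : restr L y.bit = y := by
  rw [← merge_false, restr_merge]

theorem bit_injective : Injective (Reg.bit (L := L)) := fun y z h => by
  rw [← restr_self_bit y, h, restr_self_bit]

/-- On the wires in `L` the action of a gate is given by its matrix, and all other wires keep their
bits. -/
theorem act_eq_sum {u : UGate} (hu : u.Valid L) (s : Config) :
    act u s = ∑ y, u.matrix L y (restr L s) • single (merge L s y) 1 := by
  cases u with
  | toffoli a b c =>
    obtain ⟨ha, hb, hc, -, -, -⟩ := hu
    have h : ∀ y : Reg L, (UGate.toffoli a b c).matrix L y (restr L s) =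
        if y = restr L (update s c (xor (s c) (s a && s b))) then 1 else 0 := fun y => by
      simp only [UGate.matrix, Matrix.of_apply]
      refine if_congr ?_ rfl rfl
      rw [eq_restr_iff]
      refine forall₂_congr fun w hw => ?_
      rw [restr_bit hw, restr_bit ha, restr_bit hb]
      by_cases hwc : w = c
      · subst hwc; simp
      · simp [hwc]
    simp only [h, ite_smul, one_smul, zero_smul, Finset.sum_ite_eq', Finset.mem_univ, if_true,
      merge_restr_update s hc, act]
  | hadamard a =>
    have ha : a ∈ L := hu
    have h : ∀ y : Reg L, (UGate.hadamard a).matrix L y (restr L s) =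
        (if y = restr L (update s a false) then ((1 / Real.sqrt 2 : ℝ) : ℂ) else 0) +
        (if y = restr L (update s a true) then
          (((1 / Real.sqrt 2 : ℝ) : ℂ) * if s a then -1 else 1) else 0) := fun y => by
      have key : ∀ b, y = restr L (update s a b) ↔
          (∀ w ∈ L, w ≠ a → y.bit w = (restr L s).bit w) ∧ y.bit a = b := fun b => by
        rw [eq_restr_iff]
        constructor
        · intro h
          refine ⟨fun w hw hwa => ?_, by simpa using h a ha⟩
          rw [restr_bit hw, h w hw, update_of_ne hwa]
        · rintro ⟨h, hb⟩ w hw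
          by_cases hwa : w = a
          · subst hwa; simpa using hb
          · rw [h w hw hwa, restr_bit hw, update_of_ne hwa]
      simp only [UGate.matrix, Matrix.of_apply, key, restr_bit ha]
      by_cases hc : ∀ w ∈ L, w ≠ a → y.bit w = (restr L s).bit w
      · rw [if_pos hc]
        simp only [and_iff_right hc]
        cases y.bit a <;> cases s a <;> simp
      · rw [if_neg hc]; simp [hc]
    simp only [h, add_smul, Finset.sum_add_distrib, ite_smul, zero_smul, Finset.sum_ite_eq',
      Finset.mem_univ, if_true, merge_restr_update s ha, act, smul_single, smul_eq_mul, mul_one]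
  | phase a =>
    have h : ∀ y : Reg L, (UGate.phase a).matrix L y (restr L s) =
        if y = restr L s then (if s a then Complex.I else 1) else 0 := fun y => by
      simp only [UGate.matrix, Matrix.of_apply, restr_bit (show a ∈ L from hu)]
    simp only [h, ite_smul, zero_smul, Finset.sum_ite_eq', Finset.mem_univ, if_true,
      merge_restr, act]
    split_ifs <;> simp

theorem app_single {us : List UGate} (hus : ∀ u ∈ us, u.Valid L) (s : Config) :
    app us (single s 1) = ∑ y, unitaryProduct L us y (restr L s) • single (merge L s y) 1 := by
  induction us generalizing s with
  | nil =>
    simp only [app, LinearMap.id_apply, unitaryProduct, Matrix.one_apply, ite_smul, one_smul,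
      zero_smul, Finset.sum_ite_eq', Finset.mem_univ, if_true, merge_restr]
  | cons u us ih =>
    rw [app_cons, step_single, one_smul, act_eq_sum (hus u (by simp)), map_sum]
    simp only [map_smul, ih fun v hv => hus v (by simp [hv]), restr_merge, merge_merge,
      unitaryProduct, Matrix.mul_apply, Finset.smul_sum, Finset.sum_smul, smul_smul]
    rw [Finset.sum_comm]
    refine Finset.sum_congr rfl fun y _ => Finset.sum_congr rfl fun z _ => ?_
    rw [mul_comm]

/-- The action of a circuit on configurations determines its matrix. -/
theorem unitaryProduct_apply {us : List UGate} (hus : ∀ u ∈ us, u.Valid L) (y x : Reg L) :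
    unitaryProduct L us y x = app us (single x.bit 1) y.bit := by
  rw [app_single hus, restr_self_bit, finsetSum_apply]
  rw [Finset.sum_eq_single y]
  · rw [← merge_false x, merge_merge, merge_false]; simp
  · intro z _ hz
    rw [← merge_false x, merge_merge, merge_false]
    simp [bit_injective.ne hz]
  · simp

theorem exists_bit_of_mem_support {us : List UGate} (hus : ∀ u ∈ us, u.Valid L) (x : Reg L)
    {s : Config} (hs : s ∈ (app us (single x.bit 1)).support) : ∃ y : Reg L, y.bit = s := by
  by_contra hne
  push Not at hne
  rw [mem_support_iff] at hs
  refine hs ?_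
  rw [app_single hus, finsetSum_apply]
  refine Finset.sum_eq_zero fun y _ => ?_
  have h : merge L x.bit y = y.bit := by rw [← merge_false x, merge_merge, merge_false]
  rw [h, Finsupp.smul_apply, single_eq_of_ne (hne y).symm, smul_zero]

/-! ### Inverse circuits -/

/-- A list of gates that inverts a gate. -/
def invGate : UGate → List UGate
  | .toffoli a b c => [.toffoli a b c]
  | .hadamard a => [.hadamard a]
  | .phase a => [.phase a, .phase a, .phase a]

/-- The inverse of a circuit. -/
def invList : List UGate → List UGate
  | [] => []
  | u :: us => invList us ++ invGate u

theorem invList_append (us vs : List UGate) :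
    invList (us ++ vs) = invList vs ++ invList us := by
  induction us with
  | nil => simp [invList]
  | cons u us ih => simp [invList, ih]

theorem valid_of_mem_invGate {u v : UGate} (hu : u.Valid L) (hv : v ∈ invGate u) : v.Valid L := by
  cases u <;> simp [invGate] at hv <;> subst hv <;> exact hu

theorem valid_of_mem_invList {us : List UGate} (hus : ∀ u ∈ us, u.Valid L) :
    ∀ v ∈ invList us, v.Valid L := by
  induction us with
  | nil => simp [invList]
  | cons u us ih =>
    intro v hv
    rcases List.mem_append.1 hv with hv | hv
    · exact ih (fun w hw => hus w (by simp [hw])) v hv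
    · exact valid_of_mem_invGate (hus u (by simp)) hv

/-- On configurations, the circuit for the inverse of a gate undoes the gate. -/
theorem app_invGate {u : UGate} (hu : u.Valid L) (s : Config) :
    app (invGate u) (act u s) = single s 1 := by
  cases u with
  | toffoli a b c =>
    obtain ⟨-, -, -, hab, hac, hbc⟩ := hu
    simp only [invGate, app_cons, app_nil, act, step_single, one_smul]
    rw [update_of_ne hac, update_of_ne hbc, Function.update_self, Function.update_idem]
    simp
  | hadamard a =>
    classical
    have h2 : ((1 / Real.sqrt 2 : ℝ) : ℂ) * ((1 / Real.sqrt 2 : ℝ) : ℂ) = 1 / 2 := by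
      rw [← Complex.ofReal_mul, div_mul_div_comm, Real.mul_self_sqrt (by norm_num)]
      norm_num
    have hs : update s a (s a) = s := update_eq_self _ _
    generalize hr : ((1 / Real.sqrt 2 : ℝ) : ℂ) = r at h2
    simp only [invGate, app_cons, app_nil, act, map_add, step_single, Function.update_self,
      Function.update_idem, hr, smul_add, smul_single, smul_eq_mul]
    cases h : s a <;> rw [h] at hs <;> simp only [hs, Bool.false_eq_true, if_true, if_false]
    · ext t
      simp only [Finsupp.add_apply, single_apply]
      split_ifs <;> first | ring1 | linear_combination 2 * h2
    · ext t
      simp only [Finsupp.add_apply, single_apply]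
      split_ifs <;> first | ring1 | linear_combination 2 * h2
  | phase a =>
    simp only [invGate, app_cons, app_nil, act, step_single, smul_single,
      smul_eq_mul]
    refine congrArg (single s) ?_
    split_ifs
    · linear_combination (Complex.I ^ 2 - 1) * Complex.I_sq
    · simp

theorem unitaryProduct_append (us vs : List UGate) :
    unitaryProduct L (us ++ vs) = unitaryProduct L vs * unitaryProduct L us := by
  induction us with
  | nil => simp [unitaryProduct]
  | cons u us ih => simp [unitaryProduct, ih, Matrix.mul_assoc]

theorem unitaryProduct_invGate_mul {u : UGate} (hu : u.Valid L) :
    unitaryProduct L (invGate u) * u.matrix L = 1 := by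
  have h : unitaryProduct L (invGate u) * u.matrix L = unitaryProduct L (u :: invGate u) := rfl
  classical
  ext y x
  rw [h, unitaryProduct_apply (by
    intro v hv
    rcases List.mem_cons.1 hv with rfl | hv
    · exact hu
    · exact valid_of_mem_invGate hu hv), app_cons, step_single, one_smul, app_invGate hu,
    single_apply, Matrix.one_apply]
  exact if_congr ⟨fun h => bit_injective h.symm, fun h => by rw [h]⟩ rfl rfl

/-- The circuit for the inverse of a gate has the adjoint matrix; together with
`unitaryProduct_invGate_mul` this shows that the matrices of the gates are unitary. -/
theorem unitaryProduct_invGate {u : UGate} (hu : u.Valid L) :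
    unitaryProduct L (invGate u) = (u.matrix L)ᴴ := by
  cases u with
  | toffoli a b c =>
    obtain ⟨ha, hb, hc, hab, hac, hbc⟩ := hu
    simp only [invGate, unitaryProduct, one_mul]
    ext y x
    simp only [UGate.matrix, Matrix.of_apply, Matrix.conjTranspose_apply, apply_ite star, star_one,
      star_zero]
    have key : ∀ x y : Reg L,
        (∀ w ∈ L, y.bit w = xor (x.bit w) (decide (w = c) && (x.bit a && x.bit b))) →
        ∀ w ∈ L, x.bit w = xor (y.bit w) (decide (w = c) && (y.bit a && y.bit b)) := by
      intro x y h w hw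
      have h1 := h a ha
      have h2 := h b hb
      simp only [hac, hbc, decide_false, Bool.false_and, Bool.xor_false] at h1 h2
      rw [h w hw, h1, h2]
      simp
    exact if_congr ⟨key x y, key y x⟩ rfl rfl
  | hadamard a =>
    simp only [invGate, unitaryProduct, one_mul]
    ext y x
    simp only [UGate.matrix, Matrix.of_apply, Matrix.conjTranspose_apply, apply_ite star,
      star_zero, star_mul', star_one, star_neg, Complex.star_def, Complex.conj_ofReal]
    rw [Bool.and_comm]
    refine if_congr ?_ rfl rfl
    exact forall₃_congr fun w _ _ => eq_comm
  | phase a =>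
    have h : (UGate.phase a).matrix L =
        Matrix.diagonal fun x : Reg L => if x.bit a then Complex.I else 1 := by
      ext y x
      by_cases hyx : y = x
      · subst hyx; simp [UGate.matrix]
      · simp [UGate.matrix, hyx]
    simp only [invGate, unitaryProduct, one_mul, h, Matrix.diagonal_mul_diagonal,
      Matrix.diagonal_conjTranspose]
    congr 1
    funext x
    simp only [Pi.star_apply, apply_ite star, Complex.star_def, Complex.conj_I, star_one]
    split_ifs
    · linear_combination Complex.I * Complex.I_mul_I
    · simp

theorem unitaryProduct_invList {us : List UGate} (hus : ∀ u ∈ us, u.Valid L) :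
    unitaryProduct L (invList us) = (unitaryProduct L us)ᴴ := by
  induction us with
  | nil => simp [invList, unitaryProduct]
  | cons u us ih =>
    rw [invList, unitaryProduct_append, unitaryProduct, Matrix.conjTranspose_mul,
      ih fun v hv => hus v (by simp [hv]), unitaryProduct_invGate (hus u (by simp))]

theorem unitaryProduct_mem_unitaryGroup {us : List UGate} (hus : ∀ u ∈ us, u.Valid L) :
    unitaryProduct L us ∈ Matrix.unitaryGroup (Reg L) ℂ := by
  induction us with
  | nil => exact one_mem _
  | cons u us ih =>
    refine mul_mem (ih fun v hv => hus v (by simp [hv])) ?_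
    rw [Matrix.mem_unitaryGroup_iff', Matrix.star_eq_conjTranspose,
      ← unitaryProduct_invGate (hus u (by simp)), unitaryProduct_invGate_mul (hus u (by simp))]

end QSim

namespace QSim

open Function Finsupp
open scoped Matrix

variable {L : Finset ℕ}

/-! ### Supports -/

theorem mem_support_step {u : UGate} {v : Vec} {r : Config} (hr : r ∈ (step u v).support) :
    ∃ s ∈ v.support, r ∈ (act u s).support := by
  classical
  rw [step, linearCombination_apply] at hr
  obtain ⟨s, hs, hr⟩ := Finset.mem_biUnion.1 (support_sum hr)
  exact ⟨s, hs, support_smul hr⟩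

theorem eq_of_mem_support_act {u : UGate} (hu : u.Valid L) {s r : Config}
    (hr : r ∈ (act u s).support) {w : ℕ} (hw : w ∉ L) : r w = s w := by
  rw [act_eq_sum hu, mem_support_iff, finsetSum_apply] at hr
  obtain ⟨y, -, hy⟩ := Finset.exists_ne_zero_of_sum_ne_zero hr
  have : merge L s y = r := by
    by_contra hne
    rw [Finsupp.smul_apply, single_eq_of_ne (Ne.symm hne), smul_zero] at hy
    exact hy rfl
  rw [← this, merge, dif_neg hw]

theorem eq_of_mem_support_step {u : UGate} (hu : u.Valid L) {v : Vec} {b : Bool} {w : ℕ}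
    (hw : w ∉ L) (hv : ∀ s ∈ v.support, s w = b) : ∀ r ∈ (step u v).support, r w = b := by
  intro r hr
  obtain ⟨s, hs, hr⟩ := mem_support_step hr
  rw [eq_of_mem_support_act hu hr hw, hv s hs]

theorem eq_of_mem_support_app {us : List UGate} (hus : ∀ u ∈ us, u.Valid L) {v : Vec} {b : Bool}
    {w : ℕ} (hw : w ∉ L) (hv : ∀ s ∈ v.support, s w = b) : ∀ r ∈ (app us v).support, r w = b := by
  induction us generalizing v with
  | nil => exact hv
  | cons u us ih =>
    exact ih (fun u' hu' => hus u' (by simp [hu'])) (eq_of_mem_support_step (hus u (by simp)) hw hv)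

/-! ### Deferring erasure -/

/-- The operator on the qubits in `L` that is left of `|s⟩⟨s'|` when the other qubits are traced
out. -/
noncomputable def traceOut (L : Finset ℕ) (s s' : Config) : Matrix (Reg L) (Reg L) ℂ := by
  classical
  exact if ∀ w, w ∉ L → s w = s' w then Matrix.single (restr L s) (restr L s') 1 else 0

/-- The operator on the qubits in `L` that is left of `|v⟩⟨w|` when the other qubits are traced
out. -/
noncomputable def reduced (L : Finset ℕ) :
    Vec →ₗ[ℂ] Vec →ₗ⋆[ℂ] Matrix (Reg L) (Reg L) ℂ :=
  LinearMap.mk₂'ₛₗ (RingHom.id ℂ) (starRingEnd ℂ)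
    (fun v w => v.sum fun s a => w.sum fun s' b => (a * star b) • traceOut L s s')
    (fun v v' w => by
      classical
      refine sum_add_index' (fun s => by simp) fun s a a' => ?_
      simp only [add_mul, add_smul, Finsupp.sum_add])
    (fun c v w => by
      rw [sum_smul_index' (fun s => by simp), Finsupp.smul_sum]
      simp only [Finsupp.smul_sum, smul_smul, smul_eq_mul, mul_assoc, RingHom.id_apply])
    (fun v w w' => by
      classical
      rw [← Finsupp.sum_add]
      refine Finsupp.sum_congr fun s _ => ?_
      refine sum_add_index' (fun s => by simp) fun s a a' => ?_
      simp only [star_add, mul_add, add_smul])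
    (fun c v w => by
      rw [Finsupp.smul_sum]
      refine Finsupp.sum_congr fun s _ => ?_
      rw [sum_smul_index' (fun s => by simp), Finsupp.smul_sum]
      refine Finsupp.sum_congr fun s' _ => ?_
      rw [smul_smul, smul_eq_mul, star_mul', mul_left_comm]
      rfl)

theorem reduced_apply (v w : Vec) : reduced L v w =
    ∑ s ∈ v.support, ∑ s' ∈ w.support, (v s * star (w s')) • traceOut L s s' := rfl

theorem reduced_single (s s' : Config) : reduced L (single s 1) (single s' 1) = traceOut L s s' := by
  simp [reduced]

theorem mul_single_mul_apply {α β : Type*} [Fintype α] [DecidableEq α] (A : Matrix β α ℂ)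
    (i j : α) (y z : β) : (A * Matrix.single i j (1 : ℂ) * Aᴴ) y z = A y i * star (A z j) := by
  simp [Matrix.mul_apply, Matrix.single_apply, ite_and]

open scoped Classical in
theorem conj_traceOut {L' : Finset ℕ} (A : Matrix (Reg L') (Reg L) ℂ) (s s' : Config)
    (y z : Reg L') : (A * traceOut L s s' * Aᴴ) y z =
      if ∀ w, w ∉ L → s w = s' w then
        A y (restr L s) * star (A z (restr L s')) else 0 := by
  unfold traceOut
  split_ifs
  · exact mul_single_mul_apply _ _ _ _ _
  · simp

open scoped Classical in
theorem traceOut_apply (s s' : Config) (y z : Reg L) : traceOut L s s' y z =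
      if (∀ w, w ∉ L → s w = s' w) ∧ y = restr L s ∧ z = restr L s' then 1 else 0 := by
  unfold traceOut
  by_cases h : ∀ w, w ∉ L → s w = s' w
  · rw [if_pos h, Matrix.single_apply]
    exact if_congr (by rw [and_iff_right h, eq_comm, @eq_comm _ z]) rfl rfl
  · rw [if_neg h, if_neg fun h' => h h'.1]; rfl

theorem conj_reduced {L' : Finset ℕ} (A : Matrix (Reg L') (Reg L) ℂ) (v w : Vec) :
    A * reduced L v w * Aᴴ = ∑ s ∈ v.support, ∑ s' ∈ w.support,
      (v s * star (w s')) • (A * traceOut L s s' * Aᴴ) := by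
  simp only [reduced_apply, Matrix.mul_sum, Matrix.sum_mul, Matrix.mul_smul, Matrix.smul_mul]

open scoped Classical in
/-- A gate on wires in `L` commutes with tracing out the other wires. -/
theorem conj_matrix_reduced {u : UGate} (hu : u.Valid L) (v w : Vec) :
    u.matrix L * reduced L v w * (u.matrix L)ᴴ = reduced L (step u v) (step u w) := by
  have key : ∀ s s', u.matrix L * traceOut L s s' * (u.matrix L)ᴴ =
      reduced L (act u s) (act u s') := fun s s' => by
    rw [act_eq_sum hu, act_eq_sum hu]
    simp only [map_sum, map_smul, LinearMap.sum_apply, LinearMap.smul_apply, map_smulₛₗ,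
      reduced_single]
    ext y z
    have h (y' z' : Reg L) : traceOut L (merge L s y') (merge L s' z') y z =
        if y = y' then if z = z' then traceOut L s s' (restr L s) (restr L s') else 0 else 0 := by
      rw [traceOut_apply, traceOut_apply, restr_merge, restr_merge]
      have : (∀ w, w ∉ L → merge L s y' w = merge L s' z' w) ↔ ∀ w, w ∉ L → s w = s' w :=
        forall₂_congr fun w hw => by simp [merge, hw]
      rw [this]
      by_cases h1 : y = y' <;> by_cases h2 : z = z' <;> simp [h1, h2]
    simp only [Matrix.sum_apply, Matrix.smul_apply, h, smul_eq_mul, mul_ite, mul_zero,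
      Finset.sum_ite_eq, Finset.mem_univ, if_true, conj_traceOut, traceOut_apply, and_true]
    split_ifs
    · rw [mul_one, mul_comm]; rfl
    · rfl
  rw [conj_reduced]
  simp only [step, linearCombination_apply, Finsupp.sum, map_sum, LinearMap.sum_apply, map_smul,
    LinearMap.smul_apply, map_smulₛₗ, key, Finset.smul_sum, smul_smul]
  rw [Finset.sum_comm]
  refine Finset.sum_congr rfl fun _ _ => Finset.sum_congr rfl fun _ _ => ?_
  rw [mul_comm]
  rfl

open scoped Classical in
/-- Adding a fresh qubit amounts to no longer tracing out a wire that carries `0`. -/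
theorem conj_addZero_reduced {N : ℕ} (hN : N ∉ L) {v : Vec} (hv : ∀ s ∈ v.support, s N = false) :
    addZero N L * reduced L v v * (addZero N L)ᴴ = reduced (insert N L) v v := by
  rw [conj_reduced, reduced_apply]
  refine Finset.sum_congr rfl fun s hs => Finset.sum_congr rfl fun s' hs' => ?_
  congr 1
  ext y z
  have key : ∀ (s : Config) (y : Reg (insert N L)), s N = false →
      addZero N L y (restr L s) = (if y = restr (insert N L) s then 1 else 0) := by
    intro s y hs
    simp only [addZero, Matrix.of_apply, eq_restr_iff]
    refine if_congr ?_ rfl rfl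
    rw [Finset.forall_mem_insert, hs, and_comm]
    refine and_congr Iff.rfl (forall₂_congr fun w hw => by rw [restr_bit hw])
  rw [conj_traceOut, traceOut_apply, key s y (hv s hs), key s' z (hv s' hs')]
  have h : (∀ w, w ∉ insert N L → s w = s' w) ↔ ∀ w, w ∉ L → s w = s' w := by
    refine ⟨fun h w hw => ?_, fun h w hw => h w fun hw' => hw (Finset.mem_insert_of_mem hw')⟩
    by_cases hwN : w = N
    · subst hwN; rw [hv s hs, hv s' hs']
    · exact h w (by simp [hwN, hw])
  rw [h]
  by_cases h1 : y = restr (insert N L) s <;> by_cases h2 : z = restr (insert N L) s' <;>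
    simp [h1, h2]

open scoped Classical in
/-- Erasing a qubit amounts to tracing out one more wire. -/
theorem sum_conj_project_reduced {a : ℕ} (ha : a ∈ L) (v : Vec) :
    ∑ b : Bool, project a b L * reduced L v v * (project a b L)ᴴ = reduced (L.erase a) v v := by
  simp only [conj_reduced]
  rw [Finset.sum_comm, reduced_apply]
  refine Finset.sum_congr rfl fun s _ => ?_
  rw [Finset.sum_comm]
  refine Finset.sum_congr rfl fun s' _ => ?_
  rw [← Finset.smul_sum]
  congr 1
  ext y z
  have key : ∀ (b : Bool) (s : Config) (y : Reg (L.erase a)), project a b L y (restr L s) =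
      if y = restr (L.erase a) s ∧ s a = b then 1 else 0 := by
    intro b s y
    simp only [project, Matrix.of_apply, eq_restr_iff, restr_bit ha]
    refine if_congr (and_congr ?_ Iff.rfl) rfl rfl
    exact forall₂_congr fun w hw => by rw [restr_bit (Finset.mem_of_mem_erase hw)]
  have h : (∀ w, w ∉ L.erase a → s w = s' w) ↔ (∀ w, w ∉ L → s w = s' w) ∧ s a = s' a := by
    refine ⟨fun h => ⟨fun w hw => h w fun hw' => hw (Finset.mem_of_mem_erase hw'),
      h a (by simp)⟩, fun ⟨h, h'⟩ w hw => ?_⟩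
    by_cases hwa : w = a
    · subst hwa; exact h'
    · exact h w fun hw' => hw (Finset.mem_erase.2 ⟨hwa, hw'⟩)
  rw [Matrix.sum_apply, Fintype.sum_bool, conj_traceOut, conj_traceOut, traceOut_apply, h]
  simp only [key]
  by_cases h0 : ∀ w, w ∉ L → s w = s' w
  · by_cases h1 : y = restr (L.erase a) s
    · by_cases h2 : z = restr (L.erase a) s'
      · cases s a <;> cases s' a <;> simp [h1, h2]
      · simp [h2]
    · simp [h1]
  · rw [if_neg h0, if_neg h0, if_neg (fun h' => h0 h'.1.1), add_zero]

/-- The unitary gates of a circuit. -/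
def unitaries : List Gate → List UGate
  | [] => []
  | .unitary u :: gs => u :: unitaries gs
  | .ancilla :: gs => unitaries gs
  | .erase _ :: gs => unitaries gs

/-- The number of ancillary gates of a circuit. -/
def ancillas : List Gate → ℕ
  | [] => 0
  | .unitary _ :: gs => ancillas gs
  | .ancilla :: gs => ancillas gs + 1
  | .erase _ :: gs => ancillas gs

/-- Since the labels of qubits are never used again, a circuit computes the same as its unitary
gates, applied to all the qubits with the ancillary ones initially in the state `|0⟩`, after which
the erased qubits are traced out. -/
theorem run_reduced (gs : List Gate) (N : ℕ) (L : Finset ℕ) (v : Vec) (hval : ValidList gs N L)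
    (hL : ∀ w ∈ L, w < N) (hv : ∀ s ∈ v.support, ∀ w, N ≤ w → s w = false) :
    run gs N L (reduced L v v) =
      reduced (liveAfter gs N L) (app (unitaries gs) v) (app (unitaries gs) v) := by
  induction gs generalizing N L v with
  | nil => rfl
  | cons g gs ih =>
    obtain ⟨hg, hgs⟩ := hval
    cases g with
    | unitary u =>
      change run gs N L (u.matrix L * reduced L v v * (u.matrix L)ᴴ) = _
      rw [conj_matrix_reduced hg]
      refine ih N L (step u v) hgs hL fun s hs w hw => ?_
      exact eq_of_mem_support_step hg (fun h => absurd (hL w h) (by omega))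
        (fun s hs => hv s hs w hw) s hs
    | ancilla =>
      change run gs (N + 1) (insert N L) (addZero N L * reduced L v v * (addZero N L)ᴴ) = _
      rw [conj_addZero_reduced (fun h => absurd (hL N h) (by omega))
        fun s hs => hv s hs N le_rfl]
      refine ih (N + 1) (insert N L) v hgs (fun w hw => ?_) fun s hs w hw => hv s hs w (by omega)
      rcases Finset.mem_insert.1 hw with rfl | hw
      · omega
      · exact (hL w hw).trans (by omega)
    | erase a =>
      change run gs N (L.erase a)
        (∑ b : Bool, project a b L * reduced L v v * (project a b L)ᴴ) = _
      rw [sum_conj_project_reduced hg]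
      exact ih N (L.erase a) v hgs (fun w hw => hL w (Finset.mem_of_mem_erase hw)) hv

theorem valid_mono {L L' : Finset ℕ} (h : L ⊆ L') {u : UGate} (hu : u.Valid L) : u.Valid L' := by
  cases u with
  | toffoli a b c => exact ⟨h hu.1, h hu.2.1, h hu.2.2.1, hu.2.2.2⟩
  | hadamard a => exact h hu
  | phase a => exact h hu

theorem valid_unitaries (gs : List Gate) (N : ℕ) (L : Finset ℕ) (hval : ValidList gs N L)
    (hL : ∀ w ∈ L, w < N) {B : ℕ} (hB : N + ancillas gs ≤ B) :
    ∀ u ∈ unitaries gs, u.Valid (Finset.range B) := by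
  induction gs generalizing N L with
  | nil => simp [unitaries]
  | cons g gs ih =>
    obtain ⟨hg, hgs⟩ := hval
    cases g with
    | unitary u =>
      intro u' hu'
      rcases List.mem_cons.1 hu' with rfl | hu'
      · refine valid_mono (fun w hw => ?_) hg
        have := hL w hw
        simp only [ancillas] at hB
        exact Finset.mem_range.2 (by omega)
      · exact ih N L hgs hL hB u' hu'
    | ancilla =>
      refine ih (N + 1) (insert N L) hgs (fun w hw => ?_) (by simp only [ancillas] at hB; omega)
      rcases Finset.mem_insert.1 hw with rfl | hw
      · omega
      · exact (hL w hw).trans (by omega)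
    | erase a => exact ih N (L.erase a) hgs (fun w hw => hL w (Finset.mem_of_mem_erase hw)) hB

/-- All labels of qubits are below the number of input wires plus the number of ancillary gates. -/
theorem lt_of_mem_liveAfter (gs : List Gate) (N : ℕ) (L : Finset ℕ)
    (hL : ∀ w ∈ L, w < N) : ∀ w ∈ liveAfter gs N L, w < N + ancillas gs := by
  induction gs generalizing N L with
  | nil => simpa [liveAfter, ancillas] using hL
  | cons g gs ih =>
    cases g with
    | unitary u => exact ih N L hL
    | ancilla =>
      intro w hw
      have := ih (N + 1) (insert N L) (fun w hw => by
        rcases Finset.mem_insert.1 hw with rfl | hw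
        · omega
        · exact (hL w hw).trans (by omega)) w hw
      simp only [ancillas]
      omega
    | erase a => exact ih N (L.erase a) (fun w hw => hL w (Finset.mem_of_mem_erase hw))

/-! ### Measurement probabilities -/

/-- The expected value of `f` when `v` is measured in the standard basis. -/
noncomputable def wt (v : Vec) (f : Config → ℝ) : ℝ := ∑ s ∈ v.support, ‖v s‖ ^ 2 * f s

/-- The configuration that has the bits of `x` on the first wires, and zeros elsewhere. -/
def inputConfig {n : ℕ} (x : Fin n → Bool) : Config := fun w => if h : w < n then x ⟨w, h⟩ else false

theorem restr_inputConfig {n : ℕ} (x : Fin n → Bool) (y : Reg (Finset.range n)) :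
    y = restr _ (inputConfig x) ↔ readBits Fin.val y = x := by
  rw [eq_restr_iff, funext_iff]
  constructor
  · intro h i
    rw [readBits, h i (by simp), inputConfig, dif_pos i.2]
  · intro h w hw
    have hw' := Finset.mem_range.1 hw
    rw [inputConfig, dif_pos hw', ← h ⟨w, hw'⟩, readBits]

open scoped Classical in
/-- The acceptance probability of a circuit is the probability that the output wire carries `0`
after its unitary gates. -/
theorem acceptProb_eq {n : ℕ} (C : QCircuit n 1) (x : Fin n → Bool) :
    C.acceptProb x = wt (app (unitaries C.gates) (single (inputConfig x) 1))
      fun s => if s (C.outputs 0) then 0 else 1 := by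
  have h1 : (basisState x).submatrix (readBits Fin.val) (readBits Fin.val) =
      reduced (Finset.range n) (single (inputConfig x) 1) (single (inputConfig x) 1) := by
    ext y z
    rw [reduced_single, traceOut_apply, basisState,
      Matrix.submatrix_apply, Matrix.single_apply]
    refine if_congr ?_ rfl rfl
    rw [restr_inputConfig, restr_inputConfig, eq_comm, @eq_comm _ x]
    simp
  have hlive := C.outputs_live
  rw [QCircuit.acceptProb, QCircuit.channel, h1, run_reduced _ _ _ _ C.valid
    (fun w hw => Finset.mem_range.1 hw) (fun s hs w hw => ?_), Matrix.submatrix_apply]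
  · generalize liveAfter C.gates n (Finset.range n) = L at hlive
    have hL : ∀ w, w ∈ L ↔ w = C.outputs 0 := fun w => by
      rw [← hlive]; simp
    have h2 : loadBits C.outputs L (fun _ => false) = restr L fun _ => false := by
      funext w
      simp [loadBits, restr]
    rw [h2, reduced_apply, wt, Matrix.sum_apply, Complex.re_sum]
    refine Finset.sum_congr rfl fun s hs => ?_
    rw [Matrix.sum_apply, Finset.sum_eq_single s]
    · rw [Matrix.smul_apply, traceOut_apply, Complex.star_def, Complex.mul_conj,
        Complex.normSq_eq_norm_sq]
      have : restr L (fun _ => false) = restr L s ↔ s (C.outputs 0) = false := by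
        rw [restr_eq_restr_iff]
        simp only [hL, forall_eq]
        exact eq_comm
      simp only [implies_true, true_and, and_self, this]
      cases s (C.outputs 0) <;> simp [-Complex.ofReal_pow]
    · intro s' _ hne
      rw [Matrix.smul_apply, traceOut_apply, if_neg, smul_zero]
      rintro ⟨h1, h2, h3⟩
      refine hne ?_
      funext w
      by_cases hw : w ∈ L
      · exact (restr_eq_restr_iff.1 (h3.symm.trans h2) w hw)
      · exact (h1 w hw).symm
    · intro h; exact absurd hs h
  · rw [support_single _ one_ne_zero, Finset.mem_singleton] at hs
    subst hs
    simp [inputConfig, hw]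

/-! ### Unitary circuits -/

theorem run_unitary (us : List UGate) (N : ℕ) (L : Finset ℕ) (ρ : Matrix (Reg L) (Reg L) ℂ)
    (s s' : Config) : run (us.map Gate.unitary) N L ρ (restr _ s) (restr _ s') =
      (unitaryProduct L us * ρ * (unitaryProduct L us)ᴴ) (restr L s) (restr L s') := by
  induction us generalizing ρ with
  | nil => simp [unitaryProduct]; rfl
  | cons u us ih =>
    refine (ih (u.matrix L * ρ * (u.matrix L)ᴴ)).trans ?_
    simp only [unitaryProduct, Matrix.conjTranspose_mul, Matrix.mul_assoc]

theorem validList_unitary {us : List UGate} (N : ℕ) (hus : ∀ u ∈ us, u.Valid L) :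
    ValidList (us.map Gate.unitary) N L := by
  induction us with
  | nil => trivial
  | cons u us ih => exact ⟨hus u (by simp), ih fun v hv => hus v (by simp [hv])⟩

theorem liveAfter_unitary (us : List UGate) (N : ℕ) (L : Finset ℕ) :
    liveAfter (us.map Gate.unitary) N L = L := by
  induction us with
  | nil => rfl
  | cons u us ih => exact ih

/-- The circuit on `k` qubits with the given unitary gates. -/
def unitaryCircuit (k : ℕ) (us : List UGate) (hus : ∀ u ∈ us, u.Valid (Finset.range k)) :
    QCircuit k k where
  gates := us.map Gate.unitary
  outputs := Fin.val
  valid := validList_unitary k hus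
  outputs_injective := Fin.val_injective
  outputs_live := by
    rw [liveAfter_unitary]
    ext w
    simp only [Finset.mem_image, Finset.mem_univ, true_and, Finset.mem_range]
    exact ⟨fun ⟨i, hi⟩ => hi ▸ i.2, fun h => ⟨⟨w, h⟩, rfl⟩⟩

theorem loadBits_val {k : ℕ} (L : Finset ℕ) (u : Fin k → Bool) :
    loadBits Fin.val L u = restr L (inputConfig u) := by
  funext ⟨w, hw⟩
  simp only [loadBits, restr, inputConfig]
  split_ifs with h
  · by_cases hu : u ⟨w, h⟩
    · rw [hu, decide_eq_true]
      exact ⟨⟨w, h⟩, rfl, hu⟩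
    · rw [Bool.not_eq_true] at hu
      rw [hu, decide_eq_false]
      rintro ⟨⟨_, _⟩, rfl, h2⟩
      simp [hu] at h2
  · rw [decide_eq_false]
    rintro ⟨i, hi, -⟩
    exact h (hi ▸ i.2)

/-- Basis states of `k` qubits as registers. -/
def regEquiv (k : ℕ) : (Fin k → Bool) ≃ Reg (Finset.range k) where
  toFun := loadBits Fin.val _
  invFun := readBits Fin.val
  left_inv x := by rw [loadBits_val]; exact (restr_inputConfig x _).1 rfl
  right_inv y := by rw [loadBits_val]; exact ((restr_inputConfig _ y).2 rfl).symm

/-- The matrix of a unitary circuit. -/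
noncomputable def circuitMatrix (k : ℕ) (us : List UGate) :
    Matrix (Fin k → Bool) (Fin k → Bool) ℂ :=
  (unitaryProduct (Finset.range k) us).submatrix (loadBits Fin.val _) (loadBits Fin.val _)

/-- A circuit of unitary gates with its wires in the standard order implements its matrix. -/
theorem implementsUnitary_unitaryCircuit (k : ℕ) (us : List UGate)
    (hus : ∀ u ∈ us, u.Valid (Finset.range k)) :
    (unitaryCircuit k us hus).ImplementsUnitary (circuitMatrix k us) := by
  have hU : circuitMatrix k us =
      (unitaryProduct (Finset.range k) us).submatrix (regEquiv k) (regEquiv k) := rfl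
  refine ⟨⟨us, rfl, ?_⟩, ?_, fun ρ => ?_⟩
  · rfl
  · rw [Matrix.mem_unitaryGroup_iff', Matrix.star_eq_conjTranspose, hU,
      Matrix.conjTranspose_submatrix, Matrix.submatrix_mul_equiv, ← Matrix.star_eq_conjTranspose,
      Matrix.mem_unitaryGroup_iff'.1 (unitaryProduct_mem_unitaryGroup hus),
      Matrix.submatrix_one_equiv]
  · have hρ : ρ = (ρ.submatrix (readBits (L := Finset.range k) Fin.val)
        (readBits Fin.val)).submatrix (regEquiv k) (regEquiv k) := by
      ext y z
      have h : ∀ y, readBits Fin.val (regEquiv k y) = y := (regEquiv k).left_inv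
      simp only [Matrix.submatrix_apply, h]
    conv_rhs => rw [hρ, hU, Matrix.conjTranspose_submatrix, Matrix.submatrix_mul_equiv,
      Matrix.submatrix_mul_equiv]
    ext y z
    change run (us.map Gate.unitary) k (Finset.range k) _ (loadBits Fin.val _ y)
      (loadBits Fin.val _ z) = _
    rw [loadBits_val, loadBits_val, run_unitary, ← loadBits_val, ← loadBits_val]
    rfl

end QSim

/-! ### The amplified circuit -/

namespace QSim

open Function
open Finsupp hiding update update_self update_idem
open scoped Matrix

/-- Renames the wires of a gate. -/
def mapGate (e : ℕ → ℕ) : UGate → UGate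
  | .toffoli a b c => .toffoli (e a) (e b) (e c)
  | .hadamard a => .hadamard (e a)
  | .phase a => .phase (e a)

/-- A circuit that negates the qubit `w`. -/
def notGates (w : ℕ) : List UGate := [.hadamard w, .phase w, .phase w, .hadamard w]

/-- Copies the first `m` wires to the wires `b, b + 1, …`, if the wire `n` carries `1`. -/
def copyIn (n b : ℕ) : ℕ → List UGate
  | 0 => []
  | j + 1 => .toffoli n j (b + j) :: copyIn n b j

/-- Moves a token on the wires `n + 1, …, n + 1 + m` one step up, if the wire `o` carries `1`. -/
def countIn (n o : ℕ) : ℕ → List UGate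
  | 0 => []
  | j + 1 => .toffoli o (n + 1 + j) (n + 1 + j + 1) :: .toffoli o (n + 1 + j + 1) (n + 1 + j) ::
      countIn n o j

/-- Negates the wire `A` if there is a token on one of the wires `n + 1, …, n + m` and the wire
`n` carries `1`. -/
def flips (n A : ℕ) : ℕ → List UGate
  | 0 => []
  | j + 1 => flips n A j ++ [.toffoli n (n + 1 + j) A]

/-- One run of the circuit `us` on the block of wires that starts at `b`: the input is copied into
the block, and the token moves if the output wire `o` of the block carries `1`. -/
def trial (n D o : ℕ) (us : List UGate) (b : ℕ) : List UGate :=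
  copyIn n b n ++ (us.map (mapGate (b + ·)) ++ countIn n (b + o) (2 * D))

/-- Consecutive runs of `us` on consecutive blocks of `D` wires. -/
def trials (n D o : ℕ) (us : List UGate) : ℕ → ℕ → List UGate
  | 0, _ => []
  | m + 1, b => trial n D o us b ++ trials n D o us m (b + D)

/-- Sets up the constant wire `n` and the token, and runs `us` on `2 * D` blocks. -/
def compute (n D o : ℕ) (us : List UGate) : List UGate :=
  notGates n ++ (notGates (n + 1) ++ trials n D o us (2 * D) (n + 2 + 2 * D))

/-- The label of the wire that receives the answer. -/
def target (n D : ℕ) : ℕ := n + (2 + 2 * D + 2 * D * D)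

/-- The computation of the answer, with the intermediate results uncomputed. -/
def amplified (n D o : ℕ) (us : List UGate) : List UGate :=
  compute n D o us ++ (flips n (target n D) (D + 1) ++ invList (compute n D o us))

/-! ### Validity of the amplified circuit -/

theorem valid_mapGate {e : ℕ → ℕ} (he : Injective e) {L L' : Finset ℕ} (h : ∀ w ∈ L, e w ∈ L')
    {u : UGate} (hu : u.Valid L) : (mapGate e u).Valid L' := by
  cases u with
  | toffoli a b c =>
    exact ⟨h _ hu.1, h _ hu.2.1, h _ hu.2.2.1, he.ne hu.2.2.2.1, he.ne hu.2.2.2.2.1,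
      he.ne hu.2.2.2.2.2⟩
  | hadamard a => exact h _ hu
  | phase a => exact h _ hu

theorem valid_notGates {w k : ℕ} (h : w < k) :
    ∀ u ∈ notGates w, u.Valid (Finset.range k) := by
  intro u hu
  simp only [notGates, List.mem_cons, List.not_mem_nil, or_false] at hu
  rcases hu with rfl | rfl | rfl | rfl <;> exact Finset.mem_range.2 h

theorem valid_copyIn {n b k m : ℕ} (hm : m ≤ n) (hb : n < b) (hk : b + m ≤ k) :
    ∀ u ∈ copyIn n b m, u.Valid (Finset.range k) := by
  induction m with
  | zero => simp [copyIn]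
  | succ j ih =>
    intro u hu
    rcases List.mem_cons.1 hu with rfl | hu
    · simp only [UGate.Valid, Finset.mem_range]; omega
    · exact ih (by omega) (by omega) u hu

theorem valid_countIn {n o k m : ℕ} (ho : n + 1 + m < o) (hk : o < k) :
    ∀ u ∈ countIn n o m, u.Valid (Finset.range k) := by
  induction m with
  | zero => simp [countIn]
  | succ j ih =>
    intro u hu
    simp only [countIn, List.mem_cons] at hu
    rcases hu with rfl | rfl | hu
    · simp only [UGate.Valid, Finset.mem_range]; omega
    · simp only [UGate.Valid, Finset.mem_range]; omega
    · exact ih (by omega) u hu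

theorem valid_flips {n A k m : ℕ} (hA : n + m < A) (hk : A < k) :
    ∀ u ∈ flips n A m, u.Valid (Finset.range k) := by
  induction m with
  | zero => simp [flips]
  | succ j ih =>
    intro u hu
    rcases List.mem_append.1 hu with hu | hu
    · exact ih (by omega) u hu
    · rw [List.mem_singleton] at hu
      subst hu
      simp only [UGate.Valid, Finset.mem_range]; omega

section

variable {n D o : ℕ} {us : List UGate} (hn : n ≤ D) (ho : o < D)
  (hus : ∀ u ∈ us, u.Valid (Finset.range D))

include hn ho hus

theorem valid_trial {b k : ℕ} (hb : n + 2 + 2 * D ≤ b) (hk : b + D ≤ k) :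
    ∀ u ∈ trial n D o us b, u.Valid (Finset.range k) := by
  intro u hu
  simp only [trial, List.mem_append, List.mem_map] at hu
  rcases hu with hu | ⟨u, hu, rfl⟩ | hu
  · exact valid_copyIn le_rfl (by omega) (by omega) u hu
  · refine valid_mapGate (add_right_injective b) (fun w hw => ?_) (hus u hu)
    have := Finset.mem_range.1 hw
    exact Finset.mem_range.2 (by omega)
  · exact valid_countIn (by omega) (by omega) u hu

theorem valid_trials {m b k : ℕ} (hb : n + 2 + 2 * D ≤ b) (hk : b + m * D ≤ k) :
    ∀ u ∈ trials n D o us m b, u.Valid (Finset.range k) := by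
  induction m generalizing b with
  | zero => simp [trials]
  | succ m ih =>
    rw [add_mul, one_mul] at hk
    intro u hu
    rcases List.mem_append.1 hu with hu | hu
    · exact valid_trial hn ho hus hb (by omega) u hu
    · exact ih (by omega) (by omega) u hu

theorem valid_compute : ∀ u ∈ compute n D o us, u.Valid (Finset.range (target n D)) := by
  intro u hu
  simp only [compute, List.mem_append] at hu
  rcases hu with hu | hu | hu
  · exact valid_notGates (by unfold target; omega) u hu
  · exact valid_notGates (by unfold target; omega) u hu
  · exact valid_trials hn ho hus le_rfl (by unfold target; omega) u hu

theorem valid_amplified : ∀ u ∈ amplified n D o us, u.Valid (Finset.range (target n D + 1)) := by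
  have h : ∀ u ∈ compute n D o us, u.Valid (Finset.range (target n D + 1)) := fun u hu =>
    valid_mono (Finset.range_subset_range.2 (Nat.le_succ _)) (valid_compute hn ho hus u hu)
  intro u hu
  simp only [amplified, List.mem_append] at hu
  rcases hu with hu | hu | hu
  · exact h u hu
  · exact valid_flips (by unfold target; omega) (Nat.lt_succ_self _) u hu
  · exact valid_of_mem_invList h u hu

end

/-! ### Action of the classical parts -/

theorem app_toffoli_cons (a b c : ℕ) (us : List UGate) (s : Config) (x : ℂ) :
    app (.toffoli a b c :: us) (single s x) =
      app us (single (update s c (xor (s c) (s a && s b))) x) := by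
  rw [app_cons, step_single, act, smul_single_one]

/-- The phase gate twice is `Z`, and `X = H Z H`. -/
theorem app_notGates (w : ℕ) (s : Config) :
    app (notGates w) (single s 1) = single (update s w (!s w)) 1 := by
  classical
  have h2 : ((1 / Real.sqrt 2 : ℝ) : ℂ) * ((1 / Real.sqrt 2 : ℝ) : ℂ) = 1 / 2 := by
    rw [← Complex.ofReal_mul, div_mul_div_comm, Real.mul_self_sqrt (by norm_num)]
    norm_num
  generalize hr : ((1 / Real.sqrt 2 : ℝ) : ℂ) = r at h2
  have hI := Complex.I_mul_I
  simp only [notGates, app_cons, app_nil, act, map_add, step_single, Function.update_self,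
    Function.update_idem, hr, smul_add, smul_single, smul_eq_mul, one_mul, if_true, if_false,
    Bool.false_eq_true, mul_one]
  ext t
  cases h : s w <;> simp only [Finsupp.add_apply, single_apply, Bool.not_true, Bool.not_false,
    Bool.false_eq_true, if_true, if_false]
  · split_ifs <;> first | ring1 | linear_combination 2 * h2 |
      linear_combination r * r * hI | linear_combination 2 * h2 - r * r * hI
  · split_ifs <;> first | ring1 | linear_combination 2 * h2 |
      linear_combination r * r * hI | linear_combination 2 * h2 - r * r * hI

/-- The configuration with the bits of `y` on the block of `B` wires that starts at `b`, and the
bits of `s` elsewhere. -/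
def put (b B : ℕ) (s y : Config) : Config :=
  fun w => if b ≤ w ∧ w < b + B then y (w - b) else s w

theorem put_block {b B : ℕ} (s y : Config) {w : ℕ} (hw : w < B) : put b B s y (b + w) = y w := by
  simp [put, hw]

theorem put_of_lt {b B : ℕ} (s y : Config) {w : ℕ} (hw : w < b) : put b B s y w = s w := by
  simp [put, hw]

theorem put_of_le {b B : ℕ} (s y : Config) {w : ℕ} (hw : b + B ≤ w) : put b B s y w = s w := by
  rw [put, if_neg (by omega)]

theorem put_update {b B : ℕ} (s y : Config) {c : ℕ} (hc : c < B) (v : Bool) :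
    put b B s (update y c v) = update (put b B s y) (b + c) v := by
  funext w
  by_cases hw : w = b + c
  · subst hw; simp [put, hc]
  · rw [update_of_ne hw, put, put]
    split_ifs
    · rw [update_of_ne (by omega)]
    · rfl

theorem app_copyIn {n b m : ℕ} (hm : m ≤ n) (hb : n < b) {s : Config} (hs : s n = true)
    (h0 : ∀ j < m, s (b + j) = false) :
    app (copyIn n b m) (single s 1) = single (put b m s s) 1 := by
  induction m generalizing s with
  | zero =>
    have : put b 0 s s = s := by
      funext w; rw [put, if_neg (by omega)]
    rw [this]; rfl
  | succ j ih =>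
    rw [copyIn, app_toffoli_cons, hs, h0 j (by omega), Bool.true_and, Bool.false_xor, ih (by omega)
      (by rw [update_of_ne (by omega), hs])
      (fun i hi => by rw [update_of_ne (by omega), h0 i (by omega)])]
    congr 1
    funext w
    by_cases hw : w = b + j
    · subst hw; simp [put]
    · rw [put, put, update_of_ne hw]
      split_ifs
      · rw [update_of_ne (by omega)]
      · omega
      · omega
      · rfl

/-- If a map `h` of configurations is compatible with the renaming `e` of the wires, it turns the
action of a circuit into the action of the renamed circuit. -/
theorem app_mapGate {L : Finset ℕ} {e : ℕ → ℕ} {h : Config → Config}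
    (h1 : ∀ c ∈ L, ∀ y, h y (e c) = y c)
    (h2 : ∀ c ∈ L, ∀ y v, h (update y c v) = update (h y) (e c) v)
    {us : List UGate} (hus : ∀ u ∈ us, u.Valid L) (v : Vec) :
    app (us.map (mapGate e)) (mapDomain h v) = mapDomain h (app us v) := by
  have hact : ∀ u : UGate, u.Valid L → ∀ y, act (mapGate e u) (h y) = mapDomain h (act u y) := by
    intro u hu y
    cases u with
    | toffoli a b c =>
      simp only [mapGate, act, mapDomain_single, h1 a hu.1, h1 b hu.2.1, h1 c hu.2.2.1,
        h2 c hu.2.2.1]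
    | hadamard a =>
      have ha : a ∈ L := hu
      simp only [mapGate, act, mapDomain_add, mapDomain_single, h1 a ha, h2 a ha]
    | phase a => simp only [mapGate, act, mapDomain_single, h1 a hu]
  have hstep : ∀ u : UGate, u.Valid L → ∀ v,
      step (mapGate e u) (mapDomain h v) = mapDomain h (step u v) := by
    intro u hu v
    induction v using Finsupp.induction_linear with
    | zero => simp
    | add f g hf hg => rw [mapDomain_add, map_add, map_add, mapDomain_add, hf, hg]
    | single s c =>
      rw [mapDomain_single, step_single, step_single, mapDomain_smul, hact u hu]
  induction us generalizing v with
  | nil => rfl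
  | cons u us ih =>
    rw [List.map_cons, app_cons, app_cons, hstep u (hus u (by simp)),
      ih fun w hw => hus w (by simp [hw])]

/-- There is exactly one token on the wires `n + 1, …, n + 1 + M`, at position `k`. -/
def TokenAt (n M k : ℕ) (s : Config) : Prop := ∀ j ≤ M, s (n + 1 + j) = decide (j = k)

theorem TokenAt.unique {n M k k' : ℕ} {s : Config} (h : TokenAt n M k s) (h' : TokenAt n M k' s)
    (hk : k ≤ M) : k = k' := by
  have h1 := h k hk
  rw [h' k hk] at h1
  simpa using h1

/-- Moves the token one step up. -/
def moveToken (n k : ℕ) (s : Config) : Config :=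
  update (update s (n + 1 + k + 1) true) (n + 1 + k) false

theorem app_countIn_of_false {n o m : ℕ} {s : Config}
    (h : s o = false ∨ ∀ j ≤ m, s (n + 1 + j) = false) :
    app (countIn n o m) (single s 1) = single s 1 := by
  induction m with
  | zero => rfl
  | succ j ih =>
    have h1 : (s o && s (n + 1 + j)) = false := by
      rcases h with h | h
      · simp [h]
      · simp [h j (by omega)]
    have h2 : (s o && s (n + 1 + j + 1)) = false := by
      rcases h with h | h
      · simp [h]
      · simp [show s (n + 1 + j + 1) = false from h (j + 1) le_rfl]
    rw [countIn, app_toffoli_cons, h1, Bool.xor_false, update_eq_self, app_toffoli_cons, h2,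
      Bool.xor_false, update_eq_self]
    exact ih (h.imp_right fun h i hi => h i (by omega))

/-- The pairs of gates act from the top downwards, so that a token that has been moved is not moved
again. -/
theorem app_countIn_of_true {n o m M k : ℕ} (hm : m ≤ M) (hk : k < m) (ho : n + 1 + M < o)
    {s : Config} (hs : s o = true) (ht : TokenAt n M k s) :
    app (countIn n o m) (single s 1) = single (moveToken n k s) 1 := by
  induction m with
  | zero => omega
  | succ j ih =>
    have h1 : s (n + 1 + j) = decide (j = k) := ht j (by omega)
    have h2 : s (n + 1 + j + 1) = decide (j + 1 = k) := ht (j + 1) (by omega)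
    have h3 : decide (j + 1 = k) = false := by simp; omega
    rw [countIn, app_toffoli_cons, hs, h1, h2, h3, Bool.true_and, Bool.false_xor, app_toffoli_cons,
      update_self, update_of_ne (by omega : o ≠ n + 1 + j + 1), hs, Bool.true_and,
      update_of_ne (by omega : n + 1 + j ≠ n + 1 + j + 1), h1, Bool.xor_self]
    by_cases hjk : j = k
    · subst hjk
      rw [decide_eq_true rfl, app_countIn_of_false]
      · rfl
      · right
        intro i hi
        by_cases hij : i = j
        · subst hij; rw [update_self]
        · rw [update_of_ne (by omega), update_of_ne (by omega), ht i (by omega)]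
          simp [hij]
    · rw [decide_eq_false hjk] at h1 ⊢
      rw [h3] at h2
      rw [← h2, update_eq_self, h2, ← h1, update_eq_self]
      exact ih (by omega) (by omega)

/-- The effect of a run with result `y` on a configuration with the token at `k`. -/
def afterTrial (n D o b k : ℕ) (s y : Config) : Config :=
  if y o then moveToken n k (put b D s y) else put b D s y

theorem app_flips {n A m M k : ℕ} (hA : n + 1 + M < A) (hm : m ≤ M + 1) {s : Config}
    (hs : s n = true) (ht : TokenAt n M k s) :
    app (flips n A m) (single s 1) = single (if k < m then update s A (!s A) else s) 1 := by
  induction m with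
  | zero => simp [flips, app_nil]
  | succ j ih =>
    rw [flips, app_append, ih (by omega), app_toffoli_cons, app_nil]
    have h := ht j (by omega)
    congr 1
    by_cases hkj : k < j
    · rw [if_pos hkj, if_pos (by omega), update_of_ne (by omega : n + 1 + j ≠ A), h,
        decide_eq_false (by omega), Bool.and_false, Bool.xor_false, update_eq_self]
    · rw [if_neg hkj, hs, h, Bool.true_and]
      by_cases hkj' : j = k
      · rw [if_pos (by omega), decide_eq_true hkj', Bool.xor_true]
      · rw [if_neg (by omega), decide_eq_false hkj', Bool.xor_false, update_eq_self]

/-! ### The distribution of the token -/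

theorem sum_smul_single_apply {ι : Type*} {I : Finset ι} {a : ι → ℂ} {g : ι → Config}
    (hg : Set.InjOn g I) {i : ι} (hi : i ∈ I) :
    (∑ j ∈ I, a j • single (g j) (1 : ℂ)) (g i) = a i := by
  rw [finsetSum_apply, Finset.sum_eq_single i]
  · simp
  · intro j hj hji
    rw [Finsupp.smul_apply, single_eq_of_ne (fun h => hji (hg hj hi h.symm)), smul_zero]
  · exact fun h => absurd hi h

theorem exists_of_mem_support_sum {ι : Type*} {I : Finset ι} {a : ι → ℂ} {g : ι → Config}
    {s : Config} (hs : s ∈ (∑ j ∈ I, a j • single (g j) (1 : ℂ)).support) :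
    ∃ i ∈ I, g i = s := by
  rw [mem_support_iff, finsetSum_apply] at hs
  obtain ⟨i, hi, h⟩ := Finset.exists_ne_zero_of_sum_ne_zero hs
  refine ⟨i, hi, ?_⟩
  by_contra hne
  rw [Finsupp.smul_apply, single_eq_of_ne (Ne.symm hne), smul_zero] at h
  exact h rfl

/-- If the configurations `g i` are different, the squared absolute values of the coefficients are
the probabilities. -/
theorem wt_sum {ι : Type*} {I : Finset ι} {a : ι → ℂ} {g : ι → Config} (hg : Set.InjOn g I)
    (f : Config → ℝ) :
    wt (∑ j ∈ I, a j • single (g j) (1 : ℂ)) f = ∑ i ∈ I, ‖a i‖ ^ 2 * f (g i) := by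
  classical
  rw [wt, Finset.sum_subset (s₂ := I.image g), Finset.sum_image hg]
  · exact Finset.sum_congr rfl fun i hi => by rw [sum_smul_single_apply hg hi]
  · intro s hs
    obtain ⟨i, hi, rfl⟩ := exists_of_mem_support_sum hs
    exact Finset.mem_image_of_mem g hi
  · intro s _ hs
    rw [notMem_support_iff.1 hs]
    simp

theorem wt_congr {v : Vec} {f g : Config → ℝ} (h : ∀ s ∈ v.support, f s = g s) :
    wt v f = wt v g := Finset.sum_congr rfl fun s hs => by rw [h s hs]

theorem wt_mono {v : Vec} {f g : Config → ℝ} (h : ∀ s ∈ v.support, f s ≤ g s) :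
    wt v f ≤ wt v g :=
  Finset.sum_le_sum fun s hs => mul_le_mul_of_nonneg_left (h s hs) (by positivity)

theorem wt_add (v : Vec) (f g : Config → ℝ) : wt v f + wt v g = wt v fun s => f s + g s := by
  simp only [wt, mul_add, Finset.sum_add_distrib]

theorem wt_smul (v : Vec) (c : ℝ) (f : Config → ℝ) : (wt v fun s => c * f s) = c * wt v f := by
  simp only [wt, Finset.mul_sum, mul_left_comm]

theorem wt_single (s : Config) (f : Config → ℝ) : wt (single s 1) f = f s := by
  rw [wt, support_single _ one_ne_zero]
  simp

/-- A circuit preserves the norm of a basis state. -/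
theorem wt_app_single {L : Finset ℕ} {us : List UGate} (hus : ∀ u ∈ us, u.Valid L) (x : Reg L) :
    (wt (app us (single x.bit 1)) fun _ => 1) = 1 := by
  have hm : ∀ y, merge L x.bit y = y.bit := fun y => by
    rw [← merge_false x, merge_merge, merge_false]
  rw [app_single hus, restr_self_bit]
  simp only [hm]
  rw [wt_sum bit_injective.injOn]
  have h := congrFun (congrFun (Matrix.mem_unitaryGroup_iff'.1
    (unitaryProduct_mem_unitaryGroup hus)) x) x
  rw [Matrix.star_eq_conjTranspose, Matrix.mul_apply, Matrix.one_apply_eq] at h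
  have h2 := congrArg Complex.re h
  rw [Complex.re_sum, Complex.one_re] at h2
  refine Eq.trans (Finset.sum_congr rfl fun y _ => ?_) h2
  rw [Matrix.conjTranspose_apply, Complex.star_def, Complex.conj_mul', mul_one,
    ← Complex.ofReal_pow, Complex.ofReal_re]

/-- The value of `g` at the position of the token. -/
noncomputable def tokenVal (n M : ℕ) (g : ℕ → ℝ) (s : Config) : ℝ :=
  ∑ j ∈ Finset.range (M + 1), if s (n + 1 + j) then g j else 0

theorem TokenAt.tokenVal_eq {n M k : ℕ} {s : Config} (h : TokenAt n M k s) (hk : k ≤ M)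
    (g : ℕ → ℝ) : tokenVal n M g s = g k := by
  rw [tokenVal, Finset.sum_eq_single k]
  · simp [h k hk]
  · intro j hj hjk
    have := Finset.mem_range.1 hj
    rw [h j (by omega), decide_eq_false hjk]
    simp
  · intro h'
    simp only [Finset.mem_range, not_lt] at h'
    omega

/-- The situation before a run on the block at `b`: the input `x₀` is on the first `n` wires, the
wire `n` carries `1`, the token is at `k`, and the wires from `b` up to `A` carry `0`. -/
structure Ready (n M A : ℕ) (x₀ : Config) (b k : ℕ) (s : Config) : Prop where
  input : ∀ w < n, s w = x₀ w
  one : s n = true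
  token : TokenAt n M k s
  zero : ∀ w, b ≤ w → w < A → s w = false

section Token

variable {n D o : ℕ} {us : List UGate} (hn : n ≤ D) (ho : o < D)
  (hus : ∀ u ∈ us, u.Valid (Finset.range D)) {x₀ : Config} (hx₀ : ∀ w, n ≤ w → x₀ w = false)

include hn ho hus hx₀

/-- A run leaves the superposition of the configurations after the possible results `y`, with the
amplitudes with which the input circuit produces `y` from the input `x₀`. -/
theorem app_trial {A b k : ℕ} (hb : n + 2 + 2 * D ≤ b) (hA : b + D ≤ A) (hk : k < 2 * D)
    {s : Config} (hs : Ready n (2 * D) A x₀ b k s) :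
    app (trial n D o us b) (single s 1) = ∑ y ∈ (app us (single x₀ 1)).support,
      app us (single x₀ 1) y • single (afterTrial n D o b k s y) 1 := by
  rw [trial, app_append, app_copyIn le_rfl (by omega) hs.one
    (fun j hj => hs.zero _ (by omega) (by omega)), app_append]
  have h1 : put b n s s = put b D s x₀ := by
    funext w
    by_cases hw : b ≤ w ∧ w < b + n
    · rw [put, put, if_pos hw, if_pos (by omega), hs.input _ (by omega)]
    · rw [put, put, if_neg hw]
      split_ifs with h
      · rw [hs.zero w h.1 (by omega), hx₀ _ (by omega)]
      · rfl
  have h2 : app (us.map (mapGate (b + ·))) (single (put b D s x₀) 1) =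
      mapDomain (put b D s) (app us (single x₀ 1)) := by
    rw [← app_mapGate (L := Finset.range D) (fun c hc y => put_block s y (Finset.mem_range.1 hc))
      (fun c hc y v => put_update s y (Finset.mem_range.1 hc) v) hus, mapDomain_single]
  rw [h1, h2, mapDomain, Finsupp.sum, map_sum]
  refine Finset.sum_congr rfl fun y _ => ?_
  rw [← smul_single_one, map_smul]
  congr 1
  have ht : TokenAt n (2 * D) k (put b D s y) := fun j hj => by
    rw [put_of_lt s y (by omega), hs.token j hj]
  have ho' : put b D s y (b + o) = y o := put_block s y ho
  rw [afterTrial]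
  split_ifs with hy
  · exact app_countIn_of_true le_rfl hk (by omega) (ho'.trans hy) ht
  · rw [Bool.not_eq_true] at hy
    exact app_countIn_of_false (.inl (ho'.trans hy))

omit hn hus hx₀ in
theorem ready_afterTrial {A b k : ℕ} (hb : n + 2 + 2 * D ≤ b) (hk : k < 2 * D)
    {s : Config} (hs : Ready n (2 * D) A x₀ b k s) (y : Config) :
    Ready n (2 * D) A x₀ (b + D) (if y o then k + 1 else k) (afterTrial n D o b k s y) := by
  have h1 : Ready n (2 * D) A x₀ (b + D) k (put b D s y) :=
    ⟨fun w hw => by rw [put_of_lt s y (by omega), hs.input w hw],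
      by rw [put_of_lt s y (by omega), hs.one],
      fun j hj => by rw [put_of_lt s y (by omega), hs.token j hj],
      fun w hw hw' => by rw [put_of_le s y hw, hs.zero w (by omega) hw']⟩
  rw [afterTrial]
  split_ifs
  · refine ⟨fun w hw => ?_, ?_, fun j hj => ?_, fun w hw hw' => ?_⟩
    · rw [moveToken, update_of_ne (by omega), update_of_ne (by omega), h1.input w hw]
    · rw [moveToken, update_of_ne (by omega), update_of_ne (by omega), h1.one]
    · rw [moveToken]
      by_cases hjk : j = k
      · subst hjk; rw [update_self, decide_eq_false (by omega)]
      · rw [update_of_ne (by omega)]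
        by_cases hjk' : j = k + 1
        · subst hjk'; rw [← add_assoc (n + 1), update_self, decide_eq_true rfl]
        · rw [update_of_ne (by omega), h1.token j hj, decide_eq_false hjk, decide_eq_false hjk']
    · rw [moveToken, update_of_ne (by omega), update_of_ne (by omega), h1.zero w hw hw']
  · exact h1

omit hn hus hx₀ in
/-- Different pairs of an old configuration and a result of a run lead to different configurations:
the run is recorded in its block, and the old position of the token follows from the new one.  So
there is no interference between them. -/
theorem afterTrial_inj {A b k k' : ℕ} (hb : n + 2 + 2 * D ≤ b) (hA : b + D ≤ A) (hk : k < 2 * D)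
    (hk' : k' < 2 * D) {s s' : Config} (hs : Ready n (2 * D) A x₀ b k s)
    (hs' : Ready n (2 * D) A x₀ b k' s') {y y' : Config} (hy : ∀ w, D ≤ w → y w = false)
    (hy' : ∀ w, D ≤ w → y' w = false)
    (h : afterTrial n D o b k s y = afterTrial n D o b k' s' y') : s = s' ∧ y = y' := by
  have hother : ∀ (k : ℕ) (s y : Config) (w : ℕ), k < 2 * D → (w ≤ n ∨ n + 1 + 2 * D < w) →
      afterTrial n D o b k s y w = put b D s y w := by
    intro k s y w hk hw
    rw [afterTrial]
    split_ifs
    · rw [moveToken, update_of_ne (by omega), update_of_ne (by omega)]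
    · rfl
  have hyy : y = y' := by
    funext w
    by_cases hw : w < D
    · rw [← put_block (b := b) s y hw, ← put_block (b := b) s' y' hw,
        ← hother k s y _ hk (by omega), ← hother k' s' y' _ hk' (by omega), h]
    · rw [hy w (by omega), hy' w (by omega)]
  subst hyy
  refine ⟨?_, rfl⟩
  have r := ready_afterTrial ho hb hk hs y
  have r' := ready_afterTrial ho hb hk' hs' y
  rw [← h] at r'
  have hkk : k = k' := by
    have := r.token.unique r'.token (by split_ifs <;> omega)
    split_ifs at this <;> omega
  subst hkk
  funext w
  by_cases hw : b ≤ w ∧ w < b + D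
  · rw [hs.zero w hw.1 (by omega), hs'.zero w hw.1 (by omega)]
  · by_cases hw' : w ≤ n ∨ n + 1 + 2 * D < w
    · have h1 := congrFun h w
      rw [hother k s y w hk hw', hother k s' y w hk hw', put, put, if_neg hw, if_neg hw] at h1
      exact h1
    · obtain ⟨j, rfl⟩ : ∃ j, w = n + 1 + j := ⟨w - (n + 1), by omega⟩
      rw [hs.token j (by omega), hs'.token j (by omega)]

/-- Each run multiplies the generating function of the position of the token by the generating
function of the measured output bit. -/
theorem wt_app_trials (z : ℝ) {A m K b : ℕ} (hb : n + 2 + 2 * D ≤ b) (hA : b + m * D ≤ A)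
    (hK : K + m ≤ 2 * D) {v : Vec}
    (hv : ∀ s ∈ v.support, ∃ k ≤ K, Ready n (2 * D) A x₀ b k s) :
    (∀ s ∈ (app (trials n D o us m b) v).support,
      ∃ k ≤ K + m, Ready n (2 * D) A x₀ (b + m * D) k s) ∧
    wt (app (trials n D o us m b) v) (tokenVal n (2 * D) (z ^ ·)) =
      (wt (app us (single x₀ 1)) fun y => if y o then z else 1) ^ m *
        wt v (tokenVal n (2 * D) (z ^ ·)) := by
  induction m generalizing K b v with
  | zero => simpa [trials, app_nil] using hv
  | succ m ih =>
    rw [add_mul, one_mul] at hA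
    rw [trials, app_append]
    choose! κ hκ hr using hv
    set φ := app us (single x₀ 1) with hφ
    have hφ0 : ∀ y ∈ φ.support, ∀ w, D ≤ w → y w = false := fun y hy w hw =>
      eq_of_mem_support_app hus (by simpa using hw) (fun s hs => by
        rw [support_single _ one_ne_zero, Finset.mem_singleton] at hs
        rw [hs, hx₀ w (by omega)]) y hy
    have hκ' : ∀ s ∈ v.support, κ s < 2 * D := fun s hs => by
      have := hκ s hs; omega
    -- the new configurations are indexed by an old one and the result of the run
    have hexp : app (trial n D o us b) v = ∑ p ∈ v.support ×ˢ φ.support,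
        (v p.1 * φ p.2) • single (afterTrial n D o b (κ p.1) p.1 p.2) 1 := by
      rw [Finset.sum_product]
      conv_lhs => rw [← Finsupp.sum_single v, Finsupp.sum, map_sum]
      refine Finset.sum_congr rfl fun s hs => ?_
      rw [← smul_single_one, map_smul,
        app_trial hn ho hus hx₀ hb (by omega) (hκ' s hs) (hr s hs), Finset.smul_sum]
      exact Finset.sum_congr rfl fun y _ => smul_smul _ _ _
    have hinj : Set.InjOn (fun p : Config × Config => afterTrial n D o b (κ p.1) p.1 p.2)
        (v.support ×ˢ φ.support : Finset (Config × Config)) := by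
      rintro ⟨s, y⟩ h ⟨s', y'⟩ h' heq
      obtain ⟨h1, h2⟩ := Finset.mem_product.1 (Finset.mem_coe.1 h)
      obtain ⟨h1', h2'⟩ := Finset.mem_product.1 (Finset.mem_coe.1 h')
      obtain ⟨rfl, rfl⟩ := afterTrial_inj ho hb (by omega) (hκ' s h1) (hκ' s' h1') (hr s h1)
        (hr s' h1') (hφ0 y h2) (hφ0 y' h2') heq
      rfl
    obtain ⟨ih1, ih2⟩ := ih (K := K + 1) (b := b + D) (by omega) (by omega) (by omega)
      (v := app (trial n D o us b) v) (by
        intro s' hs'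
        rw [hexp] at hs'
        obtain ⟨⟨s, y⟩, hp, rfl⟩ := exists_of_mem_support_sum hs'
        obtain ⟨h1, h2⟩ := Finset.mem_product.1 hp
        refine ⟨_, ?_, ready_afterTrial ho hb (hκ' s h1) (hr s h1) y⟩
        have := hκ s h1
        split_ifs <;> omega)
    refine ⟨fun s hs => ?_, ?_⟩
    · obtain ⟨k, hk, h⟩ := ih1 s hs
      refine ⟨k, by omega, ?_⟩
      have : b + (m + 1) * D = b + D + m * D := by ring
      rw [this]; exact h
    · rw [ih2, pow_succ, mul_assoc]
      congr 1
      rw [hexp, wt_sum hinj, Finset.sum_product, wt, wt, Finset.sum_mul_sum, Finset.sum_comm]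
      refine Finset.sum_congr rfl fun y _ => Finset.sum_congr rfl fun s hs => ?_
      have h1 := hκ' s hs
      rw [(ready_afterTrial ho hb h1 (hr s hs) y).token.tokenVal_eq (by split_ifs <;> omega),
        (hr s hs).token.tokenVal_eq (by omega), norm_mul]
      split_ifs <;> ring

end Token

end QSim

/-! ### The amplitudes of the amplified circuit -/

namespace QSim

open Function
open Finsupp hiding update update_self update_idem
open scoped Matrix

section Amplitude

variable {n D o : ℕ} {us : List UGate} (hn : n ≤ D) (ho : o < D)
  (hus : ∀ u ∈ us, u.Valid (Finset.range D)) {x₀ : Config} (hx₀ : ∀ w, n ≤ w → x₀ w = false)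

/-- The state after the computation of the answer, when the target wire carries `a`. -/
noncomputable def computed (n D o : ℕ) (us : List UGate) (x₀ : Config) (a : Bool) : Vec :=
  app (compute n D o us) (single (update x₀ (target n D) a) 1)

include hn ho hus hx₀

omit hx₀ in
theorem computed_target (a : Bool) : ∀ s ∈ (computed n D o us x₀ a).support, s (target n D) = a := by
  refine eq_of_mem_support_app (valid_compute hn ho hus) (by simp) fun s hs => ?_
  rw [support_single _ one_ne_zero, Finset.mem_singleton] at hs
  rw [hs, update_self]

/-- After the computation the token has a definite position in every configuration, and the
generating function of this position is a power of that of one run. -/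
theorem computed_ready (a : Bool) (z : ℝ) :
    (∀ s ∈ (computed n D o us x₀ a).support,
      ∃ k ≤ 2 * D, Ready n (2 * D) (target n D) x₀ (target n D) k s) ∧
    wt (computed n D o us x₀ a) (tokenVal n (2 * D) (z ^ ·)) =
      (wt (app us (single x₀ 1)) fun y => if y o then z else 1) ^ (2 * D) := by
  have hA : n + 2 + 2 * D + 2 * D * D = target n D := by unfold target; ring
  set s₁ := update (update (update x₀ (target n D) a) n true) (n + 1) true with hs₁
  have e : computed n D o us x₀ a =
      app (trials n D o us (2 * D) (n + 2 + 2 * D)) (single s₁ 1) := by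
    rw [computed, compute, app_append, app_append, app_notGates, app_notGates,
      update_of_ne (by omega : n ≠ target n D), update_of_ne (by omega : n + 1 ≠ n),
      update_of_ne (by omega : n + 1 ≠ target n D), hx₀ n le_rfl, hx₀ (n + 1) (by omega)]
    rfl
  have hr : Ready n (2 * D) (target n D) x₀ (n + 2 + 2 * D) 0 s₁ := by
    have h0 : ∀ w, n + 1 < w → w < target n D → s₁ w = false := fun w hw hw' => by
      rw [hs₁, update_of_ne (by omega), update_of_ne (by omega), update_of_ne (by omega),
        hx₀ w (by omega)]
    refine ⟨fun w hw => ?_, ?_, fun j hj => ?_, fun w hw hw' => h0 w (by omega) hw'⟩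
    · rw [hs₁, update_of_ne (by omega), update_of_ne (by omega), update_of_ne (by omega)]
    · rw [hs₁, update_of_ne (by omega), update_self]
    · rcases Nat.eq_zero_or_pos j with rfl | hj0
      · simp [hs₁]
      · rw [h0 _ (by omega) (by omega), decide_eq_false (by omega)]
  have key := wt_app_trials hn ho hus hx₀ z (m := 2 * D) (K := 0) (A := target n D) le_rfl
    hA.le (by omega) (v := single s₁ 1) (fun s hs => ?_)
  · rw [e]
    rw [hA, wt_single, hr.token.tokenVal_eq (by omega), pow_zero, mul_one, Nat.zero_add] at key
    exact key
  · rw [support_single _ one_ne_zero, Finset.mem_singleton] at hs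
    exact ⟨0, le_rfl, hs ▸ hr⟩

omit hx₀ in
/-- The computation of the answer does not look at the target wire. -/
theorem computed_not (a : Bool) : computed n D o us x₀ (!a) =
    mapDomain (fun s => update s (target n D) (!s (target n D))) (computed n D o us x₀ a) := by
  have h := app_mapGate (L := Finset.range (target n D)) (e := id)
    (h := fun s => update s (target n D) (!s (target n D)))
    (fun c hc y => update_of_ne (Finset.mem_range.1 hc).ne _ _)
    (fun c hc y v => by
      have hc' := (Finset.mem_range.1 hc).ne
      rw [update_of_ne hc'.symm, id, update_comm hc']) (valid_compute hn ho hus)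
    (single (update x₀ (target n D) a) 1)
  have hid : ∀ us : List UGate, us.map (mapGate id) = us := fun us => by
    refine (List.map_congr_left fun u _ => ?_).trans (List.map_id us)
    cases u <;> rfl
  rw [hid, mapDomain_single, update_self, update_idem] at h
  exact h

/-- The amplitude for the answer "the target is flipped if `f`" is the probability that the token
says so. -/
theorem amplified_apply {A : ℕ} (hA : A = target n D) (a f : Bool)
    {x y : Reg (Finset.range (A + 1))} (hx : x.bit = update x₀ A a)
    (hy : y.bit = update x₀ A (xor a f)) :
    unitaryProduct _ (amplified n D o us) y x =
      ((wt (computed n D o us x₀ a)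
        (tokenVal n (2 * D) fun j => if decide (j ≤ D) = f then 1 else 0) : ℝ) : ℂ) := by
  have hmono : ∀ u ∈ compute n D o us, u.Valid (Finset.range (A + 1)) := fun u hu =>
    by
    rw [hA]
    exact valid_mono (Finset.range_subset_range.2 (Nat.le_succ _)) (valid_compute hn ho hus u hu)
  have hflips : ∀ u ∈ flips n A (D + 1), u.Valid (Finset.range (A + 1)) :=
    valid_flips (by rw [hA]; unfold target; omega) (Nat.lt_succ_self _)
  set Φ := computed n D o us x₀ a with hΦ
  set Ψ := computed n D o us x₀ (xor a f) with hΨ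
  obtain ⟨hready, -⟩ := computed_ready hn ho hus hx₀ a 1
  choose! κ hκ hr using hready
  let F : Config → Config := fun s => if κ s < D + 1 then update s A (!s A) else s
  have hsum : app (flips n A (D + 1)) Φ = ∑ s ∈ Φ.support, Φ s • single (F s) 1 := by
    conv_lhs => rw [← Finsupp.sum_single Φ, Finsupp.sum, map_sum]
    refine Finset.sum_congr rfl fun s hs => ?_
    rw [← smul_single_one, map_smul, app_flips (M := 2 * D) (by rw [hA]; unfold target; omega)
      (by omega) (hr s hs).one (hr s hs).token]
  -- the matrix entry is the inner product of the flipped state `Φ` with `Ψ`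
  have hentry : unitaryProduct _ (amplified n D o us) y x =
      ∑ s ∈ Φ.support, Φ s * star (Ψ (F s)) := by
    rw [amplified, ← hA, ← List.append_assoc, unitaryProduct_append, unitaryProduct_invList hmono,
      Matrix.mul_apply]
    have hΨA : app (compute n D o us) (single (update x₀ A (xor a f)) 1) = Ψ := by
      rw [hΨ, computed, hA]
    have h1 (t) : unitaryProduct _ (compute n D o us ++ flips n A (D + 1)) t x =
        ∑ s ∈ Φ.support, Φ s * single (F s) (1 : ℂ) t.bit := by
      rw [unitaryProduct_apply, app_append, hx]
      · have h : app (compute n D o us) (single (update x₀ A a) 1) = Φ := by rw [hΦ, computed, hA]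
        rw [h, hsum, finsetSum_apply]
        rfl
      · intro u hu
        exact (List.mem_append.1 hu).elim (hmono u) (hflips u)
    have h2 (t) : (unitaryProduct _ (compute n D o us))ᴴ y t = star (Ψ t.bit) := by
      rw [Matrix.conjTranspose_apply, unitaryProduct_apply hmono, hy, hΨA]
    simp only [h1, h2, Finset.mul_sum]
    rw [Finset.sum_comm]
    refine Finset.sum_congr rfl fun s _ => ?_
    by_cases hs : F s ∈ Ψ.support
    · rw [hΨ, computed, ← hA, ← hy] at hs
      obtain ⟨t, ht⟩ := exists_bit_of_mem_support hmono y hs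
      rw [Finset.sum_eq_single t]
      · rw [← ht, single_eq_same, mul_one, mul_comm]
      · intro t' _ hne
        rw [← ht, single_eq_of_ne (bit_injective.ne hne), mul_zero, mul_zero]
      · simp
    · rw [notMem_support_iff.1 hs, star_zero, mul_zero]
      refine Finset.sum_eq_zero fun t _ => ?_
      by_cases ht : t.bit = F s
      · rw [ht, notMem_support_iff.1 hs, star_zero, zero_mul]
      · rw [single_eq_of_ne ht, mul_zero, mul_zero]
  rw [hentry, wt, Complex.ofReal_sum]
  refine Finset.sum_congr rfl fun s hs => ?_
  rw [(hr s hs).token.tokenVal_eq (hκ s hs)]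
  have hsA : s A = a := hA ▸ computed_target hn ho hus a s hs
  -- the flipped configuration occurs in `Ψ` only if the token says `f`, and then with the amplitude
  -- that `s` has in `Φ`
  have hΨF : Ψ (F s) = if decide (κ s ≤ D) = f then Φ s else 0 := by
    have hcond : (κ s < D + 1) ↔ κ s ≤ D := Nat.lt_succ_iff
    have hFA : F s A = xor a (decide (κ s ≤ D)) := by
      by_cases h : κ s ≤ D
      · simp [F, h, hsA]
      · simp [F, h, hsA]
    split_ifs with hf
    · cases f with
      | false =>
        have : ¬ κ s ≤ D := by simpa using hf
        simp only [F, hcond, this, if_false]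
        rw [hΨ, Bool.xor_false]
      | true =>
        have : κ s ≤ D := by simpa using hf
        simp only [F, hcond, this, if_true]
        rw [hΨ, Bool.xor_true, computed_not hn ho hus a, ← hA]
        refine mapDomain_apply (f := fun s : Config => update s A (!s A)) ?_ Φ s
        intro s s' h
        have h1 := congrFun h A
        simp only [update_self, Bool.not_inj_iff] at h1
        funext w
        by_cases hw : w = A
        · rw [hw, h1]
        · have h2 := congrFun h w
          simpa [hw] using h2
    · by_contra hne
      have h1 := computed_target hn ho hus (xor a f) (F s) (mem_support_iff.2 hne)
      rw [← hA, hFA] at h1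
      exact hf (by simpa using h1)
  rw [hΨF]
  split_ifs
  · rw [Complex.star_def, Complex.mul_conj, Complex.normSq_eq_norm_sq, mul_one]
  · simp

omit hn ho hus hx₀ in
theorem eight_ninths_pow_le {p : ℕ} (h : 6 * p ≤ D) : (8 / 9 : ℝ) ^ D ≤ 2⁻¹ ^ p :=
  calc (8 / 9 : ℝ) ^ D ≤ (8 / 9) ^ (6 * p) :=
        pow_le_pow_of_le_one (by norm_num) (by norm_num) h
    _ = ((8 / 9) ^ 6) ^ p := pow_mul _ _ _
    _ ≤ 2⁻¹ ^ p := pow_le_pow_left₀ (by norm_num) (by norm_num) _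

/-- If each run gives the answer `f` with probability at least `2/3`, in the sense that the output
wire carries `0` exactly when the answer is `true`, then the majority gives it up to an
exponentially small error. -/
theorem one_sub_le_wt {p : ℕ} (hp : 6 * p ≤ D) (a f : Bool)
    (h1 : (wt (app us (single x₀ 1)) fun _ => 1) = 1)
    (hf : (2 / 3 : ℝ) ≤ wt (app us (single x₀ 1)) fun y => if (!y o) = f then 1 else 0) :
    (1 - 2⁻¹ ^ p : ℝ) ≤ wt (computed n D o us x₀ a)
      (tokenVal n (2 * D) fun j => if decide (j ≤ D) = f then 1 else 0) := by
  set Φ := computed n D o us x₀ a with hΦ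
  set φ := app us (single x₀ 1) with hφ
  set P := wt φ fun y => if (!y o) = f then 1 else 0 with hP
  have htotal : (wt Φ fun _ => 1) = 1 := by
    obtain ⟨hr, hw⟩ := computed_ready hn ho hus hx₀ a 1
    have : (wt φ fun y => if y o then (1 : ℝ) else 1) = 1 := by simpa using h1
    rw [← hφ, this, one_pow] at hw
    refine Eq.trans (wt_congr fun s hs => ?_) hw
    obtain ⟨k, hk, h⟩ := hr s hs
    rw [h.token.tokenVal_eq hk, one_pow]
  -- Chernoff's bound, with the weight `z ^ k`, where `z = 2` or `z = 1/2`
  let z : ℝ := if f then 2 else 2⁻¹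
  obtain ⟨hr, hw⟩ := computed_ready hn ho hus hx₀ a z
  rw [← hφ] at hw
  set ρ := wt φ fun y => if y o then z else 1 with hρ
  have hz : 0 < z := by simp only [z]; split_ifs <;> norm_num
  have hρ0 : 0 ≤ ρ := by
    have := wt_mono (v := φ) (f := fun _ => 0 * 1) (g := fun y => if y o then z else 1)
      fun s _ => by split_ifs <;> linarith
    rwa [wt_smul, zero_mul] at this
  have hρP : ρ + (if f then 1 else 2⁻¹) * P = if f then 2 else 1 := by
    have h2 : ρ + (if f then 1 else 2⁻¹) * P = (if f then 2 else 1) * wt φ fun _ => 1 := by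
      rw [hρ, hP, ← wt_smul, wt_add, ← wt_smul]
      refine wt_congr fun y _ => ?_
      cases f <;> cases y o <;> simp [z] <;> norm_num
    rw [h2, h1, mul_one]
  -- a wrong answer means `k ≥ D` if `z = 2`, and `k ≤ D` if `z = 1/2`, so that `1 ≤ z ^ k / z ^ D`
  have hbad : wt Φ (fun s => 1 - tokenVal n (2 * D)
      (fun j => if decide (j ≤ D) = f then 1 else 0) s) ≤ z⁻¹ ^ D * ρ ^ (2 * D) := by
    rw [← hw, ← wt_smul]
    refine wt_mono fun s hs => ?_
    obtain ⟨k, hk, h⟩ := hr s hs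
    rw [h.token.tokenVal_eq hk, h.token.tokenVal_eq hk]
    by_cases hkf : decide (k ≤ D) = f
    · rw [if_pos hkf, sub_self]; positivity
    · rw [if_neg hkf, sub_zero]
      cases f with
      | true =>
        have : D ≤ k := by simp at hkf; omega
        simp only [z, if_true]
        rw [inv_pow, ← div_eq_inv_mul, one_le_div (by positivity)]
        exact pow_le_pow_right₀ (by norm_num) this
      | false =>
        have : k ≤ D := by simpa using hkf
        simp only [z, Bool.false_eq_true, if_false, inv_inv]
        rw [inv_pow, ← div_eq_mul_inv, one_le_div (by positivity)]
        exact pow_le_pow_right₀ (by norm_num) this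
  -- since `P ≥ 2/3`, `ρ ≤ 4/3` if `z = 2` and `ρ ≤ 2/3` if `z = 1/2`; in both cases `z⁻¹ ρ² ≤ 8/9`
  have hfinal : z⁻¹ ^ D * ρ ^ (2 * D) ≤ (8 / 9) ^ D := by
    rw [pow_mul, ← mul_pow]
    refine pow_le_pow_left₀ (by positivity) ?_ _
    cases f with
    | true =>
      simp only [z, if_true] at hρP ⊢
      nlinarith
    | false =>
      simp only [z, Bool.false_eq_true, if_false, inv_inv] at hρP ⊢
      nlinarith
  have hsplit : wt Φ (fun s => 1 - tokenVal n (2 * D)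
      (fun j => if decide (j ≤ D) = f then 1 else 0) s) + wt Φ (tokenVal n (2 * D)
      fun j => if decide (j ≤ D) = f then 1 else 0) = 1 := by
    rw [wt_add]
    exact (wt_congr fun s _ => by ring).trans htotal
  have := eight_ninths_pow_le hp
  linarith

end Amplitude

/-- The number of wires of a circuit is at most its size. -/
theorem ancillas_le_size {n : ℕ} (C : QCircuit n 1) : n + ancillas C.gates ≤ C.size := by
  unfold QCircuit.size
  generalize C.gates = gs
  induction gs with
  | nil => simp [ancillas]
  | cons g gs ih =>
    rcases g with ⟨_ | _ | _⟩ | _ | _ <;> simp [ancillas] at ih ⊢ <;> omega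

theorem inputConfig_queryState (x : List Bool) (m : ℕ) (a : Bool) :
    inputConfig (queryState x m a) = update (inputConfig x.get) (x.length + m) a := by
  funext w
  rcases lt_trichotomy w (x.length + m) with h | h | h
  · rw [update_of_ne h.ne, inputConfig, dif_pos (by omega)]
    have e : (⟨w, by omega⟩ : Fin (x.length + m + 1)) = Fin.castSucc ⟨w, h⟩ := rfl
    rw [e, queryState, Fin.snoc_castSucc, inputConfig]
    split_ifs with hx
    · have e' : (⟨w, h⟩ : Fin (x.length + m)) = Fin.castAdd m ⟨w, hx⟩ := rfl
      rw [e', Fin.append_left]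
    · have e' : (⟨w, h⟩ : Fin (x.length + m)) = Fin.natAdd x.length ⟨w - x.length, by omega⟩ := by
        ext; simp; omega
      rw [e', Fin.append_right]
  · subst h
    rw [update_self, inputConfig, dif_pos (by omega)]
    have e : (⟨x.length + m, by omega⟩ : Fin (x.length + m + 1)) = Fin.last _ := rfl
    rw [e, queryState, Fin.snoc_last]
  · rw [update_of_ne h.ne', inputConfig, dif_neg (by omega), inputConfig, dif_neg (by omega)]

theorem bit_restr_inputConfig {k : ℕ} (u : Fin k → Bool) :
    (restr (Finset.range k) (inputConfig u)).bit = inputConfig u := by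
  funext w
  by_cases hw : w ∈ Finset.range k
  · rw [restr_bit hw]
  · rw [Reg.bit, dif_neg hw, inputConfig, dif_neg (by simpa using hw)]

section Final

variable {n : ℕ} (C : QCircuit n 1) {D : ℕ} (hD : C.encode.length ≤ D)

include hD

theorem ancillas_le : n + ancillas C.gates ≤ D :=
  (ancillas_le_size C).trans (C.size_le_length_encode.trans hD)

theorem output_lt : C.outputs 0 < D := by
  refine lt_of_lt_of_le (lt_of_mem_liveAfter C.gates n (Finset.range n)
    (fun _ hw => Finset.mem_range.1 hw) _ ?_) (ancillas_le C hD)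
  rw [← C.outputs_live]
  exact Finset.mem_image_of_mem _ (Finset.mem_univ _)

theorem valid_unitaries_gates : ∀ u ∈ unitaries C.gates, u.Valid (Finset.range D) :=
  valid_unitaries C.gates n _ C.valid (fun _ hw => Finset.mem_range.1 hw) (ancillas_le C hD)

end Final

/-- If the circuit `C` gives the answer `f` on the input `x` with probability at least `2/3`, then
the amplified circuit adds the answer to the last qubit, up to an exponentially small error. -/
theorem one_sub_le_amplitude (x : List Bool) (C : QCircuit x.length 1) {D p : ℕ}
    (hD : C.encode.length ≤ D) (hp : 6 * p ≤ D) (a f : Bool)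
    (hf : (2 / 3 : ℝ) ≤ if f then C.acceptProb x.get else 1 - C.acceptProb x.get) :
    ((1 - 2⁻¹ ^ p : ℝ) : ℂ) ≤
      circuitMatrix (x.length + (2 + 2 * D + 2 * D * D) + 1)
        (amplified x.length D (C.outputs 0) (unitaries C.gates))
        (queryState x (2 + 2 * D + 2 * D * D) (xor a f))
        (queryState x (2 + 2 * D + 2 * D * D) a) := by
  have hn : x.length ≤ D := (Nat.le_add_right _ _).trans (ancillas_le C hD)
  have hus := valid_unitaries_gates C hD
  have hx₀ : ∀ w, x.length ≤ w → inputConfig x.get w = false := fun w hw => by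
    rw [inputConfig, dif_neg (by omega)]
  rw [circuitMatrix, Matrix.submatrix_apply, loadBits_val, loadBits_val]
  have h := amplified_apply hn (output_lt C hD) hus hx₀ (A := x.length + (2 + 2 * D + 2 * D * D)) rfl a f
    (x := restr _ (inputConfig (queryState x (2 + 2 * D + 2 * D * D) a)))
    (y := restr _ (inputConfig (queryState x (2 + 2 * D + 2 * D * D) (xor a f))))
    (by rw [bit_restr_inputConfig, inputConfig_queryState])
    (by rw [bit_restr_inputConfig, inputConfig_queryState])
  refine le_of_le_of_eq ?_ h.symm
  rw [Complex.real_le_real]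
  have h1 : (wt (app (unitaries C.gates) (single (inputConfig x.get) 1)) fun _ => 1) = 1 := by
    have := wt_app_single hus (restr _ (inputConfig x.get))
    have hb : (restr (Finset.range D) (inputConfig x.get)).bit = inputConfig x.get := by
      funext w
      by_cases hw : w ∈ Finset.range D
      · rw [restr_bit hw]
      · rw [Reg.bit, dif_neg hw, hx₀ w (by simp at hw; omega)]
    rwa [hb] at this
  refine one_sub_le_wt hn (output_lt C hD) hus hx₀ hp a f h1 (hf.trans_eq ?_)
  rw [acceptProb_eq]
  cases f with
  | true =>
    rw [if_pos rfl]
    exact wt_congr fun y _ => by cases y (C.outputs 0) <;> simp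
  | false =>
    rw [if_neg (by simp), sub_eq_iff_eq_add, wt_add]
    exact h1.symm.trans (wt_congr fun y _ => by cases y (C.outputs 0) <;> simp)

end QSim

/-! ### Arithmetic on stacks -/

namespace StackProg

open Function

/-- The stacks of the program that are used as counters: they hold numbers in unary. -/
inductive Ctr
  | n | d | b | i | j | x | y | z | fl | p | w
  deriving DecidableEq

instance : Fintype Ctr :=
  ⟨{.n, .d, .b, .i, .j, .x, .y, .z, .fl, .p, .w}, fun v => by cases v <;> simp⟩

/-- The other stacks of the program: an empty stack for intermediate results, the part of the input
circuit that is still to be read, the part that has been read, and two stacks for the output. -/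
inductive Str
  | tmp | qs | qr | aux | out
  deriving DecidableEq

instance : Fintype Str := ⟨{.tmp, .qs, .qr, .aux, .out}, fun s => by cases s <;> simp⟩

/-- A program with the stacks `Ctr` and `Str`. -/
abbrev Prog : Type 1 := Frag (Ctr ⊕ Str) (fun _ => Bool) Unit

/-- The contents of the stacks if the counters have the values `c`. -/
def stk (c : Ctr → ℕ) (q : Str → List Bool) : Ctr ⊕ Str → List Bool :=
  Sum.elim (fun v => unary (c v)) q

@[simp] theorem stk_inl (c : Ctr → ℕ) (q : Str → List Bool) (v : Ctr) :
    stk c q (.inl v) = unary (c v) := rfl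

@[simp] theorem stk_inr (c : Ctr → ℕ) (q : Str → List Bool) (s : Str) :
    stk c q (.inr s) = q s := rfl

@[simp] theorem update_stk_inl (c : Ctr → ℕ) (q : Str → List Bool) (v : Ctr) (m : ℕ) :
    update (stk c q) (.inl v) (unary m) = stk (update c v m) q := by
  funext k
  rcases k with k | k
  · by_cases h : k = v
    · subst h; simp
    · simp [h]
  · simp

@[simp] theorem update_stk_inr (c : Ctr → ℕ) (q : Str → List Bool) (s : Str) (l : List Bool) :
    update (stk c q) (.inr s) l = stk c (update q s l) := by
  funext k
  rcases k with k | k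
  · simp
  · by_cases h : k = s
    · subst h; simp
    · simp [h]

namespace Prog

/-- Runs `F` once for every unit of the counter `v`, which is counted down. -/
def forCtr (v : Ctr) (F : Prog) : Prog := Frag.forEach (.inl v) id fun _ => F

theorem runs_forCtr_zero {v : Ctr} (F : Prog) {c : Ctr → ℕ} (q : Str → List Bool) (hc : c v = 0) :
    (forCtr v F).Runs (stk c q) (stk c q) 2 := by
  refine Frag.Runs.loop_exit none (by simp [hc]) rfl ((Frag.runs_skip _).congr ?_ le_rfl)
  rw [stk_inl, hc]
  exact (update_stk_inl c q v 0).trans (by rw [← hc, update_eq_self])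

theorem runs_forCtr_succ {v : Ctr} {F : Prog} {c : Ctr → ℕ} {q : Str → List Bool} {m T T' : ℕ}
    {S' S'' : Ctr ⊕ Str → List Bool} (hc : c v = m + 1)
    (hF : F.Runs (stk (update c v m) q) S' T) (h : (forCtr v F).Runs S' S'' T') :
    (forCtr v F).Runs (stk c q) S'' (T + 1 + T') := by
  refine Frag.Runs.loop_cont (some true) ?_ rfl (hF.congr' ?_ rfl le_rfl) h
  · rw [stk_inl, hc]; rfl
  · rw [stk_inl, hc]; exact (update_stk_inl c q v m).symm

/-- Empties the stack `k`. -/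
def clear (k : Ctr ⊕ Str) : Prog := Frag.forEach k id fun _ => Frag.skip

theorem runs_clear (k : Ctr ⊕ Str) (S : Ctr ⊕ Str → List Bool) :
    (clear k).Runs S (update S k []) ((S k).length * 2 + 2) := by
  have := Frag.Runs.forEach (k := k) (d := id) (body := fun _ => (Frag.skip : Prog))
    (fun l => update S k l) 1 (S k) (fun _ _ => update_self ..) (fun a l' _ => by
      rw [update_idem]; exact Frag.runs_skip _)
  rwa [update_eq_self] at this

/-- Moves the contents of the stack `k` to the stack `l`, in reverse order. -/
def move (k l : Ctr ⊕ Str) : Prog := Frag.forEach k id fun a => Frag.push l a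

theorem runs_move {k l : Ctr ⊕ Str} (hkl : k ≠ l) (S : Ctr ⊕ Str → List Bool) :
    (move k l).Runs S (update (update S k []) l ((S k).reverse ++ S l))
      ((S k).length * 2 + 2) := by
  have key : ∀ (u : List Bool) (S : Ctr ⊕ Str → List Bool), S k = u →
      (move k l).Runs S (update (update S k []) l (u.reverse ++ S l)) (u.length * 2 + 2) := by
    intro u
    induction u with
    | nil =>
      intro S hS
      refine Frag.Runs.loop_exit (t := 1) none (by rw [hS]; rfl) rfl ?_
      rw [hS, List.reverse_nil, List.nil_append, ← update_of_ne hkl.symm [] S, update_eq_self]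
      exact Frag.runs_skip _
    | cons a u ih =>
      intro S hS
      have h := ih (update (update S k u) l (a :: S l)) (by
        rw [update_of_ne hkl, update_self])
      refine (Frag.Runs.loop_cont (S' := update (update S k u) l (a :: S l)) (t := 1) (some a)
        (by rw [hS]; rfl) rfl ?_ h).congr ?_ (by simp; omega)
      · rw [hS, List.tail_cons, ← update_of_ne hkl.symm u S]
        exact Frag.runs_push _ _ _
      · rw [update_self, update_comm hkl, update_idem, update_comm hkl.symm, update_idem]
        simp
  exact key _ S rfl

/-- Adds the counter `v` to the stack `s`. -/
def addTo (v : Ctr) (s : Ctr ⊕ Str) : Prog :=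
  (Frag.forEach (.inl v) id fun _ => (Frag.push (.inr .tmp) true).seq (Frag.push s true)).seq
    (move (.inr .tmp) (.inl v))

/-- The counter is moved to the stack `tmp` and back. -/
theorem runs_addTo {v : Ctr} {s : Ctr ⊕ Str} (hv : s ≠ .inl v) (ht : s ≠ .inr .tmp) {c : Ctr → ℕ}
    {q : Str → List Bool} (hq : q .tmp = []) :
    (addTo v s).Runs (stk c q) (update (stk c q) s (unary (c v) ++ stk c q s)) (c v * 5 + 4) := by
  have h1 := Frag.Runs.forEach_replicate (k := Sum.inl v) (d := id)
    (body := fun _ => ((Frag.push (.inr .tmp) true).seq (Frag.push s true) : Prog)) true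
    (fun i => update (stk (update c v i) (update q .tmp (unary (c v - i)))) s
      (unary (c v - i) ++ stk c q s)) 2 (c v) (fun i _ => by
        rw [update_of_ne hv.symm, stk_inl, update_self]) (fun i hi => by
      refine ((Frag.runs_push _ _ _).seq (Frag.runs_push _ _ _)).congr' rfl ?_ le_rfl
      have e : c v - i = c v - (i + 1) + 1 := by omega
      funext k
      by_cases h1 : k = s
      · subst h1; simp [hv, ht, e, List.replicate_succ]
      · rcases k with k | k
        · by_cases h2 : k = v
          · subst h2; simp [h1]
          · simp [h1, h2]
        · by_cases h2 : k = .tmp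
          · subst h2; simp [h1, e, List.replicate_succ]
          · simp [h1, h2])
  have h2 := runs_move (k := .inr .tmp) (l := .inl v) (by simp)
    (update (stk (update c v 0) (update q .tmp (unary (c v - 0)))) s
      (unary (c v - 0) ++ stk c q s))
  refine (h1.seq h2).congr' ?_ ?_ ?_
  · have e : update q .tmp [] = q := by rw [← hq, update_eq_self]
    simp [e]
  · have e : update q .tmp [] = q := by rw [← hq, update_eq_self]
    rw [update_comm ht, update_comm hv, update_of_ne ht.symm, update_of_ne hv.symm]
    simp [e]
  · rw [update_of_ne ht.symm]
    simp; omega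

/-- A sum of counters and of ones. -/
abbrev Expr := List (Option Ctr)

/-- The value of a sum of counters and of ones. -/
def val (c : Ctr → ℕ) : Expr → ℕ
  | [] => 0
  | none :: e => val c e + 1
  | some v :: e => val c e + c v

/-- Adds the value of an expression to the stack `s`. -/
def addE (s : Ctr ⊕ Str) : Expr → Prog
  | [] => Frag.skip
  | none :: e => (addE s e).seq (Frag.push s true)
  | some v :: e => (addE s e).seq (addTo v s)

theorem exists_runs_addE (s : Ctr ⊕ Str) (ht : s ≠ .inr .tmp) (e : Expr)
    (he : ∀ v, s = .inl v → some v ∉ e) :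
    ∃ t, PolyLE t ∧ ∀ (W : ℕ) (c : Ctr → ℕ) (q : Str → List Bool), (∀ v, c v ≤ W) → q .tmp = [] →
      (addE s e).Runs (stk c q) (update (stk c q) s (unary (val c e) ++ stk c q s)) (t W) := by
  induction e with
  | nil =>
    exact ⟨fun _ => 1, .const 1, fun W c q _ _ => (Frag.runs_skip _).congr (by simp [val]) le_rfl⟩
  | cons a e ih =>
    obtain ⟨t, ht', h⟩ := ih fun v hv hm => he v hv (List.mem_cons_of_mem _ hm)
    cases a with
    | none =>
      refine ⟨fun W => t W + 1, ht'.add (.const 1), fun W c q hc hq =>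
        ((h W c q hc hq).seq (Frag.runs_push _ _ _)).congr ?_ le_rfl⟩
      simp [val, List.replicate_succ]
    | some v =>
      have hv : s ≠ .inl v := fun hs => he v hs (List.mem_cons_self ..)
      refine ⟨fun W => t W + (W * 5 + 4), ht'.add ((PolyLE.id.mul (.const 5)).add (.const 4)),
        fun W c q hc hq => ?_⟩
      have h1 := h W c q hc hq
      obtain ⟨c', q', e1, hc', hq'⟩ : ∃ c' q', update (stk c q) s (unary (val c e) ++ stk c q s) =
          stk c' q' ∧ c' v = c v ∧ q' .tmp = [] := by
        rcases s with s | s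
        · refine ⟨update c s (val c e + c s), q, ?_, ?_, hq⟩
          · rw [stk_inl, unary, unary, ← List.replicate_add, update_stk_inl]
          · exact update_of_ne (fun h => hv (by rw [h])) _ _
        · exact ⟨c, _, update_stk_inr .., rfl,
            (update_of_ne (fun h => ht (by rw [h])) _ _).trans hq⟩
      have h2 := runs_addTo hv ht (c := c') hq'
      rw [hc', ← e1] at h2
      refine (h1.seq h2).congr ?_ (Nat.add_le_add_left ?_ _)
      · rw [update_idem, update_self, ← List.append_assoc, unary, unary, ← List.replicate_add,
          Nat.add_comm]
        rfl
      · have := hc v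
        omega

end Prog

end StackProg

/-! ### Writing gates and reading circuits -/

namespace StackProg

open Function QSim QCircuit

/-- The contents of the stacks that are not counters. -/
def str (qs qr aux out : List Bool) : Str → List Bool
  | .tmp => []
  | .qs => qs
  | .qr => qr
  | .aux => aux
  | .out => out

section Str

variable (qs qr aux out l : List Bool)

@[simp] theorem str_tmp : str qs qr aux out .tmp = [] := rfl
@[simp] theorem str_qs : str qs qr aux out .qs = qs := rfl
@[simp] theorem str_qr : str qs qr aux out .qr = qr := rfl
@[simp] theorem str_aux : str qs qr aux out .aux = aux := rfl
@[simp] theorem str_out : str qs qr aux out .out = out := rfl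

@[simp] theorem update_str_qs : update (str qs qr aux out) .qs l = str l qr aux out := by
  funext s; cases s <;> simp

@[simp] theorem update_str_qr : update (str qs qr aux out) .qr l = str qs l aux out := by
  funext s; cases s <;> simp

@[simp] theorem update_str_aux : update (str qs qr aux out) .aux l = str qs qr l out := by
  funext s; cases s <;> simp

@[simp] theorem update_str_out : update (str qs qr aux out) .out l = str qs qr aux l := by
  funext s; cases s <;> simp

end Str

/-- The code of a list of unitary gates. -/
def gatesCode (us : List UGate) : List Bool :=
  ((us.map Gate.unitary).flatMap gateCode).flatMap natCode

theorem gatesCode_append (us vs : List UGate) :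
    gatesCode (us ++ vs) = gatesCode us ++ gatesCode vs := by
  simp [gatesCode]

/-- The contents of the stacks when the gates `us` have been written in reverse order on `aux`, and
their inverses on `out`, above `foot`. -/
def gst (foot : List Bool) (c : Ctr → ℕ) (qs qr : List Bool) (us : List UGate) :
    Ctr ⊕ Str → List Bool :=
  stk c (str qs qr (gatesCode us).reverse (gatesCode (invList us) ++ foot))

namespace Prog

/-- Writes the codes of a list of numbers on the stack `out`. -/
def emitOut : List Expr → Prog
  | [] => Frag.skip
  | e :: l => (emitOut l).seq ((Frag.push (.inr .out) false).seq (addE (.inr .out) e))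

/-- Writes the codes of a list of numbers on the stack `aux`, in reverse order. -/
def emitAux : List Expr → Prog
  | [] => Frag.skip
  | e :: l => ((addE (.inr .aux) e).seq (Frag.push (.inr .aux) false)).seq (emitAux l)

theorem exists_runs_emitOut (l : List Expr) : ∃ t, PolyLE t ∧
    ∀ (W : ℕ) (c : Ctr → ℕ) (qs qr aux out : List Bool), (∀ v, c v ≤ W) →
      (emitOut l).Runs (stk c (str qs qr aux out))
        (stk c (str qs qr aux ((l.map (val c)).flatMap natCode ++ out))) (t W) := by
  induction l with
  | nil => exact ⟨fun _ => 1, .const 1, fun W c qs qr aux out _ => Frag.runs_skip _⟩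
  | cons e l ih =>
    obtain ⟨t, ht, h⟩ := ih
    obtain ⟨t', ht', h'⟩ := exists_runs_addE (.inr .out) (by simp) e (by simp)
    refine ⟨fun W => t W + (1 + t' W), ht.add ((PolyLE.const 1).add ht'),
      fun W c qs qr aux out hc => ?_⟩
    have h1 := Frag.runs_push (τ := Unit) (.inr .out) false
      (stk c (str qs qr aux ((l.map (val c)).flatMap natCode ++ out)))
    simp only [update_stk_inr, update_str_out, stk_inr, str_out] at h1
    refine ((h W c qs qr aux out hc).seq (h1.seq (h' W c _ hc rfl))).congr ?_ le_rfl
    simp [natCode]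

theorem exists_runs_emitAux (l : List Expr) : ∃ t, PolyLE t ∧
    ∀ (W : ℕ) (c : Ctr → ℕ) (qs qr aux out : List Bool), (∀ v, c v ≤ W) →
      (emitAux l).Runs (stk c (str qs qr aux out))
        (stk c (str qs qr (((l.map (val c)).flatMap natCode).reverse ++ aux) out)) (t W) := by
  induction l with
  | nil => exact ⟨fun _ => 1, .const 1, fun W c qs qr aux out _ => Frag.runs_skip _⟩
  | cons e l ih =>
    obtain ⟨t, ht, h⟩ := ih
    obtain ⟨t', ht', h'⟩ := exists_runs_addE (.inr .aux) (by simp) e (by simp)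
    refine ⟨fun W => t' W + 1 + t W, (ht'.add (.const 1)).add ht,
      fun W c qs qr aux out hc => ?_⟩
    have h1 := (h' W c (str qs qr aux out) hc rfl).seq (Frag.runs_push (.inr .aux) false _)
    simp only [update_stk_inr, update_str_aux, stk_inr, str_aux] at h1
    refine (h1.seq (h W c _ _ _ _ hc)).congr ?_ le_rfl
    simp [natCode]

/-- A unitary gate whose wires are given by expressions. -/
inductive SGate
  | toffoli (a b c : Expr)
  | hadamard (a : Expr)
  | phase (a : Expr)

namespace SGate

/-- The gate denoted by a symbolic gate. -/
def eval (c : Ctr → ℕ) : SGate → UGate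
  | toffoli a b d => .toffoli (val c a) (val c b) (val c d)
  | hadamard a => .hadamard (val c a)
  | phase a => .phase (val c a)

/-- The numbers that encode a symbolic gate. -/
def code : SGate → List Expr
  | toffoli a b d => [[], a, b, d]
  | hadamard a => [[none], a]
  | phase a => [[none, none], a]

/-- The numbers that encode the inverse of a symbolic gate. -/
def invCode : SGate → List Expr
  | toffoli a b d => [[], a, b, d]
  | hadamard a => [[none], a]
  | phase a => [[none, none], a, [none, none], a, [none, none], a]

theorem code_val (c : Ctr → ℕ) (g : SGate) :
    (g.code.map (val c)).flatMap natCode = gatesCode [g.eval c] := by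
  cases g <;> simp [code, gatesCode, eval, val, gateCode]

theorem invCode_val (c : Ctr → ℕ) (g : SGate) :
    (g.invCode.map (val c)).flatMap natCode = gatesCode (invGate (g.eval c)) := by
  cases g <;> simp [invCode, gatesCode, eval, val, gateCode, invGate]

end SGate

/-- Writes the gates `gs` on `aux` and their inverses on `out`. -/
def emit : List SGate → Prog
  | [] => Frag.skip
  | g :: gs => ((emitAux g.code).seq (emitOut g.invCode)).seq (emit gs)

theorem exists_runs_emit (gs : List SGate) : ∃ t, PolyLE t ∧
    ∀ (W : ℕ) (foot : List Bool) (c : Ctr → ℕ) (qs qr : List Bool) (us : List UGate),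
      (∀ v, c v ≤ W) → (emit gs).Runs (gst foot c qs qr us)
        (gst foot c qs qr (us ++ gs.map (SGate.eval c))) (t W) := by
  induction gs with
  | nil =>
    exact ⟨fun _ => 1, .const 1, fun W foot c qs qr us _ =>
      (Frag.runs_skip _).congr (by simp) le_rfl⟩
  | cons g gs ih =>
    obtain ⟨t, ht, h⟩ := ih
    obtain ⟨t₁, ht₁, h₁⟩ := exists_runs_emitAux g.code
    obtain ⟨t₂, ht₂, h₂⟩ := exists_runs_emitOut g.invCode
    refine ⟨fun W => t₁ W + t₂ W + t W, (ht₁.add ht₂).add ht, fun W foot c qs qr us hc => ?_⟩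
    have e := (h₁ W c qs qr (gatesCode us).reverse (gatesCode (invList us) ++ foot) hc).seq
      (h₂ W c qs qr _ _ hc)
    refine ((e.congr (S'' := gst foot c qs qr (us ++ [g.eval c])) ?_ le_rfl).seq
      (h W foot c qs qr _ hc)).congr (by simp) le_rfl
    rw [SGate.code_val, SGate.invCode_val, gst, gatesCode_append, invList_append,
      gatesCode_append, List.reverse_append, List.append_assoc]
    simp [invList]

/-- Reads the code of a number from `qs`, copies it to `qr`, and adds the number to the
counter `v`. -/
def readNum (v : Ctr) : Prog :=
  Frag.loop (.inr .qs) id (fun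
    | some true => (Frag.push (.inr .qr) true).seq (Frag.push (.inl v) true)
    | some false => Frag.push (.inr .qr) false
    | none => Frag.skip) (· == some true)

theorem runs_readNum (v : Ctr) (m : ℕ) : ∀ (c : Ctr → ℕ) (rest qr aux out : List Bool),
    (readNum v).Runs (stk c (str (natCode m ++ rest) qr aux out))
      (stk (update c v (c v + m)) (str rest ((natCode m).reverse ++ qr) aux out))
      (m * 3 + 2) := by
  induction m with
  | zero =>
    intro c rest qr aux out
    refine Frag.Runs.loop_exit (t := 1) (some false) rfl rfl
      ((Frag.runs_push _ _ _).congr ?_ le_rfl)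
    simp [natCode]
  | succ m ih =>
    intro c rest qr aux out
    refine (Frag.Runs.loop_cont (t := 2) (some true) rfl rfl
      (((Frag.runs_push _ _ _).seq (Frag.runs_push _ _ _)).congr
        (S'' := stk (update c v (c v + 1)) (str (natCode m ++ rest) (true :: qr) aux out)) ?_ le_rfl)
      (ih _ _ _ _ _)).congr ?_ (by omega)
    · simp [natCode, List.replicate_succ, ← update_stk_inl]
    · have e : (natCode (m + 1)).reverse = (natCode m).reverse ++ [true] := by
        simp [natCode, List.replicate_succ]
      rw [update_idem, update_self, e]
      simp [Nat.add_assoc, Nat.add_comm 1 m]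

/-- Reads the code of a number `k` from `qs`, copies it to `qr`, and continues with the `k`-th
program of a list. -/
def readTag : List Prog → Prog
  | [] => Frag.skip
  | F :: l => Frag.loop (.inr .qs) id (fun
    | some true => (Frag.push (.inr .qr) true).seq (readTag l)
    | some false => (Frag.push (.inr .qr) false).seq F
    | none => Frag.skip) fun _ => false

theorem runs_readTag {c : Ctr → ℕ} {rest aux out : List Bool} {F : Prog}
    {S' : Ctr ⊕ Str → List Bool} {t : ℕ} (k : ℕ) : ∀ (l : List Prog) (qr : List Bool),
    l[k]? = some F → F.Runs (stk c (str rest ((natCode k).reverse ++ qr) aux out)) S' t →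
    (readTag l).Runs (stk c (str (natCode k ++ rest) qr aux out)) S' (t + 2 * (k + 1)) := by
  induction k with
  | zero =>
    intro l qr hl hF
    cases l with
    | nil => simp at hl
    | cons G l =>
      obtain rfl : G = F := by simpa using hl
      have h := Frag.runs_push (τ := Unit) (.inr .qr) false (stk c (str rest qr aux out))
      simp only [update_stk_inr, update_str_qr, stk_inr, str_qr] at h
      refine (Frag.Runs.loop_exit (some false) rfl rfl ((h.seq hF).congr' ?_ rfl le_rfl)).mono
        (by omega)
      simp [natCode]
  | succ k ih =>
    intro l qr hl hF
    cases l with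
    | nil => simp at hl
    | cons G l =>
      have h := Frag.runs_push (τ := Unit) (.inr .qr) true
        (stk c (str (natCode k ++ rest) qr aux out))
      simp only [update_stk_inr, update_str_qr, stk_inr, str_qr] at h
      have e : (natCode (k + 1)).reverse ++ qr = (natCode k).reverse ++ true :: qr := by
        simp [natCode, List.replicate_succ]
      refine (Frag.Runs.loop_exit (some true) rfl rfl
        ((h.seq (ih l (true :: qr) (by simpa using hl) (e ▸ hF))).congr' ?_ rfl le_rfl)).mono
        (by omega)
      simp [natCode, List.replicate_succ]

theorem runs_clear_inl (v : Ctr) (c : Ctr → ℕ) (q : Str → List Bool) :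
    (clear (.inl v)).Runs (stk c q) (stk (update c v 0) q) (c v * 2 + 2) :=
  (runs_clear _ _).congr (update_stk_inl c q v 0) (by simp)

end Prog

end StackProg

namespace StackProg

open Function QSim QCircuit

theorem PolyLE.comp {f g : ℕ → ℕ} (hf : PolyLE f) (hg : PolyLE g) : PolyLE fun n => f (g n) := by
  obtain ⟨P, hP⟩ := hf
  exact (PolyLE.eval P hg).mono fun n => hP (g n)

theorem update_le {c : Ctr → ℕ} {W m : ℕ} (hc : ∀ v, c v ≤ W) (hm : m ≤ W) (u : Ctr) :
    ∀ v, update c u m v ≤ W := fun v => by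
  by_cases h : v = u
  · subst h; simpa using hm
  · simpa [h] using hc v

theorem sum_le_length_flatMap_natCode (ms : List ℕ) : ms.sum ≤ (ms.flatMap natCode).length := by
  induction ms with
  | nil => simp
  | cons m ms ih => simp [natCode] at ih ⊢; omega

namespace Prog

/-- The values of the counters after numbers `ms` have been added to the counters `vs`. -/
def addAll (c : Ctr → ℕ) : List Ctr → List ℕ → Ctr → ℕ
  | v :: vs, m :: ms => addAll (update c v (c v + m)) vs ms
  | _, _ => c

theorem addAll_of_notMem {u : Ctr} : ∀ {vs : List Ctr} (ms : List ℕ) (c : Ctr → ℕ), u ∉ vs →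
    addAll c vs ms u = c u
  | [], _, _, _ => by simp [addAll]
  | _ :: _, [], _, _ => by simp [addAll]
  | v :: vs, m :: ms, c, h => by
    rw [List.mem_cons, not_or] at h
    rw [addAll, addAll_of_notMem ms _ h.2, update_of_ne h.1]

theorem addAll_le : ∀ (vs : List Ctr) (ms : List ℕ) (c : Ctr → ℕ) (u : Ctr),
    addAll c vs ms u ≤ c u + ms.sum
  | [], _, _, _ => by simp [addAll]
  | _ :: _, [], _, _ => by simp [addAll]
  | v :: vs, m :: ms, c, u => by
    have := addAll_le vs ms (update c v (c v + m)) u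
    rw [addAll, List.sum_cons]
    by_cases h : u = v
    · subst h; rw [update_self] at this; omega
    · rw [update_of_ne h] at this; omega

/-- Reads numbers into the counters `vs`. -/
def readNums : List Ctr → Prog
  | [] => Frag.skip
  | v :: vs => (readNum v).seq (readNums vs)

theorem runs_readNums : ∀ (vs : List Ctr) (ms : List ℕ) (c : Ctr → ℕ) (rest qr aux out : List Bool),
    vs.length = ms.length →
    (readNums vs).Runs (stk c (str (ms.flatMap natCode ++ rest) qr aux out))
      (stk (addAll c vs ms) (str rest ((ms.flatMap natCode).reverse ++ qr) aux out))
      (ms.sum * 3 + vs.length * 2 + 1)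
  | [], [], _, _, _, _, _, _ => (Frag.runs_skip _).congr (by simp [addAll]) (by simp)
  | v :: vs, m :: ms, c, rest, qr, aux, out, h => by
    have h1 := runs_readNum v m c (ms.flatMap natCode ++ rest) qr aux out
    have h2 := runs_readNums vs ms (update c v (c v + m)) rest ((natCode m).reverse ++ qr) aux out
      (by simpa using h)
    refine (h1.seq h2).congr' ?_ ?_ (by simp; omega)
    · simp
    · simp [addAll]

/-- Resets the counters `vs`. -/
def clearAll : List Ctr → Prog
  | [] => Frag.skip
  | v :: vs => (clear (.inl v)).seq (clearAll vs)

theorem runs_clearAll {q : Str → List Bool} {W : ℕ} : ∀ (vs : List Ctr) (c : Ctr → ℕ),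
    (∀ v, c v ≤ W) → (clearAll vs).Runs (stk c q) (stk (fun v => if v ∈ vs then 0 else c v) q)
      (vs.length * (W * 2 + 2) + 1)
  | [], _, _ => (Frag.runs_skip _).congr (by simp) (by simp)
  | v :: vs, c, hc => by
    refine ((runs_clear_inl v c q).seq
      (runs_clearAll vs _ (update_le hc (Nat.zero_le _) v))).congr ?_ ?_
    · congr 1
      funext u
      by_cases h : u = v
      · subst h; simp
      · simp [h]
    · have := hc v
      rw [List.length_cons, Nat.add_mul]
      omega

/-- Reads the numbers of a gate into the counters `vs`, writes the gates `gs`, and resets the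
counters. -/
def readGate (vs : List Ctr) (gs : List SGate) : Prog :=
  (readNums vs).seq ((emit gs).seq (clearAll vs))

theorem exists_runs_readGate (vs : List Ctr) (gs : List SGate) : ∃ t, PolyLE t ∧
    ∀ (W : ℕ) (foot : List Bool) (c : Ctr → ℕ) (rest qr : List Bool) (us : List UGate)
      (ms : List ℕ), vs.length = ms.length → (∀ v, c v ≤ W) → ms.sum ≤ W → (∀ v ∈ vs, c v = 0) →
      (readGate vs gs).Runs (gst foot c (ms.flatMap natCode ++ rest) qr us)
        (gst foot c rest ((ms.flatMap natCode).reverse ++ qr)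
          (us ++ gs.map (SGate.eval (addAll c vs ms)))) (t W) := by
  obtain ⟨t, ht, h⟩ := exists_runs_emit gs
  have h2 : PolyLE fun W : ℕ => W + W := PolyLE.id.add .id
  refine ⟨fun W => (W * 3 + vs.length * 2 + 1) +
    (t (W + W) + (vs.length * ((W + W) * 2 + 2) + 1)),
    (((PolyLE.id.mul (.const 3)).add (.const _)).add (.const 1)).add ((ht.comp h2).add
      (((PolyLE.const _).mul ((h2.mul (.const 2)).add (.const 2))).add (.const 1))), ?_⟩
  intro W foot c rest qr us ms hl hc hms hv
  have hc' : ∀ v, addAll c vs ms v ≤ W + W := fun v =>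
    (addAll_le vs ms c v).trans (add_le_add (hc v) hms)
  refine ((runs_readNums vs ms c rest qr _ _ hl).seq ((h (W + W) foot _ _ _ us hc').seq
    (runs_clearAll vs _ hc'))).congr ?_ (by dsimp only; omega)
  rw [gst]
  congr 1
  funext v
  by_cases h : v ∈ vs
  · rw [if_pos h, hv v h]
  · rw [if_neg h, addAll_of_notMem _ _ h]

/-- How to read the gates: for every tag, the counters for the numbers of a gate, and the gates to
write, on the block of wires that starts at `b`. -/
def gateTable : List (List Ctr × List SGate) :=
  [([.x, .y, .z], [.toffoli [some .x, some .b] [some .y, some .b] [some .z, some .b]]),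
    ([.x], [.hadamard [some .x, some .b]]), ([.x], [.phase [some .x, some .b]]), ([], []),
    ([.x], [])]

/-- The entry of the table for the tag of the gate `g` reads all numbers of `g` and writes the image
of `g` in the block of wires at `b`, or nothing if `g` is not unitary. -/
theorem exists_gateTable (g : Gate) (c : Ctr → ℕ) (hx : c .x = 0) (hy : c .y = 0)
    (hz : c .z = 0) : ∃ k ms e, gateCode g = k :: ms ∧ k ≤ 4 ∧ gateTable[k]? = some e ∧
      e.1.length = ms.length ∧ (∀ v ∈ e.1, c v = 0) ∧
      e.2.map (SGate.eval (addAll c e.1 ms)) = (unitaries [g]).map (mapGate (c .b + ·)) := by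
  rcases g with ⟨⟨a, b, d⟩ | a | a⟩ | _ | a
  · exact ⟨0, [a, b, d], _, rfl, by omega, rfl, rfl, by simp [hx, hy, hz],
      by simp [addAll, SGate.eval, val, unitaries, mapGate, hx, hy, hz]⟩
  · exact ⟨1, [a], _, rfl, by omega, rfl, rfl, by simp [hx],
      by simp [addAll, SGate.eval, val, unitaries, mapGate, hx]⟩
  · exact ⟨2, [a], _, rfl, by omega, rfl, rfl, by simp [hx],
      by simp [addAll, SGate.eval, val, unitaries, mapGate, hx]⟩
  · exact ⟨3, [], _, rfl, by omega, rfl, rfl, by simp, by simp [unitaries]⟩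
  · exact ⟨4, [a], _, rfl, by omega, rfl, rfl, by simp [hx], by simp [unitaries]⟩

theorem exists_runs_readGate_of_mem (L : List (List Ctr × List SGate)) : ∃ t, PolyLE t ∧
    ∀ (W : ℕ) (foot : List Bool) (c : Ctr → ℕ) (rest qr : List Bool) (us : List UGate)
      (ms : List ℕ), ∀ e ∈ L, e.1.length = ms.length → (∀ v, c v ≤ W) → ms.sum ≤ W →
      (∀ v ∈ e.1, c v = 0) →
      (readGate e.1 e.2).Runs (gst foot c (ms.flatMap natCode ++ rest) qr us)
        (gst foot c rest ((ms.flatMap natCode).reverse ++ qr)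
          (us ++ e.2.map (SGate.eval (addAll c e.1 ms)))) (t W) := by
  induction L with
  | nil => exact ⟨fun _ => 0, .const 0, by simp⟩
  | cons a L ih =>
    obtain ⟨t, ht, h⟩ := ih
    obtain ⟨t', ht', h'⟩ := exists_runs_readGate a.1 a.2
    refine ⟨fun W => t W + t' W, ht.add ht', fun W foot c rest qr us ms e he hl hc hms hv => ?_⟩
    rcases List.mem_cons.1 he with rfl | he
    · exact (h' W foot c rest qr us ms hl hc hms hv).mono (Nat.le_add_left ..)
    · exact (h W foot c rest qr us ms e he hl hc hms hv).mono (Nat.le_add_right ..)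

/-- Reads the gates of a circuit and the label of its output wire, and writes the unitary gates on
the block of wires that starts at `b`.  The counter `fl` is `1` until the end marker appears. -/
def readGates : Prog :=
  Frag.loop (.inl .fl) id (fun o => if o.isSome then
    readTag (gateTable.map (fun e => (readGate e.1 e.2).seq (Frag.push (.inl .fl) true)) ++
      [readNum .x]) else Frag.skip) Option.isSome

/-- The whole code is copied to `qr`, so that it can be read again, and the label of the output wire
ends up in the counter `x`. -/
theorem exists_runs_readGates : ∃ t, PolyLE t ∧
    ∀ (W : ℕ) (foot : List Bool) (c : Ctr → ℕ) (o : ℕ) (gs : List Gate) (qr : List Bool)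
      (us : List UGate), (∀ v, c v ≤ W) → c .x = 0 → c .y = 0 → c .z = 0 → c .fl = 0 →
      ((gs.flatMap gateCode ++ [5, o]).flatMap natCode).length ≤ W →
      readGates.Runs
        (gst foot (update c .fl 1) ((gs.flatMap gateCode ++ [5, o]).flatMap natCode) qr us)
        (gst foot (update c .x o) [] (((gs.flatMap gateCode ++ [5, o]).flatMap natCode).reverse ++
          qr) (us ++ (unitaries gs).map (mapGate (c .b + ·)))) (t W) := by
  obtain ⟨t, ht, h⟩ := exists_runs_readGate_of_mem gateTable
  suffices H : ∀ (W : ℕ) (foot : List Bool) (c : Ctr → ℕ) (o : ℕ) (gs : List Gate)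
      (qr : List Bool) (us : List UGate), (∀ v, c v ≤ W) → c .x = 0 → c .y = 0 → c .z = 0 →
      c .fl = 0 → ((gs.flatMap gateCode ++ [5, o]).flatMap natCode).length ≤ W →
      readGates.Runs
        (gst foot (update c .fl 1) ((gs.flatMap gateCode ++ [5, o]).flatMap natCode) qr us)
        (gst foot (update c .x o) [] (((gs.flatMap gateCode ++ [5, o]).flatMap natCode).reverse ++
          qr) (us ++ (unitaries gs).map (mapGate (c .b + ·))))
        (gs.length * (t W + 12) + W * 3 + 18) by
    refine ⟨fun W => W * (t W + 12) + W * 3 + 18, ((PolyLE.id.mul (ht.add (.const 12))).add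
      (PolyLE.id.mul (.const 3))).add (.const 18), fun W foot c o gs qr us hc hx hy hz hf hW =>
      (H W foot c o gs qr us hc hx hy hz hf hW).mono ?_⟩
    have : gs.length ≤ W := by
      refine le_trans ?_ hW
      clear hW
      induction gs with
      | nil => simp
      | cons g gs ih =>
        rcases g with ⟨_ | _ | _⟩ | _ | _ <;> simp [gateCode, natCode] at ih ⊢ <;> omega
    have := Nat.mul_le_mul_right (t W + 12) this
    dsimp only
    omega
  intro W foot c o gs
  have hpop (qs qr us) : update (gst foot (update c .fl 1) qs qr us) (.inl .fl)
      (gst foot (update c .fl 1) qs qr us (.inl .fl)).tail =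
        gst foot (update c .fl 0) qs qr us := by
    rw [gst, gst, ← update_idem (0 : ℕ) 1 c, ← update_stk_inl]
    simp
  induction gs with
  | nil =>
    intro qr us hc hx hy hz hf hW
    have e : update c .fl 0 = c := by rw [← hf, update_eq_self]
    have h1 := runs_readNum .x o c [] ((natCode 5).reverse ++ qr) (gatesCode us).reverse
      (gatesCode (invList us) ++ foot)
    have h2 := runs_readTag 5 (gateTable.map (fun e => (readGate e.1 e.2).seq
      (Frag.push (.inl .fl) true)) ++ [readNum .x]) qr rfl h1
    refine Frag.Runs.mono (Frag.Runs.loop_cont (t₂ := 2) (some true) ?_ rfl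
      (h2.congr' ?_ (S' := gst foot (update c .x o) [] ((natCode o).reverse ++
        ((natCode 5).reverse ++ qr)) us) ?_ le_rfl) ?_) ?_
    · simp [gst]
    · rw [hpop, e]; simp [gst]
    · rw [hx, Nat.zero_add]; rfl
    · refine Frag.Runs.loop_exit none ?_ rfl ((Frag.runs_skip _).congr ?_ le_rfl)
      · simp [gst, hf]
      · have : (gst foot (update c .x o) [] ((natCode o).reverse ++ ((natCode 5).reverse ++ qr)) us
            (.inl .fl)).tail = unary 0 := by simp [gst, hf]
        rw [this, gst, update_stk_inl]
        simp [gst, unitaries, update_comm, e]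
    · simp [natCode] at hW
      simp
      omega
  | cons g gs ih =>
    intro qr us hc hx hy hz hf hW
    have e : update c .fl 0 = c := by rw [← hf, update_eq_self]
    obtain ⟨k, ms, en, hg, hk, hen, hl, hv, hu⟩ := exists_gateTable g c hx hy hz
    have hcode : ((g :: gs).flatMap gateCode ++ [5, o]).flatMap natCode = natCode k ++
        (ms.flatMap natCode ++ (gs.flatMap gateCode ++ [5, o]).flatMap natCode) := by
      simp [hg]
    rw [hcode] at hW ⊢
    have hms : ms.sum ≤ W := (sum_le_length_flatMap_natCode ms).trans (by simp at hW ⊢; omega)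
    have h1 := (h W foot c ((gs.flatMap gateCode ++ [5, o]).flatMap natCode)
      ((natCode k).reverse ++ qr) us ms en (List.mem_of_getElem? hen) hl hc hms hv).seq
      (Frag.runs_push (.inl .fl) true _)
    have h2 := runs_readTag k (gateTable.map (fun e => (readGate e.1 e.2).seq
      (Frag.push (.inl .fl) true)) ++ [readNum .x]) qr (by
        rw [List.getElem?_append_left (by simp [gateTable]; omega), List.getElem?_map, hen]
        rfl) h1
    have h3 := ih ((ms.flatMap natCode).reverse ++ ((natCode k).reverse ++ qr))
      (us ++ (unitaries [g]).map (mapGate (c .b + ·))) hc hx hy hz hf (by simp at hW ⊢; omega)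
    refine Frag.Runs.congr (Frag.Runs.loop_cont (some true) ?_ rfl
      (h2.congr' ?_ (S' := gst foot (update c .fl 1) _ _ _) ?_ le_rfl) h3) ?_ ?_
    · simp [gst]
    · rw [hpop, e]; rfl
    · rw [hu, gst, gst, ← update_stk_inl]
      simp [hf]
    · have : (unitaries (g :: gs)) = unitaries [g] ++ unitaries gs := by
        rcases g with _ | _ | _ <;> simp [unitaries]
      rw [this]
      simp
    · rw [List.length_cons, Nat.add_mul]
      omega

end Prog

end StackProg

/-! ### Writing the amplified circuit -/

namespace StackProg

open Function QSim QCircuit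

namespace Prog

/-- If the program `F` writes the gates `g i` when the counter `v` is at `i`, then the loop writes
the gates `g (m - 1), …, g 0`, one after the other. -/
theorem runs_forCtr_gst {v : Ctr} {F : Prog} {foot qs qr : List Bool} (c : ℕ → Ctr → ℕ)
    (f g : ℕ → List UGate) {T : ℕ} (h0 : f 0 = []) {m : ℕ} (hc : ∀ i ≤ m, c i v = i)
    (hf : ∀ i < m, f (i + 1) = g i ++ f i)
    (hF : ∀ i < m, ∀ us, F.Runs (gst foot (update (c (i + 1)) v i) qs qr us)
      (gst foot (c i) qs qr (us ++ g i)) T) (us : List UGate) :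
    (forCtr v F).Runs (gst foot (c m) qs qr us) (gst foot (c 0) qs qr (us ++ f m))
      (m * (T + 1) + 2) := by
  induction m generalizing us with
  | zero =>
    exact (runs_forCtr_zero F _ (hc 0 le_rfl)).congr (by rw [h0, List.append_nil]; rfl) (by omega)
  | succ m ih =>
    have h := ih (fun i hi => hc i (by omega)) (fun i hi => hf i (by omega))
      (fun i hi => hF i (by omega)) (us ++ g m)
    refine (runs_forCtr_succ (hc (m + 1) le_rfl) (hF m (by omega) us) h).congr ?_
      (by rw [Nat.add_mul]; omega)
    rw [hf m (by omega), List.append_assoc]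

theorem exists_runs_addE_inl (v : Ctr) (e : Expr) (he : some v ∉ e) : ∃ t, PolyLE t ∧
    ∀ (W : ℕ) (c : Ctr → ℕ) (q : Str → List Bool), (∀ v, c v ≤ W) → q .tmp = [] →
      (addE (.inl v) e).Runs (stk c q) (stk (update c v (val c e + c v)) q) (t W) := by
  obtain ⟨t, ht, h⟩ := exists_runs_addE (.inl v) (by simp) e fun u hu => by
    rwa [← Sum.inl_injective hu]
  refine ⟨t, ht, fun W c q hc hq => (h W c q hc hq).congr ?_ le_rfl⟩
  rw [stk_inl, unary, unary, ← List.replicate_add, update_stk_inl]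

/-- Writes one run of the input circuit on the block of wires that starts at `b`, and moves `b` to
the next block. -/
def trial : Prog :=
  (addE (.inl .j) [some .n]).seq <|
  (forCtr .j (emit [.toffoli [some .n] [some .j] [some .j, some .b]])).seq <|
  (readNum .y).seq <| (clear (.inl .y)).seq <| (readNum .y).seq <| (clear (.inl .y)).seq <|
  (Frag.push (.inl .fl) true).seq <| readGates.seq <|
  (addE (.inl .j) [some .d, some .d]).seq <|
  (forCtr .j (emit
    [.toffoli [some .x, some .b] [some .j, none, some .n] [none, some .j, none, some .n],
      .toffoli [some .x, some .b] [none, some .j, none, some .n] [some .j, none, some .n]])).seq <|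
  (clear (.inl .x)).seq <| (addE (.inl .b) [some .d]).seq <| move (.inr .qr) (.inr .qs)

/-- The numbers `k` and `l` of input and output wires in the code of the circuit are skipped. -/
theorem exists_runs_trial : ∃ t, PolyLE t ∧
    ∀ (W : ℕ) (foot : List Bool) (c : Ctr → ℕ) (k l o : ℕ) (gs : List Gate) (s : List Bool)
      (us : List UGate), (∀ v, c v ≤ W) → c .j = 0 → c .x = 0 → c .y = 0 → c .z = 0 →
      c .fl = 0 → c .d + c .d ≤ W →
      s = (k :: l :: (gs.flatMap gateCode ++ [5, o])).flatMap natCode → s.length ≤ W →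
      trial.Runs (gst foot c s [] us) (gst foot (update c .b (c .b + c .d)) s []
        (us ++ QSim.trial (c .n) (c .d) o (unitaries gs) (c .b))) (t W) := by
  obtain ⟨t₁, ht₁, h₁⟩ := exists_runs_addE_inl .j [some .n] (by simp)
  obtain ⟨t₂, ht₂, h₂⟩ := exists_runs_emit
    [.toffoli [some .n] [some .j] [some .j, some .b]]
  obtain ⟨t₃, ht₃, h₃⟩ := exists_runs_readGates
  obtain ⟨t₄, ht₄, h₄⟩ := exists_runs_addE_inl .j [some .d, some .d] (by simp)
  obtain ⟨t₅, ht₅, h₅⟩ := exists_runs_emit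
    [.toffoli [some .x, some .b] [some .j, none, some .n] [none, some .j, none, some .n],
      .toffoli [some .x, some .b] [none, some .j, none, some .n] [some .j, none, some .n]]
  obtain ⟨t₆, ht₆, h₆⟩ := exists_runs_addE_inl .b [some .d] (by simp)
  have hlin : PolyLE fun W : ℕ => W * 3 + 2 := (PolyLE.id.mul (.const 3)).add (.const 2)
  have hlin' : PolyLE fun W : ℕ => W * 2 + 2 := (PolyLE.id.mul (.const 2)).add (.const 2)
  refine ⟨_, ht₁.add <| ((PolyLE.id.mul (ht₂.add (.const 1))).add (.const 2)).add <|
    hlin.add <| hlin'.add <| hlin.add <| hlin'.add <| (PolyLE.const 1).add <| ht₃.add <| ht₄.add <|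
    ((PolyLE.id.mul (ht₅.add (.const 1))).add (.const 2)).add <| hlin'.add <| ht₆.add hlin',
    fun W foot c k l o gs s us hc hj hx hy hz hfl hd hs hW => ?_⟩
  set p := (gs.flatMap gateCode ++ [5, o]).flatMap natCode with hp
  have hs' : s = natCode k ++ (natCode l ++ p) := by simp [hs, hp]
  have hlen : s.length = (k + 1) + ((l + 1) + p.length) := by rw [hs']; simp [natCode]; omega
  have ho : o ≤ W := by
    have : p.length ≤ W := by omega
    simp [hp, natCode] at this
    omega
  have hc' : ∀ v, update c .x o v ≤ W := update_le hc ho _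
  -- the gates written after copying the input, and after the gates of the circuit
  set us₁ := us ++ copyIn (c .n) (c .b) (c .n)
  set us₂ := us₁ ++ (unitaries gs).map (mapGate (c .b + ·))
  -- the effect of the steps of the program, in their order
  have s₁ : (addE (.inl .j) [some .n]).Runs (gst foot c s [] us)
      (gst foot (update c .j (c .n)) s [] us) (t₁ W) := by
    refine (h₁ W c _ hc rfl).congr ?_ le_rfl
    simp [val, hj, gst]
  have s₂ := runs_forCtr_gst (v := .j) (foot := foot) (qs := s) (qr := [])
    (fun i => update c .j i) (copyIn (c .n) (c .b)) (fun i => [.toffoli (c .n) i (c .b + i)])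
    (T := t₂ W) rfl (m := c .n) (fun i _ => update_self ..) (fun i _ => rfl)
    (fun i hi us => by
      refine (h₂ W foot (update c .j i) s [] us (update_le hc (hi.le.trans (hc _)) _)).congr' ?_ ?_
        le_rfl
      · rw [update_idem]
      · simp [SGate.eval, val]) us
  have e₀ : update c .j 0 = c := by rw [← hj, update_eq_self]
  have s₂' := s₂.congr (t' := W * (t₂ W + 1) + 2) (S'' := gst foot c s [] us₁)
    (by simp only [e₀]; rfl) (by have := Nat.mul_le_mul_right (t₂ W + 1) (hc .n); omega)
  have ey (m : ℕ) : update (update c .y m) .y 0 = c := by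
    rw [update_idem, ← hy, update_eq_self]
  have s₃ : (readNum .y).Runs (gst foot c s [] us₁) (gst foot (update c .y k) (natCode l ++ p)
      (natCode k).reverse us₁) (W * 3 + 2) := by
    rw [hs']
    refine (runs_readNum .y k c (natCode l ++ p) [] _ _).congr ?_ (by omega)
    rw [hy, Nat.zero_add, List.append_nil]
    rfl
  have s₄ : (clear (.inl .y)).Runs (gst foot (update c .y k) (natCode l ++ p)
      (natCode k).reverse us₁) (gst foot c (natCode l ++ p) (natCode k).reverse us₁)
      (W * 2 + 2) :=
    (runs_clear_inl .y _ _).congr (by rw [ey]; rfl) (by rw [update_self]; omega)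
  have s₅ : (readNum .y).Runs (gst foot c (natCode l ++ p) (natCode k).reverse us₁)
      (gst foot (update c .y l) p ((natCode l).reverse ++ (natCode k).reverse) us₁)
      (W * 3 + 2) := by
    refine (runs_readNum .y l c p (natCode k).reverse _ _).congr ?_ (by omega)
    rw [hy, Nat.zero_add]
    rfl
  have s₆ : (clear (.inl .y)).Runs
      (gst foot (update c .y l) p ((natCode l).reverse ++ (natCode k).reverse) us₁)
      (gst foot c p ((natCode l).reverse ++ (natCode k).reverse) us₁) (W * 2 + 2) :=
    (runs_clear_inl .y _ _).congr (by rw [ey]; rfl) (by rw [update_self]; omega)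
  have s₇ : (Frag.push (.inl .fl) true : Prog).Runs
      (gst foot c p ((natCode l).reverse ++ (natCode k).reverse) us₁)
      (gst foot (update c .fl 1) p ((natCode l).reverse ++ (natCode k).reverse) us₁) 1 := by
    refine (Frag.runs_push _ _ _).congr ?_ le_rfl
    rw [gst, gst, ← update_stk_inl]
    simp [hfl]
  have s₈ : readGates.Runs
      (gst foot (update c .fl 1) p ((natCode l).reverse ++ (natCode k).reverse) us₁)
      (gst foot (update c .x o) [] s.reverse us₂) (t₃ W) := by
    refine (h₃ W foot c o gs _ us₁ hc hx hy hz hfl (by rw [← hp]; omega)).congr ?_ le_rfl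
    rw [← hp, hs']
    simp [us₂]
  have s₉ : (addE (.inl .j) [some .d, some .d]).Runs (gst foot (update c .x o) [] s.reverse us₂)
      (gst foot (update (update c .x o) .j (2 * c .d)) [] s.reverse us₂) (t₄ W) := by
    refine (h₄ W _ _ hc' rfl).congr ?_ le_rfl
    simp [val, hj, gst, two_mul]
  have s₁₀ := runs_forCtr_gst (v := .j) (foot := foot) (qs := []) (qr := s.reverse)
    (fun i => update (update c .x o) .j i) (countIn (c .n) (c .b + o))
    (fun i => [.toffoli (c .b + o) (c .n + 1 + i) (c .n + 1 + i + 1),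
      .toffoli (c .b + o) (c .n + 1 + i + 1) (c .n + 1 + i)])
    (T := t₅ W) rfl (m := 2 * c .d) (fun i _ => update_self ..) (fun i _ => rfl)
    (fun i hi us => by
      refine (h₅ W foot (update (update c .x o) .j i) [] s.reverse us
        (update_le hc' (by omega) _)).congr' ?_ ?_ le_rfl
      · rw [update_idem]
      · simp [SGate.eval, val]) us₂
  have e₁ : update (update c .x o) .j 0 = update c .x o := by
    rw [update_eq_self_iff]; simp [hj]
  have s₁₀' := s₁₀.congr (t' := W * (t₅ W + 1) + 2) (S'' := gst foot (update c .x o) [] s.reverse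
    (us ++ QSim.trial (c .n) (c .d) o (unitaries gs) (c .b)))
    (by simp [e₁, us₂, us₁, QSim.trial])
    (by have := Nat.mul_le_mul_right (t₅ W + 1) (show 2 * c .d ≤ W by omega); omega)
  have s₁₁ := (runs_clear_inl .x (update c .x o)
    (str [] s.reverse (gatesCode (us ++ QSim.trial (c .n) (c .d) o (unitaries gs) (c .b))).reverse
      (gatesCode (invList (us ++ QSim.trial (c .n) (c .d) o (unitaries gs) (c .b))) ++
        foot))).congr (t' := W * 2 + 2) (S'' := gst foot c [] s.reverse
          (us ++ QSim.trial (c .n) (c .d) o (unitaries gs) (c .b)))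
    (by rw [update_idem, ← hx, update_eq_self]; rfl) (by rw [update_self]; omega)
  have s₁₂ : (addE (.inl .b) [some .d]).Runs (gst foot c [] s.reverse
        (us ++ QSim.trial (c .n) (c .d) o (unitaries gs) (c .b)))
      (gst foot (update c .b (c .b + c .d)) [] s.reverse
        (us ++ QSim.trial (c .n) (c .d) o (unitaries gs) (c .b))) (t₆ W) := by
    refine (h₆ W _ _ hc rfl).congr ?_ le_rfl
    simp [val, gst, Nat.add_comm]
  have s₁₃ : (move (.inr .qr) (.inr .qs)).Runs (gst foot (update c .b (c .b + c .d)) [] s.reverse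
        (us ++ QSim.trial (c .n) (c .d) o (unitaries gs) (c .b)))
      (gst foot (update c .b (c .b + c .d)) s []
        (us ++ QSim.trial (c .n) (c .d) o (unitaries gs) (c .b))) (W * 2 + 2) := by
    refine (runs_move (by simp) _).congr ?_ (by simp [gst]; omega)
    simp [gst]
  exact s₁.seq <| s₂'.seq <| s₃.seq <| s₄.seq <| s₅.seq <| s₆.seq <| s₇.seq <| s₈.seq <| s₉.seq <|
    s₁₀'.seq <| s₁₁.seq <| s₁₂.seq s₁₃

end Prog

end StackProg

namespace StackProg

open Function QSim QCircuit

namespace Prog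

theorem val_update {c : Ctr → ℕ} {v : Ctr} {m : ℕ} {e : Expr} (he : some v ∉ e) :
    val (update c v m) e = val c e := by
  induction e with
  | nil => rfl
  | cons a e ih =>
    rw [List.mem_cons, not_or] at he
    cases a with
    | none => rw [val, val, ih he.2]
    | some u => rw [val, val, ih he.2, update_of_ne fun h => he.1 (by rw [h])]

/-- The loop adds a product of a counter and an expression to a counter. -/
theorem exists_runs_mulAdd {v u : Ctr} {e : Expr} (hvu : v ≠ u) (hu : some u ∉ e)
    (hv : some v ∉ e) : ∃ t, PolyLE t ∧
    ∀ (W : ℕ) (c : Ctr → ℕ) (q : Str → List Bool), (∀ v, c v ≤ W) → c u + c v * val c e ≤ W →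
      q .tmp = [] → (forCtr v (addE (.inl u) e)).Runs (stk c q)
        (stk (update (update c v 0) u (c u + c v * val c e)) q) (t W) := by
  obtain ⟨t, ht, h⟩ := exists_runs_addE_inl u e hu
  refine ⟨fun W => W * (t W + 1) + 2, (PolyLE.id.mul (ht.add (.const 1))).add (.const 2),
    fun W c q hc hW hq => ?_⟩
  suffices H : ∀ (m : ℕ) (c : Ctr → ℕ), (∀ v, c v ≤ W) → c u + m * val c e ≤ W → c v = m →
      (forCtr v (addE (.inl u) e)).Runs (stk c q)
        (stk (update (update c v 0) u (c u + m * val c e)) q) (m * (t W + 1) + 2) by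
    have := Nat.mul_le_mul_right (t W + 1) (hc v)
    exact (H _ c hc hW rfl).mono (by dsimp only; omega)
  intro m
  induction m with
  | zero =>
    intro c _ _ hm
    refine (runs_forCtr_zero _ q hm).congr ?_ (by omega)
    rw [← hm, update_eq_self, hm, Nat.zero_mul, Nat.add_zero, update_eq_self]
  | succ m ih =>
    intro c hc hW hm
    have hcu : c u + val c e + m * val c e ≤ W := by rw [Nat.add_mul] at hW; omega
    have h1 := h W (update c v m) q (update_le hc (by have := hc v; omega) v) hq
    rw [val_update hv, update_of_ne hvu.symm, Nat.add_comm] at h1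
    have h2 := ih (update (update c v m) u (c u + val c e))
      (update_le (update_le hc (by have := hc v; omega) v) (by omega) u)
      (by rwa [update_self, val_update hu, val_update hv]) (by rw [update_of_ne hvu, update_self])
    refine (runs_forCtr_succ hm h1 h2).congr ?_ (by rw [Nat.add_mul]; omega)
    rw [update_self, val_update hu, val_update hv]
    congr 1
    funext k
    by_cases h3 : k = u
    · subst h3
      rw [update_self, update_self]
      ring
    · by_cases h4 : k = v
      · subst h4; simp [h3]
      · simp [h3, h4]

theorem exists_runs_forCtr_emitOut (v : Ctr) (l : List Expr) : ∃ t, PolyLE t ∧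
    ∀ (W : ℕ) (c : Ctr → ℕ) (m : ℕ) (qs qr aux out : List Bool), (∀ v, c v ≤ W) → m ≤ W →
      (forCtr v (emitOut l)).Runs (stk (update c v m) (str qs qr aux out))
        (stk (update c v 0) (str qs qr aux ((List.range m).flatMap
          (fun i => (l.map (val (update c v i))).flatMap natCode) ++ out))) (t W) := by
  obtain ⟨t, ht, h⟩ := exists_runs_emitOut l
  refine ⟨fun W => W * (t W + 1) + 2, (PolyLE.id.mul (ht.add (.const 1))).add (.const 2),
    fun W c m qs qr aux out hc hm => ?_⟩
  refine Frag.Runs.mono (t := m * (t W + 1) + 2) ?_ (by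
    have := Nat.mul_le_mul_right (t W + 1) hm
    dsimp only; omega)
  induction m generalizing out with
  | zero => exact (runs_forCtr_zero _ _ (update_self ..)).congr (by simp) (by omega)
  | succ m ih =>
    have h1 := h W (update c v m) qs qr aux out (update_le hc (by omega) v)
    refine (runs_forCtr_succ (update_self ..) (h1.congr' ?_ rfl le_rfl)
      (ih _ (by omega))).congr ?_ (by rw [Nat.add_mul]; omega)
    · rw [update_idem]
    · simp [List.range_succ]

theorem runs_move_inl_out (v : Ctr) (c : Ctr → ℕ) (qs qr aux out : List Bool) :
    (move (.inl v) (.inr .out)).Runs (stk c (str qs qr aux out))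
      (stk (update c v 0) (str qs qr aux (unary (c v) ++ out))) (c v * 2 + 2) := by
  refine (runs_move (by simp) _).congr ?_ (by simp)
  rw [update_comm (by simp)]
  simp only [stk_inl, stk_inr, str_out, update_stk_inr, update_str_out, List.reverse_replicate]
  exact update_stk_inl _ _ _ 0

/-- Moves the string on `qr` to `qs`, and sets `d` to its length plus six times `p`. -/
def prepare : Prog :=
  (Frag.forEach (.inr .qr) id fun a => (Frag.push (.inr .qs) a).seq (Frag.push (.inl .d) true)).seq
    (forCtr .p (addE (.inl .d) (List.replicate 6 none)))

/-- The counters after the preparation. -/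
def start (n d : ℕ) : Ctr → ℕ := update (update (fun _ => 0) .n n) .d d

/-- The string arrives in reverse, and moving it from `qr` to `qs` restores the order. -/
theorem exists_runs_prepare : ∃ t, PolyLE t ∧ ∀ (W n m : ℕ) (s : List Bool), n ≤ W →
    s.length + 6 * m ≤ W →
    prepare.Runs (inputs (.inl .n) (.inr .qr) (.inl .p) n s m)
      (stk (start n (s.length + 6 * m)) (str s [] [] [])) (t W) := by
  obtain ⟨t, ht, h⟩ := exists_runs_mulAdd (v := .p) (u := .d) (e := List.replicate 6 none)
    (by simp) (by simp) (by simp)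
  refine ⟨fun W => (W * 3 + 2) + t W, ((PolyLE.id.mul (.const 3)).add (.const 2)).add ht,
    fun W n m s hn hW => ?_⟩
  let c₀ : Ctr → ℕ := update (update (fun _ => 0) .n n) .p m
  have e₀ : inputs (.inl .n) (.inr .qr) (.inl .p) n s m =
      stk (update c₀ .d 0) (str [] s.reverse [] []) := by
    funext k
    rcases k with k | k <;> cases k <;> simp [inputs, c₀]
  have h1 : ∀ (u acc : List Bool) (k : ℕ),
      (Frag.forEach (.inr .qr) id fun a =>
        (Frag.push (.inr .qs) a).seq (Frag.push (.inl .d) true) : Prog).Runs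
        (stk (update c₀ .d k) (str acc u [] []))
        (stk (update c₀ .d (k + u.length)) (str (u.reverse ++ acc) [] [] []))
        (u.length * 3 + 2) := by
    intro u
    induction u with
    | nil =>
      intro acc k
      exact Frag.Runs.loop_exit none rfl rfl ((Frag.runs_skip _).congr (by simp) le_rfl)
    | cons a u ih =>
      intro acc k
      refine (Frag.Runs.loop_cont (t := 2) (some a) rfl rfl
        (((Frag.runs_push _ _ _).seq (Frag.runs_push _ _ _)).congr ?_ le_rfl)
        (ih (a :: acc) (k + 1))).congr ?_ (by simp; omega)
      · refine Eq.trans ?_ ((update_stk_inl (update c₀ .d k) _ .d (k + 1)).trans (by rw [update_idem]))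
        simp [List.replicate_succ]
      · simp [Nat.add_assoc, Nat.add_comm 1]
  have hc : ∀ v, update c₀ .d s.length v ≤ W := fun v => by
    cases v <;> simp [c₀] <;> omega
  have hval : val (update c₀ .d s.length) (List.replicate 6 none) = 6 := rfl
  have h2 := h W (update c₀ .d s.length) (str s [] [] []) hc
    (by rw [hval]; simp [c₀]; omega) rfl
  rw [e₀]
  have h3 := h1 s.reverse [] 0
  rw [List.reverse_reverse, List.append_nil, Nat.zero_add, List.length_reverse] at h3
  refine (h3.seq h2).congr ?_ (by dsimp only; omega)
  congr 1
  rw [hval]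
  funext v
  cases v <;> simp [c₀, start, Nat.mul_comm]

/-- Computes the number of ancillary wires. -/
def width : Prog :=
  prepare.seq <| (addE (.inl .w) [none, none, some .d, some .d]).seq <|
  (addE (.inl .i) [some .d, some .d]).seq <| (forCtr .i (addE (.inl .w) [some .d])).seq <|
  (move (.inl .w) (.inr .out)).seq <| (clear (.inl .n)).seq <| (clear (.inl .d)).seq <|
  clear (.inr .qs)

theorem exists_runs_width : ∃ t, PolyLE t ∧ ∀ (W n m : ℕ) (s : List Bool) (d : ℕ),
    d = s.length + 6 * m → n + (2 + 2 * d + 2 * d * d) ≤ W →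
    width.Runs (inputs (.inl .n) (.inr .qr) (.inl .p) n s m)
      (update (fun _ => []) (.inr .out) (unary (2 + 2 * d + 2 * d * d))) (t W) := by
  obtain ⟨t₁, ht₁, h₁⟩ := exists_runs_prepare
  obtain ⟨t₂, ht₂, h₂⟩ := exists_runs_addE_inl .w [none, none, some .d, some .d] (by simp)
  obtain ⟨t₃, ht₃, h₃⟩ := exists_runs_addE_inl .i [some .d, some .d] (by simp)
  obtain ⟨t₄, ht₄, h₄⟩ := exists_runs_mulAdd (v := .i) (u := .w) (e := [some .d])
    (by simp) (by simp) (by simp)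
  have hlin : PolyLE fun W : ℕ => W * 2 + 2 := (PolyLE.id.mul (.const 2)).add (.const 2)
  refine ⟨_, ht₁.add <| ht₂.add <| ht₃.add <| ht₄.add <| hlin.add <| hlin.add <| hlin.add hlin,
    fun W n m s d hd hW => ?_⟩
  have hdd : 2 * d * d + 2 * d + n + 2 ≤ W := by omega
  have hb : ∀ v, start n d v ≤ W := fun v => by
    cases v <;> simp [start] <;> omega
  have s₁ := h₁ W n m s (by omega) (by omega)
  rw [← hd] at s₁
  have s₂ := h₂ W (start n d) (str s [] [] []) hb rfl
  have hw : val (start n d) [none, none, some .d, some .d] + start n d .w = 2 + 2 * d := by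
    simp [val, start]; omega
  rw [hw] at s₂
  have hb₂ : ∀ v, update (start n d) .w (2 + 2 * d) v ≤ W := update_le hb (by omega) _
  have s₃ := h₃ W (update (start n d) .w (2 + 2 * d)) (str s [] [] []) hb₂ rfl
  have hi : val (update (start n d) .w (2 + 2 * d)) [some .d, some .d] +
      update (start n d) .w (2 + 2 * d) .i = 2 * d := by
    simp [val, start]; omega
  rw [hi] at s₃
  have hb₃ : ∀ v, update (update (start n d) .w (2 + 2 * d)) .i (2 * d) v ≤ W :=
    update_le hb₂ (by omega) _
  have e₄ : update (update (start n d) .w (2 + 2 * d)) .i (2 * d) .w +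
      update (update (start n d) .w (2 + 2 * d)) .i (2 * d) .i *
        val (update (update (start n d) .w (2 + 2 * d)) .i (2 * d)) [some .d] =
      2 + 2 * d + 2 * d * d := by
    simp [val, start]
  have s₄ := h₄ W _ (str s [] [] []) hb₃ (by rw [e₄]; omega) rfl
  rw [e₄] at s₄
  have e₅ : update (update (update (update (start n d) .w (2 + 2 * d)) .i (2 * d)) .i 0) .w
      (2 + 2 * d + 2 * d * d) = update (start n d) .w (2 + 2 * d + 2 * d * d) := by
    funext v
    cases v <;> simp [start]
  rw [e₅] at s₄
  have s₅ := runs_move_inl_out .w (update (start n d) .w (2 + 2 * d + 2 * d * d)) s [] [] []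
  have e₆ : update (update (start n d) .w (2 + 2 * d + 2 * d * d)) .w 0 = start n d := by
    funext v
    cases v <;> simp [start]
  rw [e₆, update_self, List.append_nil] at s₅
  have s₆ := runs_clear_inl .n (start n d) (str s [] [] (unary (2 + 2 * d + 2 * d * d)))
  have s₇ := runs_clear_inl .d (update (start n d) .n 0)
    (str s [] [] (unary (2 + 2 * d + 2 * d * d)))
  have s₈ := runs_clear (.inr .qs) (stk (update (update (start n d) .n 0) .d 0)
    (str s [] [] (unary (2 + 2 * d + 2 * d * d))))
  refine (s₁.seq <| s₂.seq <| s₃.seq <| s₄.seq <| (s₅.mono (t' := W * 2 + 2) (by omega)).seq <|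
    (s₆.mono (t' := W * 2 + 2) ?_).seq <| (s₇.mono (t' := W * 2 + 2) ?_).seq
    (s₈.mono (t' := W * 2 + 2) ?_)).congr ?_ le_rfl
  · have := hb .n
    omega
  · simp [start]; omega
  · simp; omega
  · funext k
    rcases k with k | k <;> cases k <;> simp [start]

end Prog

end StackProg

namespace StackProg

open Function QSim QCircuit

theorem flips_eq (n A m : ℕ) :
    flips n A m = (List.range m).map fun i => .toffoli n (n + 1 + i) A := by
  induction m with
  | zero => rfl
  | succ m ih => simp [flips, ih, List.range_succ]

theorem length_gatesCode_le {us : List UGate} {k : ℕ} (h : ∀ u ∈ us, u.Valid (Finset.range k)) :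
    (gatesCode us).length ≤ us.length * (4 * (k + 1)) := by
  induction us with
  | nil => simp [gatesCode]
  | cons u us ih =>
    have h1 := ih fun v hv => h v (List.mem_cons_of_mem _ hv)
    have h2 : (gatesCode [u]).length ≤ 4 * (k + 1) := by
      have h3 := h u (List.mem_cons_self ..)
      cases u <;> simp [UGate.Valid] at h3 <;> simp [gatesCode, gateCode, natCode] <;> omega
    rw [← List.singleton_append, gatesCode_append, List.length_append, List.length_append,
      List.length_singleton, Nat.add_mul]
    omega

theorem length_copyIn (n b m : ℕ) : (copyIn n b m).length = m := by
  induction m with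
  | zero => rfl
  | succ m ih => rw [copyIn, List.length_cons, ih]

theorem length_countIn (n o m : ℕ) : (countIn n o m).length = 2 * m := by
  induction m with
  | zero => rfl
  | succ m ih => rw [countIn, List.length_cons, List.length_cons, ih]; ring

theorem length_compute (n D o : ℕ) (us : List UGate) :
    (compute n D o us).length = 8 + 2 * D * (n + us.length + 4 * D) := by
  have h (m b : ℕ) : (trials n D o us m b).length = m * (n + us.length + 4 * D) := by
    induction m generalizing b with
    | zero => simp [trials]
    | succ m ih =>
      rw [trials, List.length_append, ih, QSim.trial, List.length_append, List.length_append,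
        List.length_map, length_copyIn, length_countIn]
      ring
  simp [compute, notGates, h]
  omega

theorem length_unitaries_le (gs : List Gate) : (unitaries gs).length ≤ gs.length := by
  induction gs with
  | nil => simp [unitaries]
  | cons g gs ih => rcases g with _ | _ | _ <;> simp [unitaries] <;> omega

theorem length_le_length_code (gs : List Gate) :
    gs.length ≤ ((gs.flatMap gateCode).flatMap natCode).length := by
  induction gs with
  | nil => simp
  | cons g gs ih =>
    rcases g with ⟨_ | _ | _⟩ | _ | _ <;> simp [gateCode, natCode] at ih ⊢ <;> omega

namespace Prog

/-- Writes the code of the amplified circuit. -/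
def amplify : Prog :=
  prepare.seq <| (addE (.inl .b) [none, none, some .n, some .d, some .d]).seq <|
  (addE (.inl .w) [none, some .b]).seq <| (addE (.inl .i) [some .d, some .d]).seq <|
  (forCtr .i (addE (.inl .w) [some .d])).seq <| (forCtr .w (emitOut [[some .w]])).seq <|
  (emitOut [[none, none, none, none, none]]).seq <|
  (emit [.hadamard [some .n], .phase [some .n], .phase [some .n], .hadamard [some .n],
    .hadamard [none, some .n], .phase [none, some .n], .phase [none, some .n],
    .hadamard [none, some .n]]).seq <|
  (addE (.inl .i) [some .d, some .d]).seq <| (forCtr .i trial).seq <|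
  (addE (.inl .j) [none, some .d]).seq <|
  (forCtr .j (emitOut [[], [some .n], [some .j, none, some .n], [some .b]])).seq <|
  (move (.inr .aux) (.inr .out)).seq <|
  (emitOut [[none, some .b], [none, some .b]]).seq <|
  (clear (.inl .n)).seq <| (clear (.inl .d)).seq <| (clear (.inl .b)).seq <| clear (.inr .qs)

/-- The counters after the preparation, with the counter `b` set. -/
def main (n d b : ℕ) : Ctr → ℕ := update (start n d) .b b

theorem main_le {n d b W : ℕ} (hn : n ≤ W) (hd : d ≤ W) (hb : b ≤ W) : ∀ v, main n d b v ≤ W :=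
  update_le (update_le (update_le (fun _ => Nat.zero_le W) hn .n) hd .d) hb .b

/-- The amplified circuit is written as a string of the numbers of wires, the gates and the output
wires. -/
theorem encode_amplified {n D o : ℕ} {us : List UGate}
    (h : ∀ u ∈ amplified n D o us, u.Valid (Finset.range (target n D + 1))) :
    (unitaryCircuit (target n D + 1) (amplified n D o us) h).encode =
      [target n D + 1, target n D + 1].flatMap natCode ++ (gatesCode (compute n D o us) ++
        (gatesCode (flips n (target n D) (D + 1)) ++ (gatesCode (invList (compute n D o us)) ++
          (5 :: List.range (target n D + 1)).flatMap natCode))) := by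
  have : List.ofFn (Fin.val : Fin (target n D + 1) → ℕ) = List.range (target n D + 1) := by
    rw [List.ofFn_eq_map, List.map_coe_finRange_eq_range]
  simp [encode, code, unitaryCircuit, amplified, gatesCode, ← this]

/-- The bound on the labels is only needed to bound the length of the code that is moved from `aux`
to `out`. -/
theorem exists_runs_amplify : ∃ t, PolyLE t ∧ ∀ (W n m : ℕ) (s : List Bool) (d o : ℕ)
    (gs : List Gate), s = (n :: 1 :: (gs.flatMap gateCode ++ [5, o])).flatMap natCode →
    d = s.length + 6 * m → target n d + 1 ≤ W →
    (∀ u ∈ compute n d o (unitaries gs), u.Valid (Finset.range (target n d))) →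
    amplify.Runs (inputs (.inl .n) (.inr .qr) (.inl .p) n s m)
      (update (fun _ => []) (.inr .out)
        ([target n d + 1, target n d + 1].flatMap natCode ++
          (gatesCode (compute n d o (unitaries gs)) ++
            (gatesCode (flips n (target n d) (d + 1)) ++
              (gatesCode (invList (compute n d o (unitaries gs))) ++
                (5 :: List.range (target n d + 1)).flatMap natCode))))) (t W) := by
  obtain ⟨t₁, ht₁, h₁⟩ := exists_runs_prepare
  obtain ⟨t₂, ht₂, h₂⟩ := exists_runs_addE_inl .b [none, none, some .n, some .d, some .d] (by simp)
  obtain ⟨t₃, ht₃, h₃⟩ := exists_runs_addE_inl .w [none, some .b] (by simp)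
  obtain ⟨t₄, ht₄, h₄⟩ := exists_runs_addE_inl .i [some .d, some .d] (by simp)
  obtain ⟨t₅, ht₅, h₅⟩ := exists_runs_mulAdd (v := .i) (u := .w) (e := [some .d])
    (by simp) (by simp) (by simp)
  obtain ⟨t₆, ht₆, h₆⟩ := exists_runs_forCtr_emitOut .w [[some .w]]
  obtain ⟨t₇, ht₇, h₇⟩ := exists_runs_emitOut [[none, none, none, none, none]]
  obtain ⟨t₈, ht₈, h₈⟩ := exists_runs_emit [.hadamard [some .n], .phase [some .n], .phase [some .n],
    .hadamard [some .n], .hadamard [none, some .n], .phase [none, some .n], .phase [none, some .n],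
    .hadamard [none, some .n]]
  obtain ⟨t₉, ht₉, h₉⟩ := exists_runs_trial
  obtain ⟨t₁₀, ht₁₀, h₁₀⟩ := exists_runs_addE_inl .j [none, some .d] (by simp)
  obtain ⟨t₁₁, ht₁₁, h₁₁⟩ := exists_runs_forCtr_emitOut .j
    [[], [some .n], [some .j, none, some .n], [some .b]]
  obtain ⟨t₁₂, ht₁₂, h₁₂⟩ := exists_runs_emitOut [[none, some .b], [none, some .b]]
  have hlin : PolyLE fun W : ℕ => W * 2 + 2 := (PolyLE.id.mul (.const 2)).add (.const 2)
  have hmove : PolyLE fun W : ℕ => (8 + W * (W * 6)) * (4 * (W + 1)) * 2 + 2 :=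
    ((((PolyLE.const 8).add (PolyLE.id.mul (PolyLE.id.mul (.const 6)))).mul
      ((PolyLE.const 4).mul (PolyLE.id.add (.const 1)))).mul (.const 2)).add (.const 2)
  refine ⟨_, ht₁.add <| ht₂.add <| ht₃.add <| ht₄.add <| ht₅.add <| ht₆.add <| ht₇.add <|
    ht₈.add <| ht₄.add <| ((PolyLE.id.mul (ht₉.add (.const 1))).add (.const 2)).add <|
    ht₁₀.add <| ht₁₁.add <| hmove.add <| ht₁₂.add <| hlin.add <| hlin.add <| hlin.add hlin,
    fun W n m s d o gs hs hd hW hvalid => ?_⟩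
  set us := unitaries gs with hus
  set A := target n d with hA
  have hA' : A = n + 2 + 2 * d + 2 * d * d := by rw [hA, target]; omega
  have hlen : gs.length ≤ s.length := by
    refine (length_le_length_code gs).trans ?_
    rw [hs]
    simp
    omega
  have hb (b : ℕ) (h : b ≤ W) : ∀ v, main n d b v ≤ W := main_le (by omega) (by omega) h
  have s₁ := h₁ W n m s (by omega) (by omega)
  rw [← hd] at s₁
  have s₂ : (addE (.inl .b) [none, none, some .n, some .d, some .d]).Runs
      (stk (start n d) (str s [] [] [])) (stk (main n d (n + 2 + 2 * d)) (str s [] [] []))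
      (t₂ W) := by
    have e : start n d = main n d 0 := by
      funext v; cases v <;> simp [main, start]
    refine (h₂ W (start n d) _ (e ▸ hb 0 (by omega)) rfl).congr ?_ le_rfl
    rw [main]
    congr 2
    simp [val, start]
    omega
  -- the first block of wires
  set B := n + 2 + 2 * d with hB
  have s₃ : (addE (.inl .w) [none, some .b]).Runs (stk (main n d B) (str s [] [] []))
      (stk (update (main n d B) .w (B + 1)) (str s [] [] [])) (t₃ W) := by
    refine (h₃ W _ _ (hb B (by omega)) rfl).congr ?_ le_rfl
    congr 2
    simp [val, main, start]
  have hb₃ : ∀ v, update (main n d B) .w (B + 1) v ≤ W := update_le (hb B (by omega)) (by omega) _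
  have s₄ : (addE (.inl .i) [some .d, some .d]).Runs
      (stk (update (main n d B) .w (B + 1)) (str s [] [] []))
      (stk (update (update (main n d B) .w (B + 1)) .i (2 * d)) (str s [] [] [])) (t₄ W) := by
    refine (h₄ W _ _ hb₃ rfl).congr ?_ le_rfl
    congr 2
    simp [val, main, start, two_mul]
  have e₅ : update (update (main n d B) .w (B + 1)) .i (2 * d) .w +
      update (update (main n d B) .w (B + 1)) .i (2 * d) .i *
        val (update (update (main n d B) .w (B + 1)) .i (2 * d)) [some .d] = A + 1 := by
    simp [val, main, start]
    omega
  have s₅ : (forCtr .i (addE (.inl .w) [some .d])).Runs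
      (stk (update (update (main n d B) .w (B + 1)) .i (2 * d)) (str s [] [] []))
      (stk (update (main n d B) .w (A + 1)) (str s [] [] [])) (t₅ W) := by
    refine (h₅ W _ _ (update_le hb₃ (by omega) _) (by rw [e₅]; omega) rfl).congr ?_ le_rfl
    rw [e₅]
    congr 1
    funext v
    cases v <;> simp [main, start]
  have ew (i : ℕ) (h : i = 0) : update (main n d B) .w i = main n d B := by
    subst h
    funext v
    cases v <;> simp [main, start]
  have s₆ : (forCtr .w (emitOut [[some .w]])).Runs
      (stk (update (main n d B) .w (A + 1)) (str s [] [] []))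
      (stk (main n d B) (str s [] [] ((List.range (A + 1)).flatMap natCode))) (t₆ W) := by
    refine (h₆ W _ (A + 1) _ _ _ _ (hb B (by omega)) (by omega)).congr ?_ le_rfl
    rw [ew 0 rfl]
    simp [val]
  set foot := (5 :: List.range (A + 1)).flatMap natCode with hfoot
  have s₇ : (emitOut [[none, none, none, none, none]]).Runs
      (stk (main n d B) (str s [] [] ((List.range (A + 1)).flatMap natCode)))
      (gst foot (main n d B) s [] []) (t₇ W) := by
    refine (h₇ W _ _ _ _ _ (hb B (by omega))).congr ?_ le_rfl
    simp [gst, val, hfoot, gatesCode, invList]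
  have s₈ := h₈ W foot (main n d B) s [] [] (hb B (by omega))
  set us₀ := notGates n ++ notGates (n + 1) with hus₀
  have s₈' := s₈.congr (t' := t₈ W) (S'' := gst foot (main n d B) s [] us₀)
    (by simp [SGate.eval, val, main, start, hus₀, notGates]) le_rfl
  have s₉ : (addE (.inl .i) [some .d, some .d]).Runs (gst foot (main n d B) s [] us₀)
      (gst foot (update (main n d B) .i (2 * d)) s [] us₀) (t₄ W) := by
    refine (h₄ W _ _ (hb B (by omega)) rfl).congr ?_ le_rfl
    rw [gst]
    congr 2
    simp [val, main, start, two_mul]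
  have hmul (i : ℕ) : (2 * d - i) * d ≤ 2 * d * d := Nat.mul_le_mul_right _ (Nat.sub_le _ _)
  have hstep (i : ℕ) (hi : i < 2 * d) :
      B + (2 * d - i) * d = B + (2 * d - (i + 1)) * d + d := by
    rw [show 2 * d - i = 2 * d - (i + 1) + 1 by omega, Nat.add_mul]
    omega
  have s₁₀ := runs_forCtr_gst (v := .i) (F := trial) (foot := foot) (qs := s) (qr := [])
    (fun i => update (main n d (B + (2 * d - i) * d)) .i i)
    (fun i => trials n d o us i (B + (2 * d - i) * d))
    (fun i => QSim.trial n d o us (B + (2 * d - (i + 1)) * d)) (T := t₉ W) rfl (m := 2 * d)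
    (fun i _ => update_self ..) (fun i hi => by
      rw [hstep i hi]
      rfl)
    (fun i hi us' => by
      have hbi : ∀ v, update (main n d (B + (2 * d - (i + 1)) * d)) .i i v ≤ W :=
        update_le (hb _ (by have := hmul (i + 1); omega)) (by omega) _
      refine (h₉ W foot (update (main n d (B + (2 * d - (i + 1)) * d)) .i i) n 1 o gs s us' hbi
        ?_ ?_ ?_ ?_ ?_ ?_ hs (by omega)).congr' ?_ ?_ le_rfl
      any_goals simp [main, start]; try omega
      · rw [← hstep i hi]
        congr 1
        funext v
        cases v <;> simp) us₀
  have eB : B + (2 * d - 0) * d = A := by rw [Nat.sub_zero, hA']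
  have ei (b : ℕ) : update (main n d b) .i 0 = main n d b := by
    funext v
    cases v <;> simp [main, start]
  set vs := compute n d o us with hvs
  have s₁₀' := s₁₀.congr (t' := W * (t₉ W + 1) + 2) (S'' := gst foot (main n d A) s [] vs)
    (by
      rw [eB, ei, Nat.sub_self, Nat.zero_mul, Nat.add_zero, hvs, compute, hus₀, List.append_assoc])
    (by have := Nat.mul_le_mul_right (t₉ W + 1) (show 2 * d ≤ W by omega); omega)
  rw [Nat.sub_self, Nat.zero_mul, Nat.add_zero] at s₁₀'
  have s₁₁ : (addE (.inl .j) [none, some .d]).Runs (gst foot (main n d A) s [] vs)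
      (gst foot (update (main n d A) .j (d + 1)) s [] vs) (t₁₀ W) := by
    refine (h₁₀ W _ _ (hb A (by omega)) rfl).congr ?_ le_rfl
    rw [gst]
    congr 2
    simp [val, main, start]
  have ej : update (main n d A) .j 0 = main n d A := by
    funext v
    cases v <;> simp [main, start]
  have s₁₂ : (forCtr .j (emitOut [[], [some .n], [some .j, none, some .n], [some .b]])).Runs
      (gst foot (update (main n d A) .j (d + 1)) s [] vs)
      (stk (main n d A) (str s [] (gatesCode vs).reverse
        (gatesCode (flips n A (d + 1)) ++ (gatesCode (invList vs) ++ foot)))) (t₁₁ W) := by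
    refine (h₁₁ W (main n d A) (d + 1) _ _ _ _ (hb A (by omega)) (by omega)).congr ?_ le_rfl
    have ef : gatesCode (flips n A (d + 1)) = (List.range (d + 1)).flatMap fun i =>
        [0, n, n + 1 + i, A].flatMap natCode := by
      rw [flips_eq, gatesCode, List.map_map, List.flatMap_map, List.flatMap_assoc]
      rfl
    rw [ej, ef]
    simp [val, main, start]
  have s₁₃ : (move (.inr .aux) (.inr .out)).Runs (stk (main n d A) (str s [] (gatesCode vs).reverse
        (gatesCode (flips n A (d + 1)) ++ (gatesCode (invList vs) ++ foot))))
      (stk (main n d A) (str s [] [] (gatesCode vs ++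
        (gatesCode (flips n A (d + 1)) ++ (gatesCode (invList vs) ++ foot)))))
      ((8 + W * (W * 6)) * (4 * (W + 1)) * 2 + 2) := by
    refine (runs_move (by simp) _).congr (by simp) ?_
    have h1 : vs.length ≤ 8 + W * (W * 6) := by
      rw [hvs, length_compute]
      have : us.length ≤ gs.length := length_unitaries_le gs
      exact Nat.add_le_add_left (Nat.mul_le_mul (by omega) (by omega)) 8
    have h2 := (length_gatesCode_le hvalid).trans (Nat.mul_le_mul h1
      (Nat.mul_le_mul_left 4 (show A + 1 ≤ W + 1 by omega)))
    rw [stk_inr, str_aux, List.length_reverse]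
    omega
  have s₁₄ : (emitOut [[none, some .b], [none, some .b]]).Runs
      (stk (main n d A) (str s [] [] (gatesCode vs ++
        (gatesCode (flips n A (d + 1)) ++ (gatesCode (invList vs) ++ foot)))))
      (stk (main n d A) (str s [] [] ([A + 1, A + 1].flatMap natCode ++ (gatesCode vs ++
        (gatesCode (flips n A (d + 1)) ++ (gatesCode (invList vs) ++ foot)))))) (t₁₂ W) := by
    refine (h₁₂ W _ _ _ _ _ (hb A (by omega))).congr ?_ le_rfl
    simp [val, main]
  set out := [A + 1, A + 1].flatMap natCode ++ (gatesCode vs ++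
    (gatesCode (flips n A (d + 1)) ++ (gatesCode (invList vs) ++ foot)))
  -- only the stack `out` may be left nonempty
  have s₁₅ := runs_clear_inl .n (main n d A) (str s [] [] out)
  have s₁₆ := runs_clear_inl .d (update (main n d A) .n 0) (str s [] [] out)
  have s₁₇ := runs_clear_inl .b (update (update (main n d A) .n 0) .d 0) (str s [] [] out)
  have s₁₈ := runs_clear (.inr .qs)
    (stk (update (update (update (main n d A) .n 0) .d 0) .b 0) (str s [] [] out))
  refine (s₁.seq <| s₂.seq <| s₃.seq <| s₄.seq <| s₅.seq <| s₆.seq <| s₇.seq <| s₈'.seq <|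
    s₉.seq <| s₁₀'.seq <| s₁₁.seq <| s₁₂.seq <| s₁₃.seq <| s₁₄.seq <|
    (s₁₅.mono (t' := W * 2 + 2) ?_).seq <| (s₁₆.mono (t' := W * 2 + 2) ?_).seq <|
    (s₁₇.mono (t' := W * 2 + 2) ?_).seq (s₁₈.mono (t' := W * 2 + 2) ?_)).congr ?_ le_rfl
  · have := hb A (by omega) .n
    omega
  · simp [main, start]; omega
  · simp [main, start]; omega
  · simp; omega
  · funext k
    rcases k with k | k <;> cases k <;> simp [main, start]

end Prog

end StackProg

/-! ### The subroutine theorem -/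

open StackProg QSim in
/-- The number of ancillary wires is computed by the program `Prog.width`. -/
theorem polyBounded_width {F : ℕ → List Bool} (hF : PolyTimeStrings F) {p : ℕ → ℕ}
    (hp : PolyBounded p) {D : ℕ → ℕ} (hD : ∀ n, D n = (F n).length + 6 * p n) :
    PolyBounded fun n => 2 + 2 * D n + 2 * D n * D n := by
  have key : PolyTimeStrings fun n => unary (2 + 2 * D n + 2 * D n * D n) := by
    obtain ⟨t, ht, h⟩ := Prog.exists_runs_width
    have hW : PolyLE fun x => x + (2 + 2 * (6 * x) + 2 * (6 * x) * (6 * x)) := by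
      have h6 : PolyLE fun x => 6 * x := (PolyLE.const 6).mul .id
      exact PolyLE.id.add (((PolyLE.const 2).add ((PolyLE.const 2).mul h6)).add
        (((PolyLE.const 2).mul h6).mul h6))
    obtain ⟨P, hP⟩ := ht.comp hW
    refine polyTimeStrings_of_program (.inl .n) (.inr .qr) (.inl .p) (.inr .out) (by simp) (by simp)
      (by simp) Prog.width hF hp P fun n => (h _ n (p n) (F n) (D n) (hD n) ?_).mono (hP _)
    have h6 : D n ≤ 6 * (n + (F n).length + p n) := by rw [hD]; omega
    have hn : n ≤ n + (F n).length + p n := by omega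
    gcongr
  obtain ⟨h⟩ := key
  exact ⟨⟨h.toTM2ComputableAux, h.time, fun n => by
    rw [unaryEncodeNat_eq (2 + 2 * D n + 2 * D n * D n)]
    exact h.outputsFun n⟩⟩

open StackProg QSim in
/-- The program `Prog.amplify` needs the code of the circuit only, so it works for all `n` at once.
-/
theorem polyTimeStrings_amplified {Q : ∀ n, QCircuit n 1} (hQ : PolyTimeGenerated Q) {p : ℕ → ℕ}
    (hp : PolyBounded p) {D : ℕ → ℕ} (hD : ∀ n, D n = (Q n).encode.length + 6 * p n)
    (hv : ∀ n, ∀ u ∈ amplified n (D n) ((Q n).outputs 0) (unitaries (Q n).gates),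
      u.Valid (Finset.range (target n (D n) + 1))) :
    PolyTimeStrings fun n => (unitaryCircuit _ _ (hv n)).encode := by
  obtain ⟨t, ht, h⟩ := Prog.exists_runs_amplify
  -- all numbers are bounded by a polynomial in `x = n + |Q n| + p n`, as `D n ≤ 6 * x`
  have hW : PolyLE fun x => x + (2 + 2 * (6 * x) + 2 * (6 * x) * (6 * x)) + 1 := by
    have h6 : PolyLE fun x => 6 * x := (PolyLE.const 6).mul .id
    exact (PolyLE.id.add (((PolyLE.const 2).add ((PolyLE.const 2).mul h6)).add
      (((PolyLE.const 2).mul h6).mul h6))).add (.const 1)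
  obtain ⟨P, hP⟩ := ht.comp hW
  refine polyTimeStrings_of_program (.inl .n) (.inr .qr) (.inl .p) (.inr .out) (by simp) (by simp)
    (by simp) Prog.amplify hQ hp P fun n => ?_
  have hle : (Q n).encode.length ≤ D n := by rw [hD]; omega
  rw [Prog.encode_amplified (hv n)]
  refine (h _ n (p n) (Q n).encode (D n) ((Q n).outputs 0) (Q n).gates ?_ (hD n) ?_
    (valid_compute ((Nat.le_add_right _ _).trans (ancillas_le _ hle)) (output_lt _ hle)
      (valid_unitaries_gates _ hle))).mono (hP _)
  · simp [QCircuit.encode, QCircuit.code]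
  · have h6 : D n ≤ 6 * (n + (Q n).encode.length + p n) := by rw [hD]; omega
    have hn : n ≤ n + (Q n).encode.length + p n := by omega
    unfold target
    gcongr

open QSim in
theorem mainTheorem2 (A : PromiseProblem) (hA : A ∈ BQP) (p : ℕ → ℕ) (hp : PolyBounded p) :
    ∃ q : ℕ → ℕ, PolyBounded q ∧
    ∃ R : ∀ n : ℕ, QCircuit (n + q n + 1) (n + q n + 1), PolyTimeGenerated R ∧
    ∃ U : ∀ n : ℕ, Matrix (Fin (n + q n + 1) → Bool) (Fin (n + q n + 1) → Bool) ℂ,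
      (∀ n, (R n).ImplementsUnitary (U n)) ∧
      (∀ x ∈ A.yes, ∀ a : Bool,
        ((1 - 2⁻¹ ^ p x.length : ℝ) : ℂ) ≤
          U x.length (queryState x (q x.length) (xor a true)) (queryState x (q x.length) a)) ∧
      (∀ x ∈ A.no, ∀ a : Bool,
        ((1 - 2⁻¹ ^ p x.length : ℝ) : ℂ) ≤
          U x.length (queryState x (q x.length) a) (queryState x (q x.length) a)) := by
  obtain ⟨Q, hQ, hyes, hno⟩ := hA
  let D : ℕ → ℕ := fun n => (Q n).encode.length + 6 * p n
  have hle (n) : (Q n).encode.length ≤ D n := Nat.le_add_right _ _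
  have hv (n) : ∀ u ∈ amplified n (D n) ((Q n).outputs 0) (unitaries (Q n).gates),
      u.Valid (Finset.range (target n (D n) + 1)) :=
    valid_amplified ((Nat.le_add_right _ _).trans (ancillas_le _ (hle n))) (output_lt _ (hle n))
      (valid_unitaries_gates _ (hle n))
  refine ⟨fun n => 2 + 2 * D n + 2 * D n * D n, polyBounded_width hQ hp fun _ => rfl,
    fun n => unitaryCircuit _ _ (hv n), polyTimeStrings_amplified hQ hp (fun _ => rfl) hv,
    fun n => circuitMatrix _ _, fun n => implementsUnitary_unitaryCircuit _ _ (hv n),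
    fun x hx a => ?_, fun x hx a => ?_⟩
  · exact one_sub_le_amplitude x (Q x.length) (hle _) (Nat.le_add_left _ _) a true (by
      simpa using hyes x hx)
  · have h := one_sub_le_amplitude x (Q x.length) (hle _) (Nat.le_add_left _ _) a false (by
      have := hno x hx
      simp only [Bool.false_eq_true, if_false]
      linarith)
    rwa [Bool.xor_false] at h
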